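/- Let $q:G'\to G$ be a surjective homomorphism of groups with finite kernel $\Gamma$, let $W$ be a closed connected oriented (triangulated) surface of positive genus with fundamental group $\pi=\pi_1(W)$ and fundamental class $[W]\in H_2(W)=H_2(\pi)$, and let $\theta=\{\theta_{a,b}\in\mathbb{C}^*\}_{a,b\in G'}$ be a 2-cocycle on $G'$ with class $[\theta]\in H^2(G';\mathbb{C}^*)$ (trivial action on $\mathbb C^*$). A $\theta$-representation of $\Gamma$ of dimension $n\ge 1$ is a map $\rho:\Gamma\to GL_n(\mathbb{C})$ with $\rho(g)\rho(h)=\theta_{g,h}\,\rho(gh)$ for all $g,h\in\Gamma$ (so $\rho(1)=\theta_{1,1}I_n$, which is $I_n$ when $\theta_{1,1}=1$); it is irreducible if $0$ and $\mathbb{C}^n$ are the only subspaces of $\mathbb C^n$ preserved by all $\rho(h)$, and $\rho,\rho'$ are equivalent if they have the same dimension and $\rho'=M^{-1}\rho M$ for some $M\in GL_n(\mathbb{C})$. For $a\in G'$ put $$(a\rho)(h)=\frac{\theta_{a^{-1},ha}\,\theta_{h,a}}{\theta_{a,a^{-1}}\,\theta_{1,1}}\;\rho(a^{-1}ha)\qquad(h\in\Gamma),$$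 and let $G_\rho\subset G$ be the subgroup of all $\alpha\in G$ such that $a\rho$ is equivalent to $\rho$ for some $a\in q^{-1}(\alpha)$. For irreducible $\rho$, choose for each $\alpha\in G_\rho$ an element $\widetilde\alpha\in q^{-1}(\alpha)$ and a matrix $M_\alpha$ with $\widetilde\alpha\rho=M_\alpha^{-1}\rho M_\alpha$, and let $\zeta_\rho\in H^2(G_\rho;\mathbb{C}^*)$ be the class of the 2-cocycle $\{\zeta_{\alpha,\beta}\}$ determined by $$\zeta_{\alpha,\beta}\,M_\alpha M_\beta=\theta_{\widetilde\alpha,\widetilde\beta}\;\theta^{-1}_{\widetilde{\alpha\beta},\,\gamma}\;M_{\alpha\beta}\,\rho(\gamma),\qquad \gamma=\widetilde{\alpha\beta}^{-1}\widetilde\alpha\widetilde\beta\in\Gamma .$$ Theorem. For every homomorphism $g:\pi\to G$, the set $\mathrm{Hom}_g(\pi,G')$ of homomorphisms $g':\pi\to G'$ with $qg'=g$ is finite, the set of equivalence classes of irreducible $\theta$-representations of $\Gamma$ is finite, and $$\sum_{g'\in \mathrm{Hom}_g(\pi,G')}(g')^*([\theta])([W])\;=\;|\Gamma|\sum_{\rho,\;G_\rho\supset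 g(\pi)}\left(\frac{|\Gamma|}{\dim\rho}\right)^{-\chi(W)}g^*(\zeta_\rho)([W]),$$ where $\rho$ runs over the equivalence classes of irreducible $\theta$-representations of $\Gamma$ with $G_\rho\supset g(\pi)$, and $(g')^*([\theta])([W])$, $g^*(\zeta_\rho)([W])\in\mathbb{C}^*$ are the evaluations on $[W]$ of classes in $H^2(\pi;\mathbb{C}^*)$. -/

import Mathlib

open CategoryTheory

noncomputable section

/-! ### Second cohomology with coefficients in `ℂˣ` and second homology of a group

Trivial coefficients throughout, by the inhomogeneous (bar) complexes. -/

namespace GrpTwo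

variable {G : Type*} [Group G] {H : Type*} [Group H]

/-- The group `Z²(G; ℂˣ)` of 2-cocycles `θ = {θ_{a,b}}`. -/
def cocycles (G : Type*) [Group G] : Subgroup (G → G → ℂˣ) where
  carrier := {θ | ∀ a b c, θ a b * θ (a * b) c = θ a (b * c) * θ b c}
  one_mem' := by intro a b c; simp
  mul_mem' := by
    intro θ η hθ hη a b c
    simp only [Pi.mul_apply]
    rw [mul_mul_mul_comm, hθ, hη, mul_mul_mul_comm]
  inv_mem' := by
    intro θ hθ a b c
    simp only [Pi.inv_apply]
    rw [← mul_inv, hθ, mul_inv]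

/-- The coboundary `(δ b)_{x,y} = b_x b_y b_{xy}⁻¹` of a 1-cochain. -/
def coboundary (G : Type*) [Group G] : (G → ℂˣ) →* (G → G → ℂˣ) where
  toFun b := fun x y => b x * b y * (b (x * y))⁻¹
  map_one' := by ext; simp
  map_mul' b c := by
    funext x y
    simp only [Pi.mul_apply, mul_inv]
    rw [mul_mul_mul_comm (b x) (c x), mul_mul_mul_comm]

/-- The cohomology group `H²(G; ℂˣ)`. -/
abbrev Cohomology (G : Type*) [Group G] : Type _ :=
  cocycles G ⧸ (coboundary G).range.subgroupOf (cocycles G)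

/-- The cohomology class `[θ]` of a 2-cocycle. -/
def cls (θ : cocycles G) : Cohomology G := QuotientGroup.mk θ

/-- Pullback of cocycles along a homomorphism. -/
def cocyclesMap (f : H →* G) : cocycles G →* cocycles H where
  toFun θ := ⟨fun a b => θ.1 (f a) (f b), by
    intro a b c
    simpa only [map_mul] using θ.2 (f a) (f b) (f c)⟩
  map_one' := rfl
  map_mul' _ _ := rfl

/-- The homomorphism `f^* : H²(G; ℂˣ) → H²(H; ℂˣ)` induced by `f : H → G`. -/
def pullback (f : H →* G) : Cohomology G →* Cohomology H :=
  QuotientGroup.map _ _ (cocyclesMap f) (by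
    rintro θ ⟨b, hb⟩
    refine ⟨fun x => b (f x), ?_⟩
    change _ = (cocyclesMap f θ).1
    funext x y
    have := congrFun (congrFun hb (f x)) (f y)
    simpa [coboundary, cocyclesMap] using this)

/-- The boundary `∂[x|y] = [y] - [xy] + [x]` of the bar complex. -/
def bd₂ (G : Type*) [Group G] : (G × G →₀ ℤ) →+ (G →₀ ℤ) :=
  Finsupp.liftAddHom fun p => (zmultiplesHom _)
    (Finsupp.single p.2 1 - Finsupp.single (p.1 * p.2) 1 + Finsupp.single p.1 1)

/-- The boundary `∂[x|y|z] = [y|z] - [xy|z] + [x|yz] - [x|y]` of the bar complex. -/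
def bd₃ (G : Type*) [Group G] : (G × G × G →₀ ℤ) →+ (G × G →₀ ℤ) :=
  Finsupp.liftAddHom fun p => (zmultiplesHom _)
    (Finsupp.single (p.2.1, p.2.2) 1 - Finsupp.single (p.1 * p.2.1, p.2.2) 1
      + Finsupp.single (p.1, p.2.1 * p.2.2) 1 - Finsupp.single (p.1, p.2.1) 1)

/-- The homology group `H₂(G) = H₂(G; ℤ)`. -/
abbrev Homology (G : Type*) [Group G] : Type _ :=
  (bd₂ G).ker ⧸ (bd₃ G).range.addSubgroupOf (bd₂ G).ker

/-- Evaluation of a 2-cochain on a 2-chain: `Σ mᵢ [xᵢ|yᵢ] ↦ ∏ c(xᵢ, yᵢ) ^ mᵢ`, written with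
values in the additive group of `ℂˣ`. -/
def evalChain {X : Type*} (c : X → X → ℂˣ) : (X × X →₀ ℤ) →+ Additive ℂˣ :=
  Finsupp.liftAddHom fun p => (zmultiplesHom _) (Additive.ofMul (c p.1 p.2))

theorem evalChain_mul {X : Type*} (c d : X → X → ℂˣ) (z : X × X →₀ ℤ) :
    evalChain (c * d) z = evalChain c z + evalChain d z := by
  have : evalChain (c * d) = evalChain c + evalChain d := by
    refine Finsupp.addHom_ext fun p m => ?_
    simp [evalChain, zsmul_add]
  rw [this]; rfl

theorem evalChain_coboundary (b : G → ℂˣ) (z : G × G →₀ ℤ) :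
    evalChain (coboundary G b) z =
      (Finsupp.liftAddHom fun x => (zmultiplesHom _) (Additive.ofMul (b x))) (bd₂ G z) := by
  have : evalChain (coboundary G b) =
      (Finsupp.liftAddHom fun x => (zmultiplesHom _) (Additive.ofMul (b x))).comp (bd₂ G) := by
    refine Finsupp.addHom_ext fun p m => ?_
    simp only [evalChain, coboundary, bd₂, AddMonoidHom.comp_apply, Finsupp.liftAddHom_apply_single,
      zmultiplesHom_apply, map_zsmul, map_add, map_sub, one_smul]
    congr 1
    simp only [MonoidHom.coe_mk, OneHom.coe_mk, ofMul_mul, ofMul_inv]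
    abel
  rw [this]; rfl

theorem evalChain_bd₃ (c : cocycles G) (z : G × G × G →₀ ℤ) :
    evalChain c.1 (bd₃ G z) = 0 := by
  have : (evalChain c.1).comp (bd₃ G) = 0 := by
    refine Finsupp.addHom_ext fun p m => ?_
    simp only [evalChain, bd₃, AddMonoidHom.comp_apply, Finsupp.liftAddHom_apply_single,
      zmultiplesHom_apply, map_zsmul, map_add, map_sub, one_smul, AddMonoidHom.zero_apply]
    have h := congrArg Additive.ofMul (c.2 p.1 p.2.1 p.2.2)
    simp only [ofMul_mul] at h
    rw [show ∀ a b d e : Additive ℂˣ, a - b + d - e = (d + a) - (e + b) by intros; abel, ← h]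
    simp
  exact DFunLike.congr_fun this z

/-- The evaluation `x(y) ∈ ℂˣ` of a class `x ∈ H²(G; ℂˣ)` on a class `y ∈ H₂(G)`. -/
def eval (x : Cohomology G) (y : Homology G) : ℂˣ :=
  Quotient.liftOn₂' x y (fun c z => (evalChain c.1 z.1).toMul) (by
    intro c z c' z' hc hz
    rw [QuotientGroup.leftRel_apply] at hc
    rw [QuotientAddGroup.leftRel_apply] at hz
    obtain ⟨b, hb⟩ := hc
    obtain ⟨t, ht⟩ := hz
    have h1 : c'.1 = c.1 * coboundary G b := by
      rw [hb]
      change c'.1 = c.1 * (c.1⁻¹ * c'.1)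
      group
    have h2 : z'.1 = z.1 + bd₃ G t := by
      rw [ht]
      change z'.1 = z.1 + (-z.1 + z'.1)
      abel
    have h3 : evalChain (coboundary G b) z'.1 = 0 := by
      rw [evalChain_coboundary, show bd₂ G z'.1 = 0 from z'.2, map_zero]
    have h4 : evalChain c'.1 z'.1 = evalChain c.1 z.1 := by
      rw [h1, evalChain_mul, h3, h2, map_add, evalChain_bd₃]
      simp
    simp only [h4])

end GrpTwo

/-! ### Closed oriented surfaces -/

/-- A finite oriented simplicial complex with vertices `0, …, n-1` whose underlying polyhedron is a
closed oriented surface (combinatorial 2-manifold). `Tri a b c` says that `a, b, c` span a triangle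
and that the cyclic order `(a, b, c)` is the positive one. -/
structure SurfaceComplex (n : ℕ) where
  Tri : Fin n → Fin n → Fin n → Prop
  rot : ∀ {a b c}, Tri a b c → Tri b c a
  ne : ∀ {a b c}, Tri a b c → a ≠ b
  /-- a triangle is positive in only one of its two cyclic orders -/
  asymm : ∀ {a b c}, Tri a b c → ¬ Tri b a c
  /-- an edge lies in exactly two triangles, which induce opposite directions on it -/
  edge_unique : ∀ {a b c d}, Tri a b c → Tri a b d → c = d
  edge_reverse : ∀ {a b c}, Tri a b c → ∃ d, Tri b a d
  /-- every vertex lies in a triangle, and its link is a single circle -/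
  vertex_mem : ∀ a, ∃ b c, Tri a b c
  link_connected : ∀ {a b c b' c'}, Tri a b c → Tri a b' c' →
    Relation.ReflTransGen (fun x y => Tri a x y) b b'

namespace SurfaceComplex

variable {n : ℕ} (K : SurfaceComplex n)

/-- The closed simplex spanned by a set of vertices. -/
def simplex (s : Set (Fin n)) : Set (Fin n → ℝ) :=
  {x | x ∈ stdSimplex ℝ (Fin n) ∧ ∀ v, x v ≠ 0 → v ∈ s}

/-- The underlying polyhedron, with vertices at the standard basis vectors of `ℝⁿ`. -/
def realization : Set (Fin n → ℝ) :=
  {x | ∃ a b c, K.Tri a b c ∧ x ∈ simplex {a, b, c}}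

/-- The number of vertices minus the number of edges plus the number of triangles. -/
def eulerChar : ℤ :=
  (n : ℤ) - ({s | ∃ a b c, K.Tri a b c ∧ s = {a, b}} : Set (Finset (Fin n))).ncard
    + ({s | ∃ a b c, K.Tri a b c ∧ s = {a, b, c}} : Set (Finset (Fin n))).ncard

/-- `a` and `b` span an edge (symmetric, by `edge_reverse`). -/
def Adj (a b : Fin n) : Prop := ∃ c, K.Tri a b c

theorem convex_simplex (s : Set (Fin n)) : Convex ℝ (simplex s) := by
  intro x hx y hy a b ha hb hab
  refine ⟨convex_stdSimplex ℝ (Fin n) hx.1 hy.1 ha hb hab, fun v hv => ?_⟩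
  by_cases h1 : x v = 0
  · by_cases h2 : y v = 0
    · simp [h1, h2] at hv
    · exact hy.2 v h2
  · exact hx.2 v h1

theorem single_mem_simplex {s : Set (Fin n)} {a : Fin n} (ha : a ∈ s) :
    (Pi.single a 1 : Fin n → ℝ) ∈ simplex s := by
  refine ⟨single_mem_stdSimplex ℝ a, fun v hv => ?_⟩
  by_cases h : v = a
  · exact h ▸ ha
  · simp [h] at hv

/-- A vertex as a point of the polyhedron. -/
def vertex (a : Fin n) : K.realization :=
  ⟨Pi.single a 1, by
    obtain ⟨b, c, h⟩ := K.vertex_mem a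
    exact ⟨a, b, c, h, single_mem_simplex (by simp)⟩⟩

theorem segment_mem {s : Set (Fin n)} {a b : Fin n} (ha : a ∈ s) (hb : b ∈ s) (t : unitInterval) :
    (AffineMap.lineMap (Pi.single a 1) (Pi.single b 1) (t : ℝ) : Fin n → ℝ) ∈ simplex s :=
  (convex_simplex s).lineMap_mem (single_mem_simplex ha) (single_mem_simplex hb) t.2

theorem simplex_subset {a b c : Fin n} (h : K.Tri a b c) {s : Set (Fin n)}
    (hs : s ⊆ {a, b, c}) : simplex s ⊆ K.realization :=
  fun _ hx => ⟨a, b, c, h, hx.1, fun v hv => hs (hx.2 v hv)⟩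

/-- The straight path along an edge. -/
def edgePath {a b : Fin n} (h : K.Adj a b) : Path (K.vertex a) (K.vertex b) where
  toFun t := ⟨AffineMap.lineMap (Pi.single a 1) (Pi.single b 1) (t : ℝ),
    K.simplex_subset h.choose_spec (s := {a, b}) (by intro v; simp; tauto)
      (segment_mem (by simp) (by simp) t)⟩
  continuous_toFun := by
    refine Continuous.subtype_mk ?_ _
    exact AffineMap.lineMap_continuous.comp continuous_subtype_val
  source' := by apply Subtype.ext; simp [vertex]
  target' := by apply Subtype.ext; simp [vertex]

theorem edgePath_trans {a b c : Fin n} (hab : K.Adj a b) (hbc : K.Adj b c) (hac : K.Adj a c)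
    {x y z : Fin n} (h : K.Tri x y z) (ha : a ∈ ({x, y, z} : Set (Fin n)))
    (hb : b ∈ ({x, y, z} : Set (Fin n))) (hc : c ∈ ({x, y, z} : Set (Fin n))) :
    ((K.edgePath hab).trans (K.edgePath hbc)).Homotopic (K.edgePath hac) := by
  set s : Set (Fin n) := {x, y, z}
  have : ContractibleSpace (simplex s) :=
    (convex_simplex s).contractibleSpace ⟨_, single_mem_simplex ha⟩
  let P : ∀ {u v : Fin n} (hu : u ∈ s) (hv : v ∈ s),
      Path (⟨Pi.single u 1, single_mem_simplex hu⟩ : simplex s)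
        ⟨Pi.single v 1, single_mem_simplex hv⟩ := fun {u v} hu hv =>
    { toFun := fun t => ⟨_, segment_mem hu hv t⟩
      continuous_toFun := by
        refine Continuous.subtype_mk ?_ _
        exact AffineMap.lineMap_continuous.comp continuous_subtype_val
      source' := by apply Subtype.ext; simp
      target' := by apply Subtype.ext; simp }
  let ι : C(simplex s, K.realization) :=
    ⟨Set.inclusion (K.simplex_subset h subset_rfl), continuous_inclusion _⟩
  have key := (SimplyConnectedSpace.paths_homotopic ((P ha hb).trans (P hb hc)) (P ha hc)).map ι
  rw [Path.map_trans] at key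
  exact key

end SurfaceComplex

/-- The structure of a closed oriented surface on a topological space `W`: an oriented triangulation
of `W` as a closed 2-manifold. -/
structure ClosedOrientedSurface (W : Type*) [TopologicalSpace W] where
  n : ℕ
  K : SurfaceComplex n
  homeo : K.realization ≃ₜ W

namespace ClosedOrientedSurface

variable {W : Type*} [TopologicalSpace W] (S : ClosedOrientedSurface W)

/-- The Euler characteristic `χ(W)`. -/
def eulerChar : ℤ := S.K.eulerChar

/-- A vertex of the triangulation as a point of `W`. -/
abbrev vertex (a : Fin S.n) : W := S.homeo (S.K.vertex a)

/-- An oriented edge of the triangulation as a homotopy class of paths in `W`. -/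
def edge {a b : Fin S.n} (h : S.K.Adj a b) :
    Path.Homotopic.Quotient (S.vertex a) (S.vertex b) :=
  Path.Homotopic.Quotient.mk ((S.K.edgePath h).map S.homeo.continuous)

open Classical in
/-- The sign of an ordered triangle with respect to the orientation (zero if there is none). -/
def sign (a b c : Fin S.n) : ℤ :=
  (if S.K.Tri a b c then 1 else 0) - (if S.K.Tri b a c then 1 else 0)

theorem sign_rot (a b c : Fin S.n) : S.sign a b c = S.sign b c a := by
  have h1 : S.K.Tri a b c ↔ S.K.Tri b c a := ⟨S.K.rot, fun h => S.K.rot (S.K.rot h)⟩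
  have h2 : S.K.Tri b a c ↔ S.K.Tri c b a :=
    ⟨fun h => S.K.rot (S.K.rot h), S.K.rot⟩
  classical
  unfold sign
  exact congrArg₂ _ (if_congr h1 rfl rfl) (if_congr h2 rfl rfl)

theorem sign_swap (a b c : Fin S.n) : S.sign b a c = -S.sign a b c := by
  simp only [sign]; ring

theorem sum_sign (a b : Fin S.n) : ∑ c, S.sign a b c = 0 := by
  classical
  have h : ∀ x y : Fin S.n, S.K.Adj x y → ∑ c, (if S.K.Tri x y c then (1 : ℤ) else 0) = 1 := by
    rintro x y ⟨d, hd⟩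
    rw [Finset.sum_eq_single d, if_pos hd]
    · intro c _ hc
      exact if_neg fun h => hc (S.K.edge_unique h hd)
    · simp
  simp only [sign, Finset.sum_sub_distrib]
  by_cases hab : S.K.Adj a b
  · obtain ⟨c, hc⟩ := hab
    rw [h a b ⟨c, hc⟩, h b a (S.K.edge_reverse hc), sub_self]
  · have hba : ¬ S.K.Adj b a := fun ⟨c, hc⟩ => hab (S.K.edge_reverse hc)
    rw [Finset.sum_eq_zero fun c _ => if_neg fun h => hab ⟨c, h⟩,
      Finset.sum_eq_zero fun c _ => if_neg fun h => hba ⟨c, h⟩, sub_self]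

variable [PathConnectedSpace W] (w : W)

/-- A path from the base point to each vertex. -/
def tail (a : Fin S.n) : Path.Homotopic.Quotient w (S.vertex a) :=
  Path.Homotopic.Quotient.mk (PathConnectedSpace.somePath w (S.vertex a))

open Classical in
/-- The element of `π₁(W, w)` attached to the edge `ab`. In Mathlib's fundamental group `x * y` is
the loop `y` followed by the loop `x`, so the edge from `a` to `b` is traversed from `b` to `a`:
then the elements attached to `ab`, `bc` multiply to the one attached to `ac`. -/
def edgeElt (a b : Fin S.n) : FundamentalGroup W w :=
  if h : S.K.Adj b a then
    FundamentalGroup.fromPath (((S.tail w b).trans (S.edge h)).trans (S.tail w a).symm)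
  else 1

/-- The sum of all triangles with their orientation signs, as a 2-chain in the bar complex of
`π₁(W, w)`. -/
def fundamentalChain : FundamentalGroup W w × FundamentalGroup W w →₀ ℤ :=
  ∑ a, ∑ b, ∑ c, if a < b ∧ b < c then
    S.sign a b c • Finsupp.single (S.edgeElt w a b, S.edgeElt w b c) 1 else 0

theorem edgeElt_mul {a b c x y z : Fin S.n} (h : S.K.Tri x y z)
    (ha : a ∈ ({x, y, z} : Set (Fin S.n))) (hb : b ∈ ({x, y, z} : Set (Fin S.n)))
    (hc : c ∈ ({x, y, z} : Set (Fin S.n)))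
    (hba : S.K.Adj b a) (hcb : S.K.Adj c b) (hca : S.K.Adj c a) :
    S.edgeElt w a b * S.edgeElt w b c = S.edgeElt w a c := by
  have key : (S.edge hcb).trans (S.edge hba) = S.edge hca := by
    unfold edge
    rw [← Path.Homotopic.Quotient.mk_trans, ← Path.map_trans]
    exact Path.Homotopic.Quotient.eq.2
      ((S.K.edgePath_trans hcb hba hca h hc hb ha).map ⟨S.homeo, S.homeo.continuous⟩)
  rw [edgeElt, edgeElt, edgeElt, dif_pos hba, dif_pos hcb, dif_pos hca, FundamentalGroup.mul_def,
    ← key]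
  simp only [Path.Homotopic.Quotient.trans_assoc]
  rw [← Path.Homotopic.Quotient.trans_assoc (S.tail w b).symm,
    Path.Homotopic.Quotient.symm_trans, Path.Homotopic.Quotient.refl_trans]

theorem sign_mul (a b c : Fin S.n) (h : S.sign a b c ≠ 0) :
    S.edgeElt w a b * S.edgeElt w b c = S.edgeElt w a c := by
  have key : ∀ {x y z : Fin S.n}, S.K.Tri x y z →
      (S.K.Adj x y ∧ S.K.Adj y z ∧ S.K.Adj z x) ∧ S.K.Adj y x ∧ S.K.Adj z y ∧ S.K.Adj x z :=
    fun h => ⟨⟨⟨_, h⟩, ⟨_, S.K.rot h⟩, ⟨_, S.K.rot (S.K.rot h)⟩⟩, S.K.edge_reverse h,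
      S.K.edge_reverse (S.K.rot h), S.K.edge_reverse (S.K.rot (S.K.rot h))⟩
  by_cases h1 : S.K.Tri a b c
  · obtain ⟨⟨h2, h3, h4⟩, h5, h6, h7⟩ := key h1
    exact S.edgeElt_mul w h1 (by simp) (by simp) (by simp) h5 h6 h4
  · by_cases h1' : S.K.Tri b a c
    · obtain ⟨⟨h2, h3, h4⟩, h5, h6, h7⟩ := key h1'
      exact S.edgeElt_mul w h1' (by simp) (by simp) (by simp) h2 h4 h6
    · simp [sign, h1, h1'] at h

theorem bd_fundamentalChain : GrpTwo.bd₂ _ (S.fundamentalChain w) = 0 := by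
  classical
  let f : Fin S.n → Fin S.n → (FundamentalGroup W w →₀ ℤ) :=
    fun a b => Finsupp.single (S.edgeElt w a b) 1
  have h0 : ∀ a b c, GrpTwo.bd₂ _ (if a < b ∧ b < c then
      S.sign a b c • Finsupp.single (S.edgeElt w a b, S.edgeElt w b c) 1 else 0) =
      (if a < b ∧ b < c then S.sign a b c • f a b else 0)
      + (if a < b ∧ b < c then S.sign b c a • f b c else 0)
      + (if a < b ∧ b < c then S.sign a c b • f a c else 0) := by
    intro a b c
    split_ifs with h
    · by_cases hs : S.sign a b c = 0
      · have h2 := S.sign_rot a b c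
        have h3 := S.sign_swap c a b
        rw [← S.sign_rot b c a |>.symm.symm, ← h2] at h3
        rw [hs] at h2 h3
        simp [hs, ← h2, h3]
      · rw [map_zsmul, GrpTwo.bd₂, Finsupp.liftAddHom_apply_single, S.sign_mul w a b c hs,
          ← S.sign_rot a b c, S.sign_swap c a b, S.sign_rot c a b]
        simp only [f, zmultiplesHom_apply, one_smul, smul_add, smul_sub, neg_smul]
        abel
    · simp
  rw [fundamentalChain]
  simp only [map_sum, h0, Finset.sum_add_distrib]
  have e2 : ∑ a, ∑ b, ∑ c, (if a < b ∧ b < c then S.sign b c a • f b c else 0) =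
      ∑ a, ∑ b, ∑ c, (if c < a ∧ a < b then S.sign a b c • f a b else 0) := by
    rw [Finset.sum_comm]
    refine Finset.sum_congr rfl fun a _ => ?_
    rw [Finset.sum_comm]
  have e3 : ∑ a, ∑ b, ∑ c, (if a < b ∧ b < c then S.sign a c b • f a c else 0) =
      ∑ a, ∑ b, ∑ c, (if a < c ∧ c < b then S.sign a b c • f a b else 0) := by
    refine Finset.sum_congr rfl fun a _ => ?_
    rw [Finset.sum_comm]
  rw [e2, e3]
  simp only [← Finset.sum_add_distrib]
  refine Finset.sum_eq_zero fun a _ => Finset.sum_eq_zero fun b _ => ?_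
  have e4 : ∀ c, ((if a < b ∧ b < c then S.sign a b c • f a b else 0)
      + (if c < a ∧ a < b then S.sign a b c • f a b else 0)
      + (if a < c ∧ c < b then S.sign a b c • f a b else 0)) =
      if a < b then S.sign a b c • f a b else 0 := by
    intro c
    have hca : c = a → S.sign a b c = 0 := by
      rintro rfl
      have h1 : ¬ S.K.Tri c b c := fun h => S.K.ne (S.K.rot (S.K.rot h)) rfl
      have h2 : ¬ S.K.Tri b c c := fun h => S.K.ne (S.K.rot h) rfl
      simp [sign, h1, h2]
    have hcb : c = b → S.sign a b c = 0 := by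
      rintro rfl
      have h1 : ¬ S.K.Tri a c c := fun h => S.K.ne (S.K.rot h) rfl
      have h2 : ¬ S.K.Tri c a c := fun h => S.K.ne (S.K.rot (S.K.rot h)) rfl
      simp [sign, h1, h2]
    by_cases hab : a < b
    · rcases lt_trichotomy c a with h | h | h
      · have : ¬ b < c := by omega
        have : ¬ a < c := by omega
        simp [*]
      · simp [hca h]
      · rcases lt_trichotomy c b with h' | h' | h'
        · have : ¬ b < c := by omega
          have : ¬ c < a := by omega
          simp [*]
        · simp [hcb h']
        · have : ¬ c < b := by omega
          have : ¬ c < a := by omega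
          simp [*]
    · have : ¬ (a < c ∧ c < b) := by omega
      simp [hab, this]
  simp only [e4]
  split_ifs with hab
  · rw [← Finset.sum_smul, S.sum_sign, zero_smul]
  · simp

/-- The fundamental class `[W]` in `H₂(π₁(W, w))`, the image of the class of the sum of all
positively oriented triangles under `H₂(W) → H₂(π₁(W, w))`. -/
def fundamentalClass : GrpTwo.Homology (FundamentalGroup W w) :=
  QuotientAddGroup.mk ⟨S.fundamentalChain w, S.bd_fundamentalChain w⟩

end ClosedOrientedSurface

/-! ### Twisted representations -/

section Twisted

variable {G G' : Type*} [Group G] [Group G']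

theorem cocycle_one_left (θ : GrpTwo.cocycles G') (a : G') : θ.1 1 a = θ.1 1 1 := by
  have := θ.2 1 1 a
  simpa using this.symm

theorem cocycle_one_right (θ : GrpTwo.cocycles G') (a : G') : θ.1 a 1 = θ.1 1 1 := by
  have := θ.2 a 1 1
  simpa using this

theorem cocycle_inv (θ : GrpTwo.cocycles G') (a : G') : θ.1 a⁻¹ a = θ.1 a a⁻¹ := by
  have := θ.2 a a⁻¹ a
  simp only [mul_inv_cancel, inv_mul_cancel, cocycle_one_left, cocycle_one_right] at this
  rw [mul_comm] at this
  exact (mul_left_cancel this).symm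

/-- The central extension of `G'` by `ℂˣ` determined by `θ` (used only to verify the properties of
`θ`-representations below). -/
@[ext]
structure TwistedExt (θ : GrpTwo.cocycles G') where
  pt : G'
  sc : ℂˣ

namespace TwistedExt

variable {θ : GrpTwo.cocycles G'}

instance : Mul (TwistedExt θ) := ⟨fun x y => ⟨x.pt * y.pt, x.sc * y.sc * θ.1 x.pt y.pt⟩⟩
instance : One (TwistedExt θ) := ⟨⟨1, (θ.1 1 1)⁻¹⟩⟩
instance : Inv (TwistedExt θ) := ⟨fun x => ⟨x.pt⁻¹, (x.sc * θ.1 x.pt x.pt⁻¹ * θ.1 1 1)⁻¹⟩⟩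

theorem mul_pt (x y : TwistedExt θ) : (x * y).pt = x.pt * y.pt := rfl
theorem mul_sc (x y : TwistedExt θ) : (x * y).sc = x.sc * y.sc * θ.1 x.pt y.pt := rfl
theorem one_pt : (1 : TwistedExt θ).pt = 1 := rfl
theorem one_sc : (1 : TwistedExt θ).sc = (θ.1 1 1)⁻¹ := rfl
theorem inv_pt (x : TwistedExt θ) : (x⁻¹).pt = x.pt⁻¹ := rfl
theorem inv_sc (x : TwistedExt θ) : (x⁻¹).sc = (x.sc * θ.1 x.pt x.pt⁻¹ * θ.1 1 1)⁻¹ := rfl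

instance : Group (TwistedExt θ) :=
  Group.ofLeftAxioms
    (by
      intro x y z
      ext1
      · simp only [mul_pt, mul_assoc]
      · simp only [mul_sc, mul_pt]
        have := θ.2 x.pt y.pt z.pt
        calc _ = x.sc * y.sc * z.sc * (θ.1 x.pt y.pt * θ.1 (x.pt * y.pt) z.pt) := by
              simp only [mul_assoc, mul_comm, mul_left_comm]
          _ = _ := by
              rw [this]; simp only [mul_assoc, mul_comm, mul_left_comm])
    (by
      intro x
      ext1
      · simp [mul_pt, one_pt]
      · simp only [mul_sc, one_sc, one_pt, cocycle_one_left]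
        rw [mul_comm _ x.sc, mul_assoc, inv_mul_cancel, mul_one])
    (by
      intro x
      ext1
      · simp [mul_pt, one_pt, inv_pt]
      · simp only [mul_sc, one_sc, inv_sc, inv_pt, cocycle_inv, mul_inv]
        calc _ = (x.sc⁻¹ * x.sc) * ((θ.1 x.pt x.pt⁻¹)⁻¹ * θ.1 x.pt x.pt⁻¹) * (θ.1 1 1)⁻¹ := by
              simp only [mul_assoc, mul_comm, mul_left_comm]
          _ = _ := by simp)

/-- The standard lift of an element of `G'`. -/
def std (θ : GrpTwo.cocycles G') (a : G') : TwistedExt θ := ⟨a, 1⟩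

/-- The projection to `G'`. -/
def proj : TwistedExt θ →* G' where
  toFun := pt
  map_one' := rfl
  map_mul' _ _ := rfl

end TwistedExt

open TwistedExt

/-- The scalar matrix `c I`. -/
abbrev scal {n : ℕ} (c : ℂˣ) : GL (Fin n) ℂ := Matrix.GeneralLinearGroup.scalar (Fin n) c

theorem scal_val {n : ℕ} (c : ℂˣ) :
    ((scal c : GL (Fin n) ℂ) : Matrix (Fin n) (Fin n) ℂ) = (c : ℂ) • 1 := by
  change Matrix.scalar (Fin n) (c : ℂ) = _
  rw [Matrix.smul_one_eq_diagonal]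
  rfl

theorem scal_mul {n : ℕ} (c d : ℂˣ) : (scal (c * d) : GL (Fin n) ℂ) = scal c * scal d :=
  map_mul _ c d

theorem scal_one {n : ℕ} : (scal 1 : GL (Fin n) ℂ) = 1 := map_one _

theorem scal_inv {n : ℕ} (c : ℂˣ) : (scal c⁻¹ : GL (Fin n) ℂ) = (scal c)⁻¹ := map_inv _ c

theorem scal_comm {n : ℕ} (c : ℂˣ) (M : GL (Fin n) ℂ) : M * scal c = scal c * M := by
  apply Units.ext
  rw [Units.val_mul, Units.val_mul, scal_val]
  simp

theorem scal_inj {n : ℕ} (hn : 0 < n) {c d : ℂˣ} (h : (scal c : GL (Fin n) ℂ) = scal d) :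
    c = d := by
  have h1 := congrArg (fun M : GL (Fin n) ℂ => (M : Matrix (Fin n) (Fin n) ℂ) ⟨0, hn⟩ ⟨0, hn⟩) h
  simp only [scal_val, Matrix.smul_apply, Matrix.one_apply_eq, smul_eq_mul, mul_one] at h1
  exact Units.ext h1

/-- A `θ`-representation `Γ → GL_n(ℂ)`, `n ≥ 1`, of the kernel `Γ` of `q : G' → G`. The relation
`mul_eq` for `g = h = 1` says that `ρ(1) = θ_{1,1} I`, which is the unit matrix for a cocycle with
`θ_{1,1} = 1`. -/
structure ThetaRep (θ : GrpTwo.cocycles G') (q : G' →* G) (n : ℕ) where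
  pos : 0 < n
  toFun : q.ker → GL (Fin n) ℂ
  mul_eq : ∀ g h : q.ker, toFun g * toFun h = scal (θ.1 g h) * toFun (g * h)

namespace ThetaRep

variable {θ : GrpTwo.cocycles G'} {q : G' →* G} {n : ℕ}

/-- Irreducibility: the only subspaces of `ℂⁿ` preserved by `Γ` are `0` and `ℂⁿ`. -/
def Irreducible (ρ : ThetaRep θ q n) : Prop :=
  ∀ V : Submodule ℂ (Fin n → ℂ),
    (∀ h : q.ker, ∀ v ∈ V, Matrix.mulVec (ρ.toFun h).1 v ∈ V) → V = ⊥ ∨ V = ⊤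

variable (ρ : ThetaRep θ q n)

/-- The values of the action of `a ∈ G'` on `ρ`:
`(aρ)(h) = θ_{a⁻¹,ha} θ_{h,a} / (θ_{a,a⁻¹} θ_{1,1}) ρ(a⁻¹ h a)`. -/
def act (a : G') (h : q.ker) : GL (Fin n) ℂ :=
  scal (θ.1 a⁻¹ (h * a) * θ.1 h a / (θ.1 a a⁻¹ * θ.1 1 1)) *
    ρ.toFun ⟨a⁻¹ * h * a, by
      have : q h.1 = 1 := h.2
      simp [MonoidHom.mem_ker, this]⟩

/-- Extension of `ρ` to the preimage of `Γ` in the central extension. -/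
def hat : (q.comp (proj (θ := θ))).ker →* GL (Fin n) ℂ where
  toFun x := scal x.1.sc * ρ.toFun ⟨x.1.pt, x.2⟩
  map_one' := by
    have h := ρ.mul_eq 1 1
    rw [mul_one] at h
    change scal (θ.1 1 1)⁻¹ * ρ.toFun 1 = 1
    rw [mul_right_cancel h, ← scal_mul]
    simp
  map_mul' x y := by
    have h := ρ.mul_eq ⟨x.1.pt, x.2⟩ ⟨y.1.pt, y.2⟩
    calc _ = scal (x.1.sc * y.1.sc * θ.1 x.1.pt y.1.pt) *
          ρ.toFun (⟨x.1.pt, x.2⟩ * ⟨y.1.pt, y.2⟩) := rfl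
      _ = scal x.1.sc * (scal y.1.sc *
          (scal (θ.1 x.1.pt y.1.pt) * ρ.toFun (⟨x.1.pt, x.2⟩ * ⟨y.1.pt, y.2⟩))) := by
        simp only [scal_mul, mul_assoc]
      _ = scal x.1.sc * (scal y.1.sc * (ρ.toFun ⟨x.1.pt, x.2⟩ * ρ.toFun ⟨y.1.pt, y.2⟩)) := by
        rw [h]
      _ = _ := by
        rw [← mul_assoc (scal y.1.sc), ← scal_comm y.1.sc (ρ.toFun _)]
        simp only [mul_assoc]

/-- Conjugation of an element over `Γ`. -/
def cj (x : TwistedExt θ) (y : (q.comp (proj (θ := θ))).ker) : (q.comp (proj (θ := θ))).ker :=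
  ⟨x⁻¹ * y.1 * x, by
    have : q (proj y.1) = 1 := y.2
    simp [MonoidHom.mem_ker, this]⟩

theorem cj_mul (x x' : TwistedExt θ) (y : (q.comp (proj (θ := θ))).ker) :
    cj (x * x') y = cj x' (cj x y) := by
  apply Subtype.ext
  simp only [cj]
  group

theorem cj_coe (k y : (q.comp (proj (θ := θ))).ker) : cj k.1 y = k⁻¹ * y * k := rfl

/-- An element of `Γ` as an element of the central extension. -/
def el (h : q.ker) : (q.comp (proj (θ := θ))).ker := ⟨std θ h.1, h.2⟩

theorem hat_el (h : q.ker) : ρ.hat (el h) = ρ.toFun h := by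
  change scal 1 * ρ.toFun h = _
  rw [scal_one, one_mul]

theorem hat_cj (x : TwistedExt θ) (y : (q.comp (proj (θ := θ))).ker) :
    ρ.hat (cj x y) = scal y.1.sc * ρ.act x.pt ⟨y.1.pt, y.2⟩ := by
  have h2 : (cj x y).1.sc = (x.sc * θ.1 x.pt x.pt⁻¹ * θ.1 1 1)⁻¹ * y.1.sc * θ.1 x.pt⁻¹ y.1.pt
      * x.sc * θ.1 (x.pt⁻¹ * y.1.pt) x.pt := rfl
  have h3 := θ.2 x.pt⁻¹ y.1.pt x.pt
  have h4 : (cj x y).1.sc = y.1.sc *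
      (θ.1 x.pt⁻¹ (y.1.pt * x.pt) * θ.1 y.1.pt x.pt / (θ.1 x.pt x.pt⁻¹ * θ.1 1 1)) := by
    rw [h2, ← h3, div_eq_mul_inv]
    simp only [mul_inv]
    calc _ = (x.sc⁻¹ * x.sc) * (y.1.sc * (θ.1 x.pt⁻¹ y.1.pt * θ.1 (x.pt⁻¹ * y.1.pt) x.pt
          * ((θ.1 x.pt x.pt⁻¹)⁻¹ * (θ.1 1 1)⁻¹))) := by
          simp only [mul_assoc, mul_comm, mul_left_comm]
      _ = _ := by rw [inv_mul_cancel, one_mul]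
  change scal (cj x y).1.sc * ρ.toFun _ = _
  rw [h4, scal_mul, mul_assoc]
  rfl

theorem conj_iff (x : TwistedExt θ) (M : GL (Fin n) ℂ) :
    (∀ h : q.ker, ρ.act x.pt h = M⁻¹ * ρ.toFun h * M) ↔
      ∀ y, ρ.hat (cj x y) = M⁻¹ * ρ.hat y * M := by
  constructor
  · intro H y
    rw [hat_cj, H]
    change _ = M⁻¹ * (scal y.1.sc * ρ.toFun _) * M
    simp only [← mul_assoc]
    rw [scal_comm]
  · intro H h
    have h1 := H (el h)
    rw [hat_cj, hat_el] at h1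
    rw [← h1]
    change _ = scal 1 * _
    rw [scal_one, one_mul]
    rfl

/-- The stabilizer `G_ρ`: all `α ∈ G` such that `aρ` is equivalent to `ρ` for some `a` over `α`. -/
def stab : Subgroup G where
  carrier := {α | ∃ a, q a = α ∧ ∃ M : GL (Fin n) ℂ, ∀ h, ρ.act a h = M⁻¹ * ρ.toFun h * M}
  one_mem' := by
    refine ⟨(1 : TwistedExt θ).pt, map_one q, 1, (ρ.conj_iff 1 1).2 fun y => ?_⟩
    have : cj 1 y = y := by apply Subtype.ext; simp [cj]
    rw [this]; simp
  mul_mem' := by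
    rintro _ _ ⟨a, rfl, M, hM⟩ ⟨b, rfl, N, hN⟩
    rw [show a = (std θ a).pt from rfl, conj_iff] at hM
    rw [show b = (std θ b).pt from rfl, conj_iff] at hN
    refine ⟨(std θ a * std θ b).pt, map_mul q a b, M * N, (ρ.conj_iff _ _).2 fun y => ?_⟩
    rw [cj_mul, hN, hM]
    group
  inv_mem' := by
    rintro _ ⟨a, rfl, M, hM⟩
    rw [show a = (std θ a).pt from rfl, conj_iff] at hM
    refine ⟨((std θ a)⁻¹).pt, map_inv q a, M⁻¹, (ρ.conj_iff _ _).2 fun y => ?_⟩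
    have h := hM (cj (std θ a)⁻¹ y)
    rw [← cj_mul, inv_mul_cancel] at h
    have : cj 1 y = y := by apply Subtype.ext; simp [cj]
    rw [this] at h
    rw [h]
    group

theorem exists_matrix {α : G} (hα : α ∈ ρ.stab) {b : G'} (hb : q b = α) :
    ∃ M : GL (Fin n) ℂ, ∀ h, ρ.act b h = M⁻¹ * ρ.toFun h * M := by
  obtain ⟨a, rfl, M, hM⟩ := hα
  rw [show a = (std θ a).pt from rfl, conj_iff] at hM
  let k : (q.comp (proj (θ := θ))).ker := ⟨(std θ a)⁻¹ * std θ b, by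
    change q (a⁻¹ * b) = 1
    rw [map_mul, map_inv, hb, inv_mul_cancel]⟩
  refine ⟨M * ρ.hat k, (ρ.conj_iff (std θ b) _).2 fun y => ?_⟩
  have h1 : std θ b = std θ a * k.1 := by simp [k]
  rw [h1, cj_mul, cj_coe, map_mul, map_mul, hM, map_inv]
  group

theorem schur (hρ : ρ.Irreducible) (A : GL (Fin n) ℂ) (hA : ∀ h, A * ρ.toFun h = ρ.toFun h * A) :
    ∃ c : ℂˣ, A = scal c := by
  have : Nonempty (Fin n) := ⟨⟨0, ρ.pos⟩⟩
  obtain ⟨μ, hμ⟩ := Module.End.exists_eigenvalue (Matrix.toLin' A.1)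
  have hinv := hρ (Module.End.eigenspace (Matrix.toLin' A.1) μ) (by
    intro h v hv
    rw [Module.End.mem_eigenspace_iff] at hv ⊢
    rw [Matrix.toLin'_apply] at hv ⊢
    have h1 : A.1 * (ρ.toFun h).1 = (ρ.toFun h).1 * A.1 := congrArg Units.val (hA h)
    rw [Matrix.mulVec_mulVec, h1, ← Matrix.mulVec_mulVec, hv, Matrix.mulVec_smul])
  have htop := hinv.resolve_left hμ
  have hAv : ∀ v, A.1.mulVec v = μ • v := fun v => by
    have : v ∈ Module.End.eigenspace (Matrix.toLin' A.1) μ := htop ▸ Submodule.mem_top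
    rwa [Module.End.mem_eigenspace_iff, Matrix.toLin'_apply] at this
  have hAμ : A.1 = μ • 1 := by
    apply Matrix.toLin'.injective
    ext1 v
    ext1
    simp [hAv]
  have hμ0 : μ ≠ 0 := by
    rintro rfl
    rw [zero_smul] at hAμ
    exact A.ne_zero hAμ
  exact ⟨Units.mk0 μ hμ0, Units.ext (by rw [scal_val, hAμ]; rfl)⟩

variable (hq : Function.Surjective q)

/-- The chosen element `α̃ ∈ q⁻¹(α)`. -/
def lift (α : ρ.stab) : G' := Function.surjInv hq α.1

theorem q_lift (α : ρ.stab) : q (ρ.lift hq α) = α := Function.surjInv_eq hq α.1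

/-- The chosen matrix `M_α` with `α̃ρ = M_α⁻¹ ρ M_α`. -/
def mat (α : ρ.stab) : GL (Fin n) ℂ := (ρ.exists_matrix α.2 (ρ.q_lift hq α)).choose

theorem mat_spec (α : ρ.stab) (h : q.ker) :
    ρ.act (ρ.lift hq α) h = (ρ.mat hq α)⁻¹ * ρ.toFun h * ρ.mat hq α :=
  (ρ.exists_matrix α.2 (ρ.q_lift hq α)).choose_spec h

/-- The element `γ_{α,β}` of `Γ`, the inverse of the lift of `αβ` times the lifts of `α` and `β`. -/
def defect (α β : ρ.stab) : q.ker :=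
  ⟨(ρ.lift hq (α * β))⁻¹ * ρ.lift hq α * ρ.lift hq β, by
    simp [MonoidHom.mem_ker, q_lift]⟩

/-- The corresponding element of the central extension. -/
def cc (α β : ρ.stab) : (q.comp (proj (θ := θ))).ker :=
  ⟨(std θ (ρ.lift hq (α * β)))⁻¹ * std θ (ρ.lift hq α) * std θ (ρ.lift hq β),
    (ρ.defect hq α β).2⟩

theorem hat_cc (α β : ρ.stab) : ρ.hat (ρ.cc hq α β) =
    scal (θ.1 (ρ.lift hq α) (ρ.lift hq β) *
      (θ.1 (ρ.lift hq (α * β)) (ρ.defect hq α β))⁻¹) * ρ.toFun (ρ.defect hq α β) := by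
  have h : (ρ.cc hq α β).1 = ⟨ρ.defect hq α β, θ.1 (ρ.lift hq α) (ρ.lift hq β) *
      (θ.1 (ρ.lift hq (α * β)) (ρ.defect hq α β))⁻¹⟩ := by
    change (std θ (ρ.lift hq (α * β)))⁻¹ * std θ (ρ.lift hq α) * std θ (ρ.lift hq β) = _
    rw [mul_assoc, inv_mul_eq_iff_eq_mul]
    ext1
    · simp [mul_pt, std, defect, mul_assoc]
    · simp [mul_sc, std]
  have h' : (ρ.cc hq α β).1.sc = _ := congrArg TwistedExt.sc h
  change scal (ρ.cc hq α β).1.sc * ρ.toFun _ = _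
  rw [h']
  rfl

theorem exists_zeta (hρ : ρ.Irreducible) (α β : ρ.stab) : ∃ z : ℂˣ,
    scal z * (ρ.mat hq α * ρ.mat hq β) =
      scal (θ.1 (ρ.lift hq α) (ρ.lift hq β) *
        (θ.1 (ρ.lift hq (α * β)) (ρ.defect hq α β))⁻¹) *
        (ρ.mat hq (α * β) * ρ.toFun (ρ.defect hq α β)) := by
  have H := fun α => (ρ.conj_iff (std θ (ρ.lift hq α)) _).1 (ρ.mat_spec hq α)
  rw [← mul_assoc, ← scal_comm, mul_assoc, ← hat_cc]
  obtain ⟨c, hc⟩ := ρ.schur hρ (ρ.mat hq α * ρ.mat hq β *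
    (ρ.mat hq (α * β) * ρ.hat (ρ.cc hq α β))⁻¹) (by
      intro h
      have h1 : std θ (ρ.lift hq α) * std θ (ρ.lift hq β) =
          std θ (ρ.lift hq (α * β)) * (ρ.cc hq α β).1 := by
        change _ = _ * ((std θ (ρ.lift hq (α * β)))⁻¹ * _ * _)
        group
      have h2 := congrArg (fun x => ρ.hat (cj x (el h))) h1
      simp only [cj_mul, cj_coe] at h2
      rw [map_mul, map_mul, map_inv, H, H, H, hat_el] at h2
      have h3 := congrArg (fun x => ρ.mat hq α * ρ.mat hq β * x *
        (ρ.mat hq (α * β) * ρ.hat (ρ.cc hq α β))⁻¹) h2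
      simp only [mul_inv_rev, mul_assoc, mul_inv_cancel_left,
        mul_inv_cancel, mul_one] at h3
      simp only [mul_inv_rev, mul_assoc]
      exact h3.symm)
  refine ⟨c⁻¹, ?_⟩
  rw [mul_inv_eq_iff_eq_mul] at hc
  rw [hc, scal_inv, inv_mul_cancel_left]

/-- The number `ζ_{α,β}`, determined by
`ζ_{α,β} M_α M_β = θ_{α̃,β̃} θ_{α̃β̃,γ}⁻¹ M_{αβ} ρ(γ)`, where in the second factor the first
index is the lift of `αβ`, and `γ = γ_{α,β}`. -/
def zeta (hρ : ρ.Irreducible) (α β : ρ.stab) : ℂˣ := (ρ.exists_zeta hq hρ α β).choose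

theorem zeta_spec (hρ : ρ.Irreducible) (α β : ρ.stab) :
    scal (ρ.zeta hq hρ α β) * (ρ.mat hq α * ρ.mat hq β) =
      scal (θ.1 (ρ.lift hq α) (ρ.lift hq β) *
        (θ.1 (ρ.lift hq (α * β)) (ρ.defect hq α β))⁻¹) *
        (ρ.mat hq (α * β) * ρ.toFun (ρ.defect hq α β)) :=
  (ρ.exists_zeta hq hρ α β).choose_spec

theorem zeta_mem (hρ : ρ.Irreducible) : ρ.zeta hq hρ ∈ GrpTwo.cocycles ρ.stab := by
  intro α β γ
  have H := fun α => (ρ.conj_iff (std θ (ρ.lift hq α)) _).1 (ρ.mat_spec hq α)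
  have Z : ∀ α β : ρ.stab, scal (ρ.zeta hq hρ α β) * (ρ.mat hq α * ρ.mat hq β) =
      ρ.mat hq (α * β) * ρ.hat (ρ.cc hq α β) := by
    intro α β
    rw [zeta_spec, hat_cc, ← mul_assoc, ← mul_assoc, scal_comm]
  have A : ∀ x : (q.comp (proj (θ := θ))).ker, ρ.hat x * ρ.mat hq γ =
      ρ.mat hq γ * ρ.hat (cj (std θ (ρ.lift hq γ)) x) := by
    intro x
    rw [H]
    group
  have C : ρ.cc hq (α * β) γ * cj (std θ (ρ.lift hq γ)) (ρ.cc hq α β) =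
      ρ.cc hq α (β * γ) * ρ.cc hq β γ := by
    apply Subtype.ext
    simp only [cc, cj, Subgroup.coe_mul, mul_assoc α β γ]
    group
  have E : scal (ρ.zeta hq hρ α β * ρ.zeta hq hρ (α * β) γ) *
        (ρ.mat hq α * ρ.mat hq β * ρ.mat hq γ) =
      scal (ρ.zeta hq hρ α (β * γ) * ρ.zeta hq hρ β γ) *
        (ρ.mat hq α * ρ.mat hq β * ρ.mat hq γ) := by
    calc _ = scal (ρ.zeta hq hρ (α * β) γ) *
          ((scal (ρ.zeta hq hρ α β) * (ρ.mat hq α * ρ.mat hq β)) * ρ.mat hq γ) := by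
          rw [mul_comm, scal_mul]; simp only [mul_assoc]
      _ = (scal (ρ.zeta hq hρ (α * β) γ) * (ρ.mat hq (α * β) * ρ.mat hq γ)) *
          ρ.hat (cj (std θ (ρ.lift hq γ)) (ρ.cc hq α β)) := by
          rw [Z, mul_assoc (ρ.mat hq (α * β)), A]; simp only [mul_assoc]
      _ = ρ.mat hq (α * β * γ) * ρ.hat (ρ.cc hq α (β * γ) * ρ.cc hq β γ) := by
          rw [Z, mul_assoc, ← map_mul, C]
      _ = (ρ.mat hq (α * (β * γ)) * ρ.hat (ρ.cc hq α (β * γ))) * ρ.hat (ρ.cc hq β γ) := by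
          rw [map_mul, mul_assoc α β γ, mul_assoc]
      _ = scal (ρ.zeta hq hρ α (β * γ)) * (ρ.mat hq α *
          (ρ.mat hq (β * γ) * ρ.hat (ρ.cc hq β γ))) := by
          rw [← Z]; simp only [mul_assoc]
      _ = _ := by
          rw [← Z, scal_mul, ← mul_assoc (ρ.mat hq α), scal_comm]; simp only [mul_assoc]
  exact scal_inj ρ.pos (mul_right_cancel E)

/-- The cohomology class `ζ_ρ ∈ H²(G_ρ; ℂˣ)`. -/
def zetaClass (hρ : ρ.Irreducible) : GrpTwo.Cohomology ρ.stab :=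
  GrpTwo.cls ⟨ρ.zeta hq hρ, ρ.zeta_mem hq hρ⟩

end ThetaRep

/-- Equivalence of irreducible `θ`-representations of the same dimension. -/
def irrSetoid (θ : GrpTwo.cocycles G') (q : G' →* G) (n : ℕ) :
    Setoid {ρ : ThetaRep θ q n // ρ.Irreducible} where
  r ρ ρ' := ∃ M : GL (Fin n) ℂ, ∀ h, ρ'.1.toFun h = M⁻¹ * ρ.1.toFun h * M
  iseqv :=
    { refl := fun ρ => ⟨1, fun h => by simp⟩
      symm := by
        rintro ρ ρ' ⟨M, hM⟩
        exact ⟨M⁻¹, fun h => by rw [hM]; group⟩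
      trans := by
        rintro ρ ρ' ρ'' ⟨M, hM⟩ ⟨N, hN⟩
        exact ⟨M * N, fun h => by rw [hN, hM]; group⟩ }

/-- The set of equivalence classes of irreducible `θ`-representations of `Γ = ker q`. -/
def IrrClass (θ : GrpTwo.cocycles G') (q : G' →* G) : Type _ :=
  Σ n : ℕ, Quotient (irrSetoid θ q n)

namespace IrrClass

variable {θ : GrpTwo.cocycles G'} {q : G' →* G} (c : IrrClass θ q)

/-- The dimension. -/
def dim : ℕ := c.1

/-- A representative; the group `G_ρ` and the class `ζ_ρ` do not depend on it. -/
def rep : {ρ : ThetaRep θ q c.1 // ρ.Irreducible} :=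
  @Quotient.out _ (irrSetoid θ q c.1) c.2

/-- The subgroup `G_ρ ⊆ G`. -/
def stab : Subgroup G := c.rep.1.stab

/-- The class `ζ_ρ ∈ H²(G_ρ; ℂˣ)`. -/
def zetaClass (hq : Function.Surjective q) : GrpTwo.Cohomology c.stab :=
  c.rep.1.zetaClass hq c.rep.2

end IrrClass

end Twisted

/-- The lifts of `g : π → G` along `q : G' → G`. -/
abbrev Lifts {G G' P : Type*} [Group G] [Group G'] [Group P] (q : G' →* G) (g : P →* G) : Type _ :=
  {g' : P →* G' // q.comp g' = g}

end

/-! Both sides evaluate one state sum on the triangulation. Let `TwistedExt θ` be the central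
extension of G' by ℂˣ given by θ. Fix on every edge e an element `s e` over the value of g on that
edge, and let k run over the labellings of the edges by elements of Γ. The weight of the labelling
`s e * k e` is the product over the triangles of `tau` of the boundary, where `tau` reads off the
scalar of a central element and vanishes elsewhere.

First evaluation (`sum_lifts`). A nonzero weight forces the image in G' of every triangle boundary
to be trivial. Such a flat labelling is the holonomy of a homomorphism, up to gauge; this is
`exists_hom`, proved with the covering space glued from the labelling. After normalisation at one
vertex, the contributing labellings are exactly the pairs (lift of g, pointed Γ-valued gauge
function), and the weight is the value of the pulled-back class on [W] (`eval_eq_weight`). Each lift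
is thus counted |Γ|^(n-1) times, n being the number of vertices.

Second evaluation (`sum_weight`). On the preimage of Γ, `tau` is the sum over the irreducible ρ of
dim ρ/|Γ| times the character (`card_mul_tau`). Conjugation by an element of the extension permutes
the irreducibles, so each `s e` is implemented by an invertible matrix on their direct sum.
Replacing the representation of a triangle boundary by the product of the edge matrices costs, in
each block, a scalar. This scalar is the `tau` of an element of the central extension of G_ρ given
by ζ_ρ, and it does not depend on k. The sum over k then splits over the edges. Schur orthogonality
glues matrix indices around every vertex, leaving one index per vertex; the blocks so chosen are
related by the action of the edges, hence equal to a single class ρ fixed by g(π). Such a ρ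
contributes dim ρ per vertex, |Γ|/dim ρ per edge and dim ρ/|Γ| per triangle, and the scalars
multiply to the value of ζ_ρ on [W], again by `eval_eq_weight`. Comparing powers of |Γ| and dim ρ
gives the exponent -χ(W). -/

noncomputable section

/-! ### Flat labellings and homomorphisms of the fundamental group -/

/-- A locally constant cocycle `ℓ` on an open cover `U` gives a transport of paths with values in
the structure group; a path that sees only charts compatible with a given index `a` is transported
along the constant section of that index. -/
theorem exists_transport {W ι H : Type*} [TopologicalSpace W] [Group H] (U : ι → Set W)
    (hU : ∀ i, IsOpen (U i)) (idx : W → ι) (hidx : ∀ x, x ∈ U (idx x)) (ℓ : ι → ι → H)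
    (hℓ : ∀ x i j k, x ∈ U i → x ∈ U j → x ∈ U k → ℓ i j * ℓ j k = ℓ i k) :
    ∃ m : ∀ {x y : W}, Path.Homotopic.Quotient x y → H,
      (∀ {x y z : W} (p : Path.Homotopic.Quotient x y) (p' : Path.Homotopic.Quotient y z),
        m (p.trans p') = m p' * m p) ∧
      ∀ {x y : W} (γ : Path x y) (a : ι),
        (∀ t i j, γ t ∈ U i → γ t ∈ U j → ℓ i j * ℓ j a = ℓ i a) →
        m (Path.Homotopic.Quotient.mk γ) = ℓ (idx y) a * (ℓ (idx x) a)⁻¹ := by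
  -- With H discrete, the bundle glued from ℓ is a covering of W, and m will be its monodromy
  -- applied to 1.
  let _ : TopologicalSpace H := ⊥
  have : DiscreteTopology H := ⟨rfl⟩
  have hone : ∀ x i, x ∈ U i → ℓ i i = 1 := fun x i hx => by
    simpa using hℓ x i i i hx hx hx
  let Z : FiberBundleCore ι W H :=
    { baseSet := U
      isOpen_baseSet := hU
      indexAt := idx
      mem_baseSet_at := hidx
      coordChange := fun i j _ v => ℓ j i * v
      coordChange_self := fun i x hx v => by rw [hone x i hx, one_mul]
      continuousOn_coordChange := fun i j =>
        (continuous_of_discreteTopology.comp continuous_snd).continuousOn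
      coordChange_comp := fun i j k x hx v => by
        rw [← mul_assoc, hℓ x k j i hx.2 hx.1.2 hx.1.1] }
  let _ : TopologicalSpace (Bundle.TotalSpace H Z.Fiber) := Z.toTopologicalSpace
  let _ : ∀ b, TopologicalSpace (Z.Fiber b) := fun b => Z.topologicalSpaceFiber b
  let _ : FiberBundle H Z.Fiber := Z.fiberBundle
  let tm : W → H → Bundle.TotalSpace H Z.Fiber := fun x v => ⟨x, v⟩
  let sc : Bundle.TotalSpace H Z.Fiber → H := fun p => p.2
  have cov : IsCoveringMap (Bundle.TotalSpace.proj : Bundle.TotalSpace H Z.Fiber → W) :=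
    FiberBundle.isCoveringMap
  have triv : ∀ (x : W) (p : Bundle.TotalSpace H Z.Fiber),
      (trivializationAt H Z.Fiber x p).2 = ℓ (idx x) (idx p.1) * sc p := fun x p => rfl
  let pt : ∀ x : W, H → (Bundle.TotalSpace.proj : Bundle.TotalSpace H Z.Fiber → W) ⁻¹' {x} :=
    fun x v => ⟨⟨x, v⟩, rfl⟩
  let val : ∀ {x : W}, (Bundle.TotalSpace.proj : Bundle.TotalSpace H Z.Fiber → W) ⁻¹' {x} → H :=
    fun e => e.1.2
  have pt_val : ∀ {x : W} (e), pt x (val e) = e := by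
    rintro x ⟨⟨y, v⟩, rfl⟩; rfl
  -- Coordinate changes multiply on the left, so right multiplication by k is well defined on the
  -- total space.
  have Rcont : ∀ k : H, Continuous
      (fun p : Bundle.TotalSpace H Z.Fiber => tm p.1 (sc p * k)) := by
    intro k
    rw [continuous_iff_continuousAt]
    intro p
    rw [FiberBundle.continuousAt_totalSpace]
    refine ⟨(FiberBundle.continuous_proj H Z.Fiber).continuousAt, ?_⟩
    have h1 : ContinuousAt (fun q : Bundle.TotalSpace H Z.Fiber =>
        (trivializationAt H Z.Fiber p.1 q).2) p :=
      ((FiberBundle.continuousAt_totalSpace H (f := id)).1 continuousAt_id).2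
    have h2 : ContinuousAt (fun q : Bundle.TotalSpace H Z.Fiber =>
        (trivializationAt H Z.Fiber p.1 q).2 * k) p :=
      (continuous_of_discreteTopology (f := fun v : H => v * k)).continuousAt.comp h1
    refine h2.congr (Filter.Eventually.of_forall fun q => ?_)
    change (trivializationAt H Z.Fiber p.1 q).2 * k = (trivializationAt H Z.Fiber p.1 _).2
    rw [triv, triv, mul_assoc]
  -- Right translates of lifts are lifts, so by uniqueness monodromy commutes with right
  -- multiplication and is determined by its value at 1.
  have equiv : ∀ {x y : W} (p : Path.Homotopic.Quotient x y) (v k : H),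
      val (cov.monodromy p (pt x (v * k))) = val (cov.monodromy p (pt x v)) * k := by
    intro x y p v k
    obtain ⟨γ⟩ := p
    have h := (cov.eq_liftPath_iff' (γ := γ) (e := (pt x (v * k)).1)
      (γ_0 := γ.source.trans rfl)
      (Γ := ⟨fun t => tm (cov.liftPath γ (pt x v).1 (γ.source.trans rfl) t).1
        (sc (cov.liftPath γ (pt x v).1 (γ.source.trans rfl) t) * k),
        (Rcont k).comp (map_continuous _)⟩)).2 ⟨by
          exact cov.liftPath_lifts γ (pt x v).1 (γ.source.trans rfl), by
          change tm _ (sc _ * k) = _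
          rw [cov.liftPath_zero]⟩
    have h1 := congrArg (fun f => (f (1 : unitInterval))) h
    have h2 := congrArg sc h1
    exact h2.symm
  refine ⟨fun {x y} p => val (cov.monodromy p (pt x 1)), ?_, ?_⟩
  · intro x y z p p'
    beta_reduce
    rw [cov.monodromy_trans_apply, ← equiv, one_mul, pt_val]
  · intro x y γ a H1
    -- The lift of γ is written down explicitly: by the relation assumed along γ, near each time it
    -- is constant in the chart chosen at that time.
    have hcont : Continuous fun t : unitInterval =>
        tm (γ t) (ℓ (idx (γ t)) a) := by
      rw [continuous_iff_continuousAt]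
      intro t
      rw [FiberBundle.continuousAt_totalSpace]
      refine ⟨(map_continuous γ).continuousAt, ?_⟩
      have hev : ∀ᶠ s in nhds t, γ s ∈ U (idx (γ t)) :=
        (map_continuous γ).continuousAt.eventually_mem ((hU _).mem_nhds (hidx _))
      refine (continuousAt_const (y := ℓ (idx (γ t)) a)).congr (hev.mono fun s hs => ?_)
      exact (H1 s _ _ hs (hidx _)).symm
    have h : cov.monodromy (Path.Homotopic.Quotient.mk γ) (pt x (ℓ (idx x) a)) =
        pt y (ℓ (idx y) a) := by
      apply Subtype.ext
      have h := (cov.eq_liftPath_iff' (γ := γ) (e := (pt x (ℓ (idx x) a)).1)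
        (γ_0 := γ.source.trans rfl) (Γ := ⟨_, hcont⟩)).2 ⟨rfl, by
          change tm _ _ = _
          rw [γ.source]⟩
      have h1 := congrArg (fun f => (f (1 : unitInterval))) h
      refine h1.symm.trans ?_
      change tm _ _ = _
      rw [γ.target]
    have h3 := equiv (Path.Homotopic.Quotient.mk γ) 1 (ℓ (idx x) a)
    rw [one_mul, h] at h3
    change _ = val (pt y (ℓ (idx y) a)) * _
    rw [h3, mul_inv_cancel_right]

namespace SurfaceComplex

variable {n : ℕ} (K : SurfaceComplex n)

theorem adj_symm {a b : Fin n} (h : K.Adj a b) : K.Adj b a := K.edge_reverse h.choose_spec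

theorem adj_ne {a b : Fin n} (h : K.Adj a b) : a ≠ b := K.ne h.choose_spec

/-- The polyhedron of the open star of a vertex, as a subset of `ℝⁿ`. -/
def starSet (u : Fin n) : Set (Fin n → ℝ) := {x | x ∈ K.realization ∧ x u ≠ 0}

/-- A simplex holding a point with nonzero u-coordinate has u among its vertices, so it contains the
segment to u, along which that coordinate stays positive. This makes open stars contractible. -/
theorem starConvex_starSet (u : Fin n) : StarConvex ℝ (Pi.single u 1) (K.starSet u) := by
  rintro x ⟨⟨a, b, c, h, hx⟩, hu⟩ s t hs ht hst
  refine ⟨⟨a, b, c, h, ?_⟩, ?_⟩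
  · exact convex_simplex _ (single_mem_simplex (hx.2 u hu)) hx hs ht hst
  · have h1 : 0 < x u := lt_of_le_of_ne (hx.1.1 u) hu.symm
    have : 0 < s * 1 + t * x u := by
      rcases hs.eq_or_lt with rfl | hs
      · obtain rfl : t = 1 := by linarith
        linarith
      · positivity
    simpa using this.ne'

end SurfaceComplex

namespace Path.Homotopic.Quotient

variable {X : Type*} [TopologicalSpace X] {x y z : X}

theorem symm_symm (p : Path.Homotopic.Quotient x y) : p.symm.symm = p := by
  induction p using Path.Homotopic.Quotient.ind with | _ p
  rw [← mk_symm, ← mk_symm, Path.symm_symm]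

theorem symm_trans_eq (p : Path.Homotopic.Quotient x y) (p' : Path.Homotopic.Quotient y z) :
    (p.trans p').symm = p'.symm.trans p.symm := by
  induction p using Path.Homotopic.Quotient.ind with | _ p
  induction p' using Path.Homotopic.Quotient.ind with | _ p'
  rw [← mk_symm, ← mk_symm, ← mk_trans, ← mk_trans, ← mk_symm, Path.trans_symm]

theorem symm_trans_cancel (p : Path.Homotopic.Quotient x y) (p' : Path.Homotopic.Quotient x z) :
    p.trans (p.symm.trans p') = p' := by
  rw [← trans_assoc, trans_symm, refl_trans]

theorem trans_symm_cancel (p : Path.Homotopic.Quotient y x) (p' : Path.Homotopic.Quotient x z) :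
    p.symm.trans (p.trans p') = p' := by
  rw [← trans_assoc, symm_trans, refl_trans]

end Path.Homotopic.Quotient

namespace ClosedOrientedSurface

variable {W : Type*} [TopologicalSpace W] (S : ClosedOrientedSurface W)

/-- Barycentric coordinates. -/
def coord (x : W) : Fin S.n → ℝ := (S.homeo.symm x).1

theorem continuous_coord : Continuous S.coord :=
  continuous_subtype_val.comp S.homeo.symm.continuous

theorem coord_mem (x : W) : S.coord x ∈ S.K.realization := (S.homeo.symm x).2

@[simp] theorem coord_homeo (y : S.K.realization) : S.coord (S.homeo y) = y.1 := by simp [coord]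

theorem coord_injective : Function.Injective S.coord :=
  Subtype.val_injective.comp S.homeo.symm.injective

theorem coord_vertex (a : Fin S.n) : S.coord (S.vertex a) = Pi.single a 1 := by
  rw [vertex, coord_homeo]; rfl

/-- The open star of a vertex. -/
def star (u : Fin S.n) : Set W := {x | S.coord x u ≠ 0}

theorem isOpen_star (u : Fin S.n) : IsOpen (S.star u) :=
  isOpen_ne_fun ((continuous_apply u).comp S.continuous_coord) continuous_const

theorem exists_mem_star (x : W) : ∃ u, x ∈ S.star u := by
  obtain ⟨a, b, c, -, hx⟩ := S.coord_mem x
  by_contra! h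
  have h1 := hx.1.2
  rw [Finset.sum_eq_zero] at h1
  · simp at h1
  · intro u _
    simpa [star] using h u

theorem mem_star_vertex {a u : Fin S.n} (h : S.vertex a ∈ S.star u) : u = a := by
  by_contra hne
  apply h
  rw [coord_vertex, Pi.single_eq_of_ne hne]

theorem vertex_mem_star (a : Fin S.n) : S.vertex a ∈ S.star a := by
  change S.coord (S.vertex a) a ≠ 0
  rw [coord_vertex, Pi.single_eq_same]
  exact one_ne_zero

theorem exists_tri (x : W) : ∃ a b c, S.K.Tri a b c ∧
    S.coord x ∈ SurfaceComplex.simplex {a, b, c} ∧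
    ∀ u, x ∈ S.star u → u ∈ ({a, b, c} : Set (Fin S.n)) := by
  obtain ⟨a, b, c, h, hx⟩ := S.coord_mem x
  exact ⟨a, b, c, h, hx, fun u hu => hx.2 u hu⟩

/-- Both paths factor through the contractible set A, where paths with common endpoints are
homotopic. It is applied to open stars and to closed triangles. -/
theorem homotopic_of_coord_mem (A : Set (Fin S.n → ℝ)) (hA : A ⊆ S.K.realization)
    [ContractibleSpace A] {x y : W} (p p' : Path x y) (hp : ∀ t, S.coord (p t) ∈ A)
    (hp' : ∀ t, S.coord (p' t) ∈ A) : p.Homotopic p' := by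
  let ι : C(A, W) := ⟨fun z => S.homeo ⟨z.1, hA z.2⟩,
    S.homeo.continuous.comp (continuous_inclusion hA)⟩
  have hι : ∀ z, S.coord (ι z) = z.1 := fun z => S.coord_homeo _
  have hsurj : ∀ z, S.coord z ∈ A → ∃ a, ι a = z := fun z hz =>
    ⟨⟨_, hz⟩, S.coord_injective (hι _)⟩
  obtain ⟨a, rfl⟩ := hsurj x (by simpa using hp 0)
  obtain ⟨b, rfl⟩ := hsurj y (by simpa using hp 1)
  let P : ∀ r : Path (ι a) (ι b), (∀ t, S.coord (r t) ∈ A) → Path a b := fun r hr =>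
    { toFun := fun t => ⟨S.coord (r t), hr t⟩
      continuous_toFun := (S.continuous_coord.comp (map_continuous r)).subtype_mk _
      source' := by apply Subtype.ext; simp [hι]
      target' := by apply Subtype.ext; simp [hι] }
  have hP : ∀ r hr, (P r hr).map ι.continuous = r := by
    intro r hr
    ext t
    exact S.coord_injective (hι _)
  have key := (SimplyConnectedSpace.paths_homotopic (P p hp) (P p' hp')).map ι
  rw [hP, hP] at key
  exact key

theorem homotopic_of_mem_star (u : Fin S.n) {x y : W} (p p' : Path x y)
    (hp : ∀ t, p t ∈ S.star u) (hp' : ∀ t, p' t ∈ S.star u) : p.Homotopic p' := by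
  have : ContractibleSpace (S.K.starSet u) := (S.K.starConvex_starSet u).contractibleSpace
    ⟨_, S.coord_mem (p 0), hp 0⟩
  exact S.homotopic_of_coord_mem (S.K.starSet u) (fun _ h => h.1) p p'
    (fun t => ⟨S.coord_mem _, hp t⟩) (fun t => ⟨S.coord_mem _, hp' t⟩)

theorem homotopic_of_mem_simplex {a b c : Fin S.n} (h : S.K.Tri a b c) {x y : W}
    (p p' : Path x y) (hp : ∀ t, S.coord (p t) ∈ SurfaceComplex.simplex {a, b, c})
    (hp' : ∀ t, S.coord (p' t) ∈ SurfaceComplex.simplex {a, b, c}) : p.Homotopic p' := by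
  have : ContractibleSpace (SurfaceComplex.simplex {a, b, c} : Set (Fin S.n → ℝ)) :=
    (SurfaceComplex.convex_simplex _).contractibleSpace ⟨_, hp 0⟩
  exact S.homotopic_of_coord_mem _ (S.K.simplex_subset h subset_rfl) p p' hp hp'

theorem lineMap_mem_starSet {x : W} {u : Fin S.n} (h : x ∈ S.star u) (t : unitInterval) :
    (AffineMap.lineMap (S.coord x) (Pi.single u 1) (t : ℝ) : Fin S.n → ℝ) ∈ S.K.starSet u := by
  rw [AffineMap.lineMap_apply_module]
  rw [add_comm]
  exact S.K.starConvex_starSet u ⟨S.coord_mem x, h⟩ t.2.1 (by linarith [t.2.2]) (by ring)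

/-- The straight path from a point of an open star to its centre. -/
def seg {x : W} {u : Fin S.n} (h : x ∈ S.star u) : Path x (S.vertex u) where
  toFun t := S.homeo ⟨AffineMap.lineMap (S.coord x) (Pi.single u 1) (t : ℝ),
    (S.lineMap_mem_starSet h t).1⟩
  continuous_toFun := by
    refine S.homeo.continuous.comp (Continuous.subtype_mk ?_ _)
    exact AffineMap.lineMap_continuous.comp continuous_subtype_val
  source' := S.coord_injective (by simp)
  target' := S.coord_injective (by rw [coord_vertex]; simp)

theorem coord_seg {x : W} {u : Fin S.n} (h : x ∈ S.star u) (t : unitInterval) :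
    S.coord (S.seg h t) = AffineMap.lineMap (S.coord x) (Pi.single u 1) (t : ℝ) :=
  S.coord_homeo _

theorem seg_mem_star {x : W} {u : Fin S.n} (h : x ∈ S.star u) (t : unitInterval) :
    S.seg h t ∈ S.star u := by
  change S.coord _ u ≠ 0
  rw [coord_seg]
  exact (S.lineMap_mem_starSet h t).2

theorem seg_mem_simplex {x : W} {u : Fin S.n} (h : x ∈ S.star u) {s : Set (Fin S.n)}
    (hx : S.coord x ∈ SurfaceComplex.simplex s) (t : unitInterval) :
    S.coord (S.seg h t) ∈ SurfaceComplex.simplex s := by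
  rw [coord_seg]
  exact (SurfaceComplex.convex_simplex s).lineMap_mem hx
    (SurfaceComplex.single_mem_simplex (hx.2 u h)) t.2

theorem coord_edgePath {a b : Fin S.n} (h : S.K.Adj a b) {s : Set (Fin S.n)} (ha : a ∈ s)
    (hb : b ∈ s) (t : unitInterval) :
    S.coord ((S.K.edgePath h).map S.homeo.continuous t) ∈ SurfaceComplex.simplex s := by
  change S.coord (S.homeo _) ∈ _
  rw [coord_homeo]
  exact SurfaceComplex.segment_mem ha hb t

theorem edge_symm {a b : Fin S.n} (h : S.K.Adj a b) (h' : S.K.Adj b a) :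
    S.edge h = (S.edge h').symm := by
  obtain ⟨c, hc⟩ := id h
  unfold edge
  rw [← Path.Homotopic.Quotient.mk_symm]
  exact Path.Homotopic.Quotient.eq.2 (S.homotopic_of_mem_simplex hc _ _
    (S.coord_edgePath h (by simp) (by simp))
    (fun t => S.coord_edgePath h' (by simp) (by simp) _))

theorem seg_vertex (a : Fin S.n) :
    Path.Homotopic.Quotient.mk (S.seg (S.vertex_mem_star a)) =
      Path.Homotopic.Quotient.refl (S.vertex a) := by
  rw [← Path.Homotopic.Quotient.mk_refl]
  exact Path.Homotopic.Quotient.eq.2 (S.homotopic_of_mem_star a _ _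
    (S.seg_mem_star _) (fun t => S.vertex_mem_star a))

theorem trans_mem {X : Type*} [TopologicalSpace X] {A : Set X} {x y z : X} (p : Path x y)
    (p' : Path y z) (hp : ∀ t, p t ∈ A) (hp' : ∀ t, p' t ∈ A) (t) : p.trans p' t ∈ A := by
  rw [Path.trans_apply]
  split_ifs
  exacts [hp _, hp' _]

/-- All the paths involved lie in one closed triangle containing x. This allows the star in which x
is viewed to be exchanged for another. -/
theorem seg_trans_edge {x : W} {u v : Fin S.n} (hu : x ∈ S.star u) (hv : x ∈ S.star v)
    (h : S.K.Adj u v) : (Path.Homotopic.Quotient.mk (S.seg hu)).trans (S.edge h) =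
      Path.Homotopic.Quotient.mk (S.seg hv) := by
  obtain ⟨a, b, c, habc, hx, hs⟩ := S.exists_tri x
  unfold edge
  rw [← Path.Homotopic.Quotient.mk_trans]
  exact Path.Homotopic.Quotient.eq.2 (S.homotopic_of_mem_simplex habc _ _
    (trans_mem (A := S.coord ⁻¹' SurfaceComplex.simplex {a, b, c}) _ _ (S.seg_mem_simplex hu hx)
      (S.coord_edgePath h (hs u hu) (hs v hv)))
    (S.seg_mem_simplex hv hx))

theorem adj_of_mem_star {x : W} {u v : Fin S.n} (hu : x ∈ S.star u) (hv : x ∈ S.star v)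
    (h : u ≠ v) : S.K.Adj u v := by
  obtain ⟨a, b, c, habc, hx, hs⟩ := S.exists_tri x
  have h1 : S.K.Adj a b := ⟨_, habc⟩
  have h2 : S.K.Adj b c := ⟨_, S.K.rot habc⟩
  have h3 : S.K.Adj c a := ⟨_, S.K.rot (S.K.rot habc)⟩
  have h1' := S.K.adj_symm h1
  have h2' := S.K.adj_symm h2
  have h3' := S.K.adj_symm h3
  rcases hs u hu with rfl | rfl | rfl <;> rcases hs v hv with rfl | rfl | rfl <;>
    first | exact absurd rfl h | assumption

/-- Induction over paths: a property of classes of paths from a point to vertices that holds for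
segments in stars and is stable under composition with edges holds for all paths. -/
theorem path_induction {x y : W} (p : Path x y)
    (Q : ∀ v, Path.Homotopic.Quotient x (S.vertex v) → Prop)
    (h0 : ∀ v (h : x ∈ S.star v), Q v (Path.Homotopic.Quotient.mk (S.seg h)))
    (hstep : ∀ v v' (h : S.K.Adj v v') c, Q v c → Q v' (c.trans (S.edge h)))
    (v : Fin S.n) (h : y ∈ S.star v) :
    Q v ((Path.Homotopic.Quotient.mk p).trans (Path.Homotopic.Quotient.mk (S.seg h))) := by
  obtain ⟨⟨f, hf⟩, rfl, rfl⟩ := p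
  set p : Path (f 0) (f 1) := ⟨⟨f, hf⟩, rfl, rfl⟩ with hp
  -- Lebesgue subdivision: each piece of the path lies in a single open star.
  obtain ⟨t, ht0, htm, ⟨N, hN⟩, ht⟩ := exists_monotone_Icc_subset_open_cover_unitInterval
    (c := fun u => f ⁻¹' S.star u) (fun u => (S.isOpen_star u).preimage hf) (fun s _ => by
      obtain ⟨u, hu⟩ := S.exists_mem_star (f s)
      exact Set.mem_iUnion.2 ⟨u, hu⟩)
  have key : ∀ (k : ℕ) (v : Fin S.n) (h : f (t k) ∈ S.star v),
      Q v ((Path.Homotopic.Quotient.mk (p.subpath 0 (t k))).trans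
        (Path.Homotopic.Quotient.mk (S.seg h))) := by
    intro k
    induction k with
    | zero =>
      rw [ht0]
      intro v h
      have e : Path.Homotopic.Quotient.mk (p.subpath 0 0) =
          Path.Homotopic.Quotient.refl (p 0) := by rw [Path.subpath_self]; rfl
      rw [e, Path.Homotopic.Quotient.refl_trans]
      exact h0 v h
    | succ k ih =>
      obtain ⟨u, hu⟩ := ht k
      have hk : f (t k) ∈ S.star u := hu ⟨le_rfl, htm k.le_succ⟩
      have hk' : f (t (k + 1)) ∈ S.star u := hu ⟨htm k.le_succ, le_rfl⟩
      -- Inside the star of u, going straight to u is homotopic to following the path first and then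
      -- going to u.
      have e1 : Path.Homotopic.Quotient.mk (S.seg hk) =
          (Path.Homotopic.Quotient.mk (p.subpath (t k) (t (k + 1)))).trans
            (Path.Homotopic.Quotient.mk (S.seg hk')) := by
        rw [← Path.Homotopic.Quotient.mk_trans]
        refine Path.Homotopic.Quotient.eq.2 (S.homotopic_of_mem_star u _ _ (S.seg_mem_star hk)
          (trans_mem _ _ (fun s => ?_) (S.seg_mem_star hk')))
        have : p.subpath (t k) (t (k + 1)) s ∈ f '' Set.Icc (t k) (t (k + 1)) := by
          have h1 := p.range_subpath_of_le _ _ (htm k.le_succ)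
          change _ ∈ p '' _
          rw [← h1]
          exact ⟨s, rfl⟩
        obtain ⟨r, hr, hr'⟩ := this
        rw [← hr']
        exact hu hr
      have e2 : (Path.Homotopic.Quotient.mk (p.subpath 0 (t k))).trans
          (Path.Homotopic.Quotient.mk (p.subpath (t k) (t (k + 1)))) =
          Path.Homotopic.Quotient.mk (p.subpath 0 (t (k + 1))) := by
        rw [← Path.Homotopic.Quotient.mk_trans]
        exact Path.Homotopic.Quotient.eq.2 ⟨Path.Homotopy.subpathTransSubpath p _ _ _⟩
      have hQu := ih u hk
      rw [e1, ← Path.Homotopic.Quotient.trans_assoc, e2] at hQu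
      intro v h
      -- The induction hypothesis ends at the centre u of the star just used; another star
      -- containing the same point has a centre adjacent to u, reached by one edge.
      by_cases huv : u = v
      · subst huv
        exact hQu
      · have := hstep u v (S.adj_of_mem_star hk' h huv) _ hQu
        rwa [Path.Homotopic.Quotient.trans_assoc, seg_trans_edge] at this
  have := key N
  rw [hN N le_rfl] at this
  have h2 := this v h
  rwa [Path.subpath_zero_one] at h2

variable [PathConnectedSpace W] (w : W)

open Path.Homotopic.Quotient in
/-- Every element of the fundamental group is, between any two vertices, a product of edge
elements along a path of edges. -/
theorem edgeElt_induction (a : Fin S.n) (P : Fin S.n → FundamentalGroup W w → Prop) (h1 : P a 1)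
    (hstep : ∀ b b' γ, S.K.Adj b b' → P b γ → P b' (γ * S.edgeElt w b b')) (b : Fin S.n)
    (γ : FundamentalGroup W w) : P b γ := by
  -- The path is reversed because of the order of multiplication: appending an edge to c then
  -- multiplies the group element on the right by the edge element.
  let elt : ∀ v, Path.Homotopic.Quotient (S.vertex a) (S.vertex v) → FundamentalGroup W w :=
    fun v c => FundamentalGroup.fromPath (((S.tail w v).trans c.symm).trans (S.tail w a).symm)
  let c : Path.Homotopic.Quotient (S.vertex a) (S.vertex b) :=
    ((S.tail w a).symm.trans (FundamentalGroup.toPath γ).symm).trans (S.tail w b)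
  have hc : elt b c = γ := by
    change (((S.tail w b).trans c.symm).trans (S.tail w a).symm) = FundamentalGroup.toPath γ
    simp only [c, symm_trans_eq, symm_symm, trans_assoc, symm_trans_cancel, trans_symm, trans_refl]
  obtain ⟨p, hp⟩ : ∃ p, Path.Homotopic.Quotient.mk p = c := by
    induction c using Path.Homotopic.Quotient.ind with | _ p
    exact ⟨p, rfl⟩
  have key := S.path_induction p (fun v c => P v (elt v c)) (by
      intro v hv
      obtain rfl := S.mem_star_vertex hv
      rw [S.seg_vertex]
      have : elt v (Path.Homotopic.Quotient.refl _) = 1 := by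
        change ((S.tail w v).trans (Path.Homotopic.Quotient.refl _).symm).trans
          (S.tail w v).symm = Path.Homotopic.Quotient.refl w
        have h2 : (Path.Homotopic.Quotient.refl (S.vertex v)).symm = .refl _ := by
          rw [← mk_refl, ← mk_symm, Path.refl_symm]
        rw [h2, trans_refl, trans_symm]
      simpa only [this] using h1) (by
      intro v v' h c hP
      have := hstep v v' _ h hP
      convert this using 1
      rw [edgeElt, dif_pos (S.K.adj_symm h), FundamentalGroup.mul_def]
      rw [S.edge_symm (S.K.adj_symm h) h]
      change _ = (((S.tail w v').trans (S.edge h).symm).trans (S.tail w v).symm).trans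
        (((S.tail w v).trans c.symm).trans (S.tail w a).symm)
      change ((S.tail w v').trans (c.trans (S.edge h)).symm).trans (S.tail w a).symm = _
      simp only [symm_trans_eq, trans_assoc, trans_symm_cancel]) b (S.vertex_mem_star b)
  rw [seg_vertex, Path.Homotopic.Quotient.trans_refl, hp, hc] at key
  exact key

/-- A flat labelling of the edges by the elements of a group comes, up to a gauge transformation,
from a homomorphism of the fundamental group. -/
theorem exists_hom {H : Type*} [Group H] (ℓ : Fin S.n → Fin S.n → H)
    (hℓ : ∀ {x y z}, S.K.Tri x y z → ∀ i ∈ ({x, y, z} : Set (Fin S.n)),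
      ∀ j ∈ ({x, y, z} : Set (Fin S.n)), ∀ k ∈ ({x, y, z} : Set (Fin S.n)),
      ℓ i j * ℓ j k = ℓ i k) :
    ∃ (h : FundamentalGroup W w →* H) (ψ : Fin S.n → H),
      ∀ a b, S.K.Adj a b → h (S.edgeElt w a b) = (ψ a)⁻¹ * ℓ a b * ψ b := by
  choose idx hidx using S.exists_mem_star
  -- The cover is by open vertex stars. Stars with a common point have their centres in one
  -- triangle, so flatness on triangles is the cocycle condition.
  obtain ⟨m, hm, hseg⟩ := exists_transport S.star S.isOpen_star idx hidx ℓ (by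
    intro x i j k hi hj hk
    obtain ⟨a, b, c, h, -, hs⟩ := S.exists_tri x
    exact hℓ h i (hs i hi) j (hs j hj) k (hs k hk))
  have hone : ∀ x, m (Path.Homotopic.Quotient.refl x) = 1 := by
    intro x
    have := hm (Path.Homotopic.Quotient.refl x) (Path.Homotopic.Quotient.refl x)
    rw [Path.Homotopic.Quotient.refl_trans] at this
    simpa using this.symm
  have hinv : ∀ {x y : W} (p : Path.Homotopic.Quotient x y), m p.symm = (m p)⁻¹ := by
    intro x y p
    rw [eq_inv_iff_mul_eq_one, ← hm, Path.Homotopic.Quotient.trans_symm, hone]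
  have hedge : ∀ {a b} (h : S.K.Adj a b), m (S.edge h) = ℓ b a := by
    intro a b h
    obtain ⟨c, hc⟩ := id h
    have hs : ∀ t i, ((S.K.edgePath h).map S.homeo.continuous) t ∈ S.star i →
        i ∈ ({a, b, c} : Set (Fin S.n)) := fun t i hi =>
      (S.coord_edgePath h (s := {a, b, c}) (by simp) (by simp) t).2 i hi
    have := hseg ((S.K.edgePath h).map S.homeo.continuous) a (fun t i j hi hj =>
      hℓ hc i (hs t i hi) j (hs t j hj) a (by simp))
    rw [S.mem_star_vertex (hidx (S.vertex a)), S.mem_star_vertex (hidx (S.vertex b))] at this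
    have h1 : ℓ a a = 1 := by
      simpa using hℓ hc a (by simp) a (by simp) a (by simp)
    rwa [h1, inv_one, mul_one] at this
  -- The gauge function is the transport along the tails that join the base point to the vertices.
  refine ⟨⟨⟨fun γ => m (FundamentalGroup.toPath γ), hone w⟩, fun x y => hm _ _⟩,
    fun a => m (S.tail w a), fun a b h => ?_⟩
  rw [edgeElt, dif_pos (S.K.adj_symm h)]
  change m (((S.tail w b).trans (S.edge _)).trans (S.tail w a).symm) = _
  rw [hm, hm, hinv, hedge, mul_assoc]

end ClosedOrientedSurface

/-! ### Combinatorics of darts, edges and triangles -/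

namespace SurfaceComplex

variable {n : ℕ} (K : SurfaceComplex n)

/-- Oriented edges. -/
abbrev Dart : Type := {d : Fin n × Fin n // K.Adj d.1 d.2}

/-- Edges, directed from the smaller to the larger vertex. -/
abbrev Edge : Type := {d : Fin n × Fin n // K.Adj d.1 d.2 ∧ d.1 < d.2}

/-- Triangles, written in positive order starting at the smallest vertex. -/
abbrev Face : Type :=
  {t : Fin n × Fin n × Fin n // K.Tri t.1 t.2.1 t.2.2 ∧ t.1 < t.2.1 ∧ t.1 < t.2.2}

instance : Fintype K.Dart := Fintype.ofFinite _
instance : Fintype K.Edge := Fintype.ofFinite _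
instance : Fintype K.Face := Fintype.ofFinite _
instance : DecidableEq K.Edge := Classical.decEq _

variable {K}

/-- The dart of a triangle that follows a given dart. -/
def Dart.next (d : K.Dart) : K.Dart := ⟨(d.1.2, d.2.choose), ⟨_, K.rot d.2.choose_spec⟩⟩

/-- The opposite dart. -/
def Dart.rev (d : K.Dart) : K.Dart := ⟨(d.1.2, d.1.1), K.adj_symm d.2⟩

/-- The edge as a dart in its standard direction. -/
def Edge.dart (e : K.Edge) : K.Dart := ⟨e.1, e.2.1⟩

theorem Dart.next_eq {a b c : Fin n} (h : K.Adj a b) (hc : K.Tri a b c) :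
    Dart.next ⟨(a, b), h⟩ = (⟨(b, c), ⟨_, K.rot hc⟩⟩ : K.Dart) := by
  apply Subtype.ext
  exact Prod.ext rfl (K.edge_unique h.choose_spec hc)

/-- The `k`-th dart of a triangle. -/
def Face.dart (t : K.Face) : Fin 3 → K.Dart :=
  ![⟨(t.1.1, t.1.2.1), ⟨_, t.2.1⟩⟩, ⟨(t.1.2.1, t.1.2.2), ⟨_, K.rot t.2.1⟩⟩,
    ⟨(t.1.2.2, t.1.1), ⟨_, K.rot (K.rot t.2.1)⟩⟩]

theorem Face.next_dart_zero (t : K.Face) : (t.dart 0).next = t.dart 1 := Dart.next_eq _ t.2.1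
theorem Face.next_dart_one (t : K.Face) : (t.dart 1).next = t.dart 2 := Dart.next_eq _ (K.rot t.2.1)
theorem Face.next_dart_two (t : K.Face) : (t.dart 2).next = t.dart 0 :=
  Dart.next_eq _ (K.rot (K.rot t.2.1))

/-- A dart lies in one positively oriented triangle, and exactly one of the three rotations of that
triangle starts at its smallest vertex. -/
theorem dart_bijective : Function.Bijective fun p : K.Face × Fin 3 => p.1.dart p.2 := by
  constructor
  · rintro ⟨⟨⟨a, b, c⟩, (h : K.Tri a b c), (hb : a < b), (hc : a < c)⟩, i⟩
      ⟨⟨⟨a', b', c'⟩, (h' : K.Tri a' b' c'), (hb' : a' < b'), (hc' : a' < c')⟩, j⟩ hij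
    have h2 := K.rot h
    have h3 := K.rot h2
    have h2' := K.rot h'
    have h3' := K.rot h2'
    have key : ∀ {x y z x' y' z' : Fin n}, K.Tri x y z → K.Tri x' y' z' → (x, y) = (x', y') →
        x = x' ∧ y = y' ∧ z = z' := by
      intro x y z x' y' z' hx hx' e
      obtain ⟨rfl, rfl⟩ := Prod.mk.inj e
      exact ⟨rfl, rfl, K.edge_unique hx hx'⟩
    have hij' := congrArg Subtype.val hij
    fin_cases i <;> fin_cases j
    · obtain ⟨rfl, rfl, rfl⟩ := key h h' hij'; rfl
    · obtain ⟨rfl, rfl, rfl⟩ := key h h2' hij'; omega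
    · obtain ⟨rfl, rfl, rfl⟩ := key h h3' hij'; omega
    · obtain ⟨rfl, rfl, rfl⟩ := key h2 h' hij'; omega
    · obtain ⟨rfl, rfl, rfl⟩ := key h2 h2' hij'; rfl
    · obtain ⟨rfl, rfl, rfl⟩ := key h2 h3' hij'; omega
    · obtain ⟨rfl, rfl, rfl⟩ := key h3 h' hij'; omega
    · obtain ⟨rfl, rfl, rfl⟩ := key h3 h2' hij'; omega
    · obtain ⟨rfl, rfl, rfl⟩ := key h3 h3' hij'; rfl
  · rintro ⟨⟨a, b⟩, c, (h : K.Tri a b c)⟩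
    have h2 := K.rot h
    have h3 := K.rot h2
    have n1 := K.ne h
    have n2 := K.ne h2
    have n3 := K.ne h3
    rcases lt_or_gt_of_ne n1 with h1 | h1
    · rcases lt_or_gt_of_ne n3 with h4 | h4
      · exact ⟨(⟨(c, a, b), h3, h4, h4.trans h1⟩, 1), rfl⟩
      · exact ⟨(⟨(a, b, c), h, h1, h4⟩, 0), rfl⟩
    · rcases lt_or_gt_of_ne n2 with h4 | h4
      · exact ⟨(⟨(b, c, a), h2, h4, h1⟩, 2), rfl⟩
      · exact ⟨(⟨(c, a, b), h3, h4.trans h1, h4⟩, 1), rfl⟩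

/-- Every oriented edge belongs to exactly one triangle. -/
def faceEquiv : K.Face × Fin 3 ≃ K.Dart := Equiv.ofBijective _ dart_bijective

theorem edge_dart_bijective :
    Function.Bijective fun p : K.Edge × Bool => if p.2 then p.1.dart else p.1.dart.rev := by
  constructor
  · rintro ⟨⟨⟨a, b⟩, h, (hb : a < b)⟩, i⟩ ⟨⟨⟨a', b'⟩, h', (hb' : a' < b')⟩, j⟩ hij
    have hij' := congrArg Subtype.val hij
    cases i <;> cases j <;> obtain ⟨rfl, rfl⟩ := Prod.mk.inj hij'
    · rfl
    · exact absurd hb hb'.asymm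
    · exact absurd hb hb'.asymm
    · rfl
  · rintro ⟨⟨a, b⟩, h⟩
    rcases lt_or_gt_of_ne (K.adj_ne h) with h1 | h1
    · exact ⟨(⟨(a, b), h, h1⟩, true), rfl⟩
    · exact ⟨(⟨(b, a), K.adj_symm h, h1⟩, false), rfl⟩

theorem prod_face {M : Type*} [CommMonoid M] (F : K.Dart → M) :
    ∏ t : K.Face, (F (t.dart 0) * F (t.dart 1) * F (t.dart 2)) = ∏ d, F d := by
  rw [← Equiv.prod_comp faceEquiv, Fintype.prod_prod_type]
  exact Finset.prod_congr rfl fun t _ => (Fin.prod_univ_three fun k => F (t.dart k)).symm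

theorem prod_edge {M : Type*} [CommMonoid M] (F : K.Dart → M) :
    ∏ e : K.Edge, (F e.dart * F e.dart.rev) = ∏ d, F d := by
  rw [← Equiv.prod_comp (Equiv.ofBijective _ edge_dart_bijective), Fintype.prod_prod_type]
  refine Finset.prod_congr rfl fun e _ => ?_
  rw [Fintype.prod_bool]
  rfl

/-- Regrouped by edges instead of triangles, the product pairs every dart with its opposite. This is
where the surface being closed and oriented enters. -/
theorem prod_face_eq_one {M : Type*} [CommGroup M] (F : K.Dart → M)
    (hF : ∀ d, F d.rev = (F d)⁻¹) :
    ∏ t : K.Face, (F (t.dart 0) * F (t.dart 1) * F (t.dart 2)) = 1 := by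
  rw [prod_face, ← prod_edge]
  exact Finset.prod_eq_one fun e _ => by rw [hF, mul_inv_cancel]

theorem eulerChar_eq :
    K.eulerChar = (n : ℤ) - Fintype.card K.Edge + Fintype.card K.Face := by
  have h1 : ({s | ∃ a b c, K.Tri a b c ∧ s = {a, b}} : Set (Finset (Fin n))) =
      Set.range fun e : K.Edge => ({e.1.1, e.1.2} : Finset (Fin n)) := by
    ext s
    constructor
    · rintro ⟨a, b, c, h, rfl⟩
      rcases lt_or_gt_of_ne (K.ne h) with h1 | h1
      · exact ⟨⟨(a, b), ⟨c, h⟩, h1⟩, rfl⟩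
      · exact ⟨⟨(b, a), K.adj_symm ⟨c, h⟩, h1⟩, Finset.pair_comm _ _⟩
    · rintro ⟨⟨⟨a, b⟩, ⟨c, h⟩, -⟩, rfl⟩
      exact ⟨a, b, c, h, rfl⟩
  have h2 : ({s | ∃ a b c, K.Tri a b c ∧ s = {a, b, c}} : Set (Finset (Fin n))) =
      Set.range fun t : K.Face => ({t.1.1, t.1.2.1, t.1.2.2} : Finset (Fin n)) := by
    ext s
    constructor
    · rintro ⟨a, b, c, h, rfl⟩
      obtain ⟨⟨t, k⟩, ht⟩ := dart_bijective.2 (⟨(a, b), ⟨c, h⟩⟩ : K.Dart)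
      obtain ⟨⟨x, y, z⟩, (hx : K.Tri x y z), h1, h2⟩ := t
      refine ⟨⟨(x, y, z), hx, h1, h2⟩, ?_⟩
      have ht' := congrArg Subtype.val ht
      have hy := K.rot hx
      have hz := K.rot hy
      fin_cases k <;> obtain ⟨h3, h4⟩ := Prod.mk.inj ht' <;> change _ = a at h3 <;>
        change _ = b at h4 <;> subst h3 h4
      · obtain rfl := K.edge_unique hx h; rfl
      · obtain rfl := K.edge_unique hy h; ext; simp; tauto
      · obtain rfl := K.edge_unique hz h; ext; simp; tauto
    · rintro ⟨⟨⟨a, b, c⟩, h, -⟩, rfl⟩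
      exact ⟨a, b, c, h, rfl⟩
  have i1 : Function.Injective fun e : K.Edge => ({e.1.1, e.1.2} : Finset (Fin n)) := by
    rintro ⟨⟨a, b⟩, h, (hb : a < b)⟩ ⟨⟨a', b'⟩, h', (hb' : a' < b')⟩ e
    change ({a, b} : Finset (Fin n)) = {a', b'} at e
    have e1 : a ∈ ({a', b'} : Finset (Fin n)) := e ▸ by simp
    have e2 : b ∈ ({a', b'} : Finset (Fin n)) := e ▸ by simp
    simp only [Finset.mem_insert, Finset.mem_singleton] at e1 e2
    rcases e1 with rfl | rfl <;> rcases e2 with rfl | rfl <;> first | rfl | omega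
  have i2 : Function.Injective
      fun t : K.Face => ({t.1.1, t.1.2.1, t.1.2.2} : Finset (Fin n)) := by
    rintro ⟨⟨a, b, c⟩, (h : K.Tri a b c), (hb : a < b), (hc : a < c)⟩
      ⟨⟨a', b', c'⟩, (h' : K.Tri a' b' c'), (hb' : a' < b'), (hc' : a' < c')⟩ e
    change ({a, b, c} : Finset (Fin n)) = {a', b', c'} at e
    have e1 : a ∈ ({a', b', c'} : Finset (Fin n)) := e ▸ by simp
    have e2 : b ∈ ({a', b', c'} : Finset (Fin n)) := e ▸ by simp
    have e3 : c ∈ ({a', b', c'} : Finset (Fin n)) := e ▸ by simp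
    have e1' : a' ∈ ({a, b, c} : Finset (Fin n)) := e ▸ by simp
    have n2 := K.ne (K.rot h)
    simp only [Finset.mem_insert, Finset.mem_singleton] at e1 e2 e3 e1'
    have ha : a = a' := by omega
    subst ha
    have e2' : b = b' ∨ b = c' := by omega
    rcases e2' with rfl | rfl
    · obtain rfl := K.edge_unique h h'; rfl
    · obtain rfl : c = b' := by omega
      -- The same three vertices cannot span triangles of both orientations.
      exact absurd (K.rot (K.rot h')) (K.asymm h)
  rw [eulerChar, h1, h2, ← Nat.card_coe_set_eq, ← Nat.card_coe_set_eq,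
    Nat.card_congr (Equiv.ofInjective _ i1).symm, Nat.card_congr (Equiv.ofInjective _ i2).symm,
    Nat.card_eq_fintype_card, Nat.card_eq_fintype_card]

-- Converts the signed sum over increasing triples in the fundamental chain into a product over
-- faces. A negative triple a < b < c is the face (a, c, b), which accounts for the inverse in the
-- second hypothesis.
open Classical in
theorem prod_ordered {M : Type*} [CommGroup M] (Ω ω : Fin n → Fin n → Fin n → M)
    (h1 : ∀ a b c, K.Tri a b c → a < b → b < c → ω a b c = Ω a b c)
    (h2 : ∀ a b c, K.Tri a c b → a < b → b < c → (ω a b c)⁻¹ = Ω a c b) :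
    ∏ a, ∏ b, ∏ c, (if a < b ∧ b < c then
      ω a b c ^ ((if K.Tri a b c then (1 : ℤ) else 0) - if K.Tri b a c then 1 else 0) else 1) =
      ∏ t : K.Face, Ω t.1.1 t.1.2.1 t.1.2.2 := by
  have e1 : ∀ a b c, (if a < b ∧ b < c then
      ω a b c ^ ((if K.Tri a b c then (1 : ℤ) else 0) - if K.Tri b a c then 1 else 0) else 1) =
      (if K.Tri a b c ∧ a < b ∧ b < c then Ω a b c else 1) *
        (if K.Tri a c b ∧ a < b ∧ b < c then Ω a c b else 1) := by
    intro a b c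
    have hr : K.Tri b a c ↔ K.Tri a c b := ⟨K.rot, fun h => K.rot (K.rot h)⟩
    simp only [hr]
    by_cases h : a < b ∧ b < c
    · have : K.Tri a b c → ¬ K.Tri a c b := fun h1 h2 => K.asymm h1 (hr.2 h2)
      by_cases t1 : K.Tri a b c
      · simp [h, t1, this t1, h1 a b c t1 h.1 h.2]
      · by_cases t2 : K.Tri a c b
        · simp [h, t1, t2, ← h2 a b c t2 h.1 h.2]
        · simp [h, t1, t2]
    · simp [h]
  simp only [e1, Finset.prod_mul_distrib]
  have e2 : ∏ a, ∏ b, ∏ c, (if K.Tri a c b ∧ a < b ∧ b < c then Ω a c b else 1) =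
      ∏ a, ∏ b, ∏ c, (if K.Tri a b c ∧ a < c ∧ c < b then Ω a b c else 1) :=
    Finset.prod_congr rfl fun a _ => Finset.prod_comm
  rw [e2]
  simp only [← Finset.prod_mul_distrib]
  have e3 : ∏ t : K.Face, Ω t.1.1 t.1.2.1 t.1.2.2 =
      ∏ t : Fin n × Fin n × Fin n,
        if K.Tri t.1 t.2.1 t.2.2 ∧ t.1 < t.2.1 ∧ t.1 < t.2.2 then Ω t.1 t.2.1 t.2.2 else 1 := by
    rw [← Finset.prod_filter]
    symm
    apply Finset.prod_subtype
    simp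
  rw [e3, Fintype.prod_prod_type]
  refine Finset.prod_congr rfl fun a _ => ?_
  rw [Fintype.prod_prod_type]
  refine Finset.prod_congr rfl fun b _ => Finset.prod_congr rfl fun c _ => ?_
  by_cases t : K.Tri a b c
  · have := K.ne (K.rot t)
    dsimp only
    rcases lt_or_gt_of_ne this with h | h
    · by_cases h' : a < b
      · simp [t, h, h', h.not_gt, h'.trans h]
      · have : ¬ (a < c ∧ c < b) := by omega
        simp [t, h', this]
    · by_cases h' : a < c
      · simp [t, h, h', h.not_gt, h'.trans h]
      · have : ¬ (a < b ∧ b < c) := by omega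
        simp [t, h', this]
  · simp [t]

/-- Reversing a dart and passing to the next one turns it about its source to a neighbouring dart.
Since the link of the vertex is connected, an invariant function depends on the source only. -/
theorem eq_of_rotation {X : Type*} (f : K.Dart → X) (hf : ∀ d, f d = f d.rev.next)
    {a b b' : Fin n} (h : K.Adj a b) (h' : K.Adj a b') : f ⟨(a, b), h⟩ = f ⟨(a, b'), h'⟩ := by
  obtain ⟨c, hc⟩ := id h
  obtain ⟨c', hc'⟩ := id h'
  have key := K.link_connected hc hc'
  clear hc'
  induction key with
  | refl => rfl
  | tail _ hxy ih =>
    rename_i x y _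
    rw [ih, hf ⟨(a, y), h'⟩]
    congr 1
    exact (Dart.next_eq _ (K.rot (K.rot hxy))).symm

end SurfaceComplex

/-! ### Contraction of matrix networks on the surface -/

namespace SurfaceComplex

variable {n : ℕ} {K : SurfaceComplex n}

theorem trace_triple {X : Type*} [Fintype X] [DecidableEq X] (w : X → ℂ) (A B C : Matrix X X ℂ) :
    (Matrix.diagonal w * A * B * C).trace =
      ∑ h : Fin 3 → X, w (h 0) * (A (h 0) (h 1) * B (h 1) (h 2) * C (h 2) (h 0)) := by
  have e : (Matrix.diagonal w * A * B * C).trace =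
      ∑ p, ∑ q, ∑ r, w p * (A p q * B q r * C r p) := by
    rw [Matrix.mul_assoc, Matrix.mul_assoc, Matrix.trace]
    refine Finset.sum_congr rfl fun p _ => ?_
    rw [Matrix.diag_apply, Matrix.diagonal_mul, Matrix.mul_apply, Finset.mul_sum]
    refine Finset.sum_congr rfl fun q _ => ?_
    rw [Matrix.mul_apply, Finset.mul_sum, Finset.mul_sum]
    exact Finset.sum_congr rfl fun r _ => by ring
  rw [e, ← (Fin.consEquiv fun _ => X).sum_comp, Fintype.sum_prod_type]
  refine Finset.sum_congr rfl fun p _ => ?_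
  rw [← (Fin.consEquiv fun _ => X).sum_comp, Fintype.sum_prod_type]
  refine Finset.sum_congr rfl fun q _ => ?_
  rw [← (Fin.consEquiv fun _ => X).sum_comp, Fintype.sum_prod_type]
  refine Finset.sum_congr rfl fun r _ => ?_
  rw [Fintype.sum_unique]
  rfl

/-- Contraction of a network of matrices over a closed surface: traces around the triangles,
orthogonality relations along the edges. -/
theorem sum_prod_trace {X Φ : Type*} [Fintype X] [DecidableEq X] [Fintype Φ]
    (U : (K.Edge → Φ) → K.Dart → Matrix X X ℂ) (Up Um : K.Edge → Φ → Matrix X X ℂ)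
    (hp : ∀ x e, U x e.dart = Up e (x e)) (hm : ∀ x e, U x e.dart.rev = Um e (x e))
    (wt : K.Face → X → ℂ) (κ : K.Edge → X → X → ℂ)
    (hκ : ∀ e p q r s, ∑ y, Up e y p q * Um e y r s = if p = s ∧ q = r then κ e p q else 0) :
    ∑ x, ∏ t : K.Face, (Matrix.diagonal (wt t) * U x (t.dart 0) * U x (t.dart 1) *
        U x (t.dart 2)).trace =
      ∑ s : Fin n → X, (∏ t : K.Face, wt t (s t.1.1)) * ∏ e : K.Edge, κ e (s e.1.1) (s e.1.2) := by
  -- Expanding the traces puts one matrix index on every dart, at the corner of the triangle where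
  -- the dart starts. The factors are then regrouped by edges.
  have e1 : ∀ x, ∏ t : K.Face, (Matrix.diagonal (wt t) * U x (t.dart 0) * U x (t.dart 1) *
        U x (t.dart 2)).trace =
      ∑ f : K.Dart → X, (∏ t : K.Face, wt t (f (t.dart 0))) *
        ∏ e : K.Edge, (Up e (x e) (f e.dart) (f e.dart.next) *
          Um e (x e) (f e.dart.rev) (f e.dart.rev.next)) := by
    intro x
    have h1 : ∀ f : K.Dart → X, ∏ e : K.Edge, (Up e (x e) (f e.dart) (f e.dart.next) *
          Um e (x e) (f e.dart.rev) (f e.dart.rev.next)) =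
        ∏ t : K.Face, (U x (t.dart 0) (f (t.dart 0)) (f (t.dart 1)) *
          U x (t.dart 1) (f (t.dart 1)) (f (t.dart 2)) *
          U x (t.dart 2) (f (t.dart 2)) (f (t.dart 0))) := by
      intro f
      calc _ = ∏ e : K.Edge, ((fun d => U x d (f d) (f d.next)) e.dart *
            (fun d => U x d (f d) (f d.next)) e.dart.rev) := by
            simp only [hp, hm]
        _ = ∏ t : K.Face, ((fun d => U x d (f d) (f d.next)) (t.dart 0) *
            (fun d => U x d (f d) (f d.next)) (t.dart 1) *
            (fun d => U x d (f d) (f d.next)) (t.dart 2)) := by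
            exact (prod_edge fun d => U x d (f d) (f d.next)).trans (prod_face _).symm
        _ = _ := by
            simp only [Face.next_dart_zero, Face.next_dart_one, Face.next_dart_two]
    simp only [trace_triple]
    rw [Finset.prod_univ_sum, Fintype.piFinset_univ]
    let E : (K.Dart → X) ≃ (K.Face → Fin 3 → X) :=
      (Equiv.arrowCongr faceEquiv.symm (Equiv.refl X)).trans (Equiv.curry _ _ _)
    rw [← E.sum_comp]
    refine Finset.sum_congr rfl fun f _ => ?_
    rw [h1, ← Finset.prod_mul_distrib]
    rfl
  simp only [e1]
  rw [Finset.sum_comm]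
  -- With the indices fixed, the sum over x is a product of one sum per edge, and each is given by
  -- the orthogonality relation.
  have e2 : ∀ f : K.Dart → X, ∑ x : K.Edge → Φ, (∏ t : K.Face, wt t (f (t.dart 0))) *
        ∏ e : K.Edge, (Up e (x e) (f e.dart) (f e.dart.next) *
          Um e (x e) (f e.dart.rev) (f e.dart.rev.next)) =
      (∏ t : K.Face, wt t (f (t.dart 0))) * ∏ e : K.Edge,
        if f e.dart = f e.dart.rev.next ∧ f e.dart.next = f e.dart.rev then
          κ e (f e.dart) (f e.dart.next) else 0 := by
    intro f
    rw [← Finset.mul_sum]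
    congr 1
    simp only [← hκ]
    rw [Finset.prod_univ_sum, Fintype.piFinset_univ]
  simp only [e2]
  symm
  -- The surviving index functions are invariant under rotation about vertices, hence come from a
  -- unique function on vertices.
  refine Fintype.sum_of_injective (fun (s : Fin n → X) (d : K.Dart) => s d.1.1) ?_ _ _ ?_ ?_
  · intro s s' h
    funext a
    obtain ⟨b, c, hc⟩ := K.vertex_mem a
    exact congrFun h ⟨(a, b), ⟨c, hc⟩⟩
  · intro f hf
    by_contra hne
    have h1 : ∀ e : K.Edge, f e.dart = f e.dart.rev.next ∧ f e.dart.next = f e.dart.rev := by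
      intro e
      by_contra he
      exact hne (mul_eq_zero_of_right _ (Finset.prod_eq_zero (Finset.mem_univ e) (if_neg he)))
    have h2 : ∀ d : K.Dart, f d = f d.rev.next := by
      intro d
      obtain ⟨⟨e, i⟩, rfl⟩ := edge_dart_bijective.2 d
      cases i
      · exact (h1 e).2.symm
      · exact (h1 e).1
    refine hf ⟨fun a => f ⟨(a, (K.vertex_mem a).choose), (K.vertex_mem a).choose_spec⟩, ?_⟩
    funext d
    exact eq_of_rotation f h2 _ _
  · intro s
    refine congrArg₂ _ rfl (Finset.prod_congr rfl fun e _ => ?_)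
    rw [if_pos ⟨rfl, rfl⟩]
    rfl

end SurfaceComplex

/-! ### The central extension, its trace, and weights of labellings -/

namespace TwistedExt

variable {Q : Type*} [Group Q] {θ : GrpTwo.cocycles Q}

/-- The central subgroup `ℂˣ` of the extension. -/
def cen (θ : GrpTwo.cocycles Q) (c : ℂˣ) : TwistedExt θ := ⟨1, c * (θ.1 1 1)⁻¹⟩

theorem cen_mul_eq (c : ℂˣ) (x : TwistedExt θ) : cen θ c * x = ⟨x.pt, c * x.sc⟩ := by
  ext1
  · simp [mul_pt, cen]
  · simp only [mul_sc, cen, cocycle_one_left]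
    rw [mul_right_comm, inv_mul_cancel_right]

theorem cen_mul (c d : ℂˣ) : cen θ (c * d) = cen θ c * cen θ d := by
  rw [cen_mul_eq]
  simp [cen, mul_assoc]

theorem cen_one : cen θ 1 = 1 := by
  ext1 <;> simp [cen, one_pt, one_sc]

theorem cen_inv (c : ℂˣ) : cen θ c⁻¹ = (cen θ c)⁻¹ := by
  rw [eq_inv_iff_mul_eq_one, ← cen_mul, inv_mul_cancel, cen_one]

theorem cen_comm (c : ℂˣ) (x : TwistedExt θ) : x * cen θ c = cen θ c * x := by
  rw [cen_mul_eq]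
  ext1
  · simp [mul_pt, cen]
  · simp only [mul_sc, cen, cocycle_one_right]
    rw [mul_assoc, mul_assoc, inv_mul_cancel, mul_one, mul_comm]

theorem eq_cen {x : TwistedExt θ} (h : x.pt = 1) : x = cen θ (x.sc * θ.1 1 1) := by
  ext1
  · exact h
  · simp [cen]

theorem std_mul_std (a b : Q) : std θ a * std θ b = cen θ (θ.1 a b) * std θ (a * b) := by
  rw [cen_mul_eq]
  ext1
  · rfl
  · simp [mul_sc, std]

open Classical in
/-- The trace of the twisted group algebra: the scalar of a central element, zero elsewhere. -/
def tau (x : TwistedExt θ) : ℂ := if x.pt = 1 then ((x.sc * θ.1 1 1 : ℂˣ) : ℂ) else 0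

theorem tau_cen (c : ℂˣ) : tau (cen θ c) = c := by
  rw [tau, if_pos (show (cen θ c).pt = 1 from rfl)]
  simp [cen]

theorem tau_cen_mul (c : ℂˣ) (x : TwistedExt θ) : tau (cen θ c * x) = c * tau x := by
  rw [cen_mul_eq, tau, tau]
  split_ifs
  · simp [mul_assoc]
  · simp

theorem tau_conj (x y : TwistedExt θ) : tau (x * y * x⁻¹) = tau y := by
  by_cases h : y.pt = 1
  · rw [eq_cen h, cen_comm, mul_inv_cancel_right]
  · rw [tau, tau, if_neg h, if_neg]
    simpa [mul_pt, inv_pt] using h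

theorem cen_mul_three (c₁ c₂ c₃ : ℂˣ) (x y z : TwistedExt θ) :
    cen θ c₁ * x * (cen θ c₂ * y) * (cen θ c₃ * z) = cen θ (c₁ * c₂ * c₃) * (x * y * z) := by
  have L : ∀ c (x y : TwistedExt θ), x * (cen θ c * y) = cen θ c * (x * y) := fun c x y => by
    rw [← mul_assoc, cen_comm, mul_assoc]
  rw [L c₃, L c₂, show c₁ * c₂ * c₃ = c₃ * (c₂ * c₁) by rw [mul_comm c₁, mul_comm], cen_mul,
    cen_mul]
  simp only [mul_assoc]

end TwistedExt

open TwistedExt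

namespace SurfaceComplex

variable {n : ℕ} {K : SurfaceComplex n}

open Classical in
/-- A labelling of the edges by group elements, extended to all oriented edges. -/
def extend {A : Type*} [Group A] (v : K.Edge → A) (d : K.Dart) : A :=
  if h : d.1.1 < d.1.2 then v ⟨d.1, d.2, h⟩
  else (v ⟨d.rev.1, d.rev.2, lt_of_le_of_ne (not_lt.1 h) (K.adj_ne d.2).symm⟩)⁻¹

section

variable {A : Type*} [Group A] (v : K.Edge → A)

theorem extend_dart (e : K.Edge) : extend v e.dart = v e := dif_pos e.2.2

theorem extend_dart_rev (e : K.Edge) : extend v e.dart.rev = (v e)⁻¹ := dif_neg e.2.2.not_gt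

theorem eq_extend (u : K.Dart → A) (hu : ∀ d, u d.rev = (u d)⁻¹) (h : ∀ e, u e.dart = v e) :
    u = extend v := by
  funext d
  obtain ⟨⟨e, i⟩, rfl⟩ := edge_dart_bijective.2 d
  cases i
  · change u e.dart.rev = extend v e.dart.rev
    rw [extend_dart_rev, hu, h]
  · change u e.dart = extend v e.dart
    rw [extend_dart, h]

theorem extend_rev (d : K.Dart) : extend v d.rev = (extend v d)⁻¹ := by
  obtain ⟨⟨e, i⟩, rfl⟩ := edge_dart_bijective.2 d
  cases i
  · change extend v e.dart = (extend v e.dart.rev)⁻¹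
    rw [extend_dart_rev, extend_dart, inv_inv]
  · change extend v e.dart.rev = (extend v e.dart)⁻¹
    rw [extend_dart_rev, extend_dart]

theorem map_extend {B : Type*} [Group B] (f : A →* B) (d : K.Dart) :
    f (extend v d) = extend (fun e => f (v e)) d :=
  congrFun (eq_extend (fun e => f (v e)) (fun d => f (extend v d))
    (fun d => by rw [extend_rev, map_inv]) (fun e => by rw [extend_dart])) d

end

variable {Q : Type*} [Group Q] {θ : GrpTwo.cocycles Q}

/-- The product over all triangles of the traces of their boundaries. -/
def weight (u : K.Dart → TwistedExt θ) : ℂ :=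
  ∏ t : K.Face, tau (u (t.dart 0) * u (t.dart 1) * u (t.dart 2))

/-- The boundary of each triangle is merely conjugated by the value of φ at its first vertex, and
`tau` is invariant under conjugation. -/
theorem weight_gauge (u : K.Dart → TwistedExt θ) (φ : Fin n → TwistedExt θ) :
    weight (fun d => φ d.1.1 * u d * (φ d.1.2)⁻¹) = weight u := by
  refine Finset.prod_congr rfl fun t _ => ?_
  refine Eq.trans ?_ (tau_conj (φ t.1.1) _)
  congr 1
  change φ t.1.1 * u (t.dart 0) * (φ t.1.2.1)⁻¹ * (φ t.1.2.1 * u (t.dart 1) * (φ t.1.2.2)⁻¹) *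
    (φ t.1.2.2 * u (t.dart 2) * (φ t.1.1)⁻¹) = _
  group

/-- The two labellings differ by central scalars that are inverse on opposite darts, and these
cancel over the closed surface. The weight therefore depends only on the underlying labels. -/
theorem weight_eq_of_pt_eq (u u' : K.Dart → TwistedExt θ) (hu : ∀ d, u d.rev = (u d)⁻¹)
    (hu' : ∀ d, u' d.rev = (u' d)⁻¹) (h : ∀ d, (u d).pt = (u' d).pt) : weight u = weight u' := by
  let F : K.Dart → ℂˣ := fun d => (u d * (u' d)⁻¹).sc * θ.1 1 1
  have hF : ∀ d, u d = cen θ (F d) * u' d := by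
    intro d
    rw [← eq_cen (by simp [mul_pt, inv_pt, h]), inv_mul_cancel_right]
  have hrev : ∀ d, F d.rev = (F d)⁻¹ := by
    intro d
    have h1 := hF d.rev
    rw [hu, hu', hF d, mul_inv_rev, ← cen_inv, cen_comm] at h1
    have h2 := mul_right_cancel h1
    have := congrArg TwistedExt.sc h2
    exact (mul_right_cancel this).symm
  have hcom : ∀ t : K.Face, u (t.dart 0) * u (t.dart 1) * u (t.dart 2) =
      cen θ (F (t.dart 0) * F (t.dart 1) * F (t.dart 2)) *
        (u' (t.dart 0) * u' (t.dart 1) * u' (t.dart 2)) := by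
    intro t
    rw [hF (t.dart 0), hF (t.dart 1), hF (t.dart 2), cen_mul_three]
  have := prod_face_eq_one F hrev
  simp only [weight, hcom, tau_cen_mul, Finset.prod_mul_distrib]
  have h3 := congrArg (Units.val) this
  rw [Units.coe_prod] at h3
  rw [h3, Units.val_one, one_mul]

end SurfaceComplex

namespace ClosedOrientedSurface

open SurfaceComplex

variable {W : Type*} [TopologicalSpace W] (S : ClosedOrientedSurface W) [PathConnectedSpace W]
  (w : W)

theorem edgeElt_swap {a b : Fin S.n} (h : S.K.Adj a b) :
    S.edgeElt w b a = (S.edgeElt w a b)⁻¹ := by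
  obtain ⟨c, hc⟩ := id h
  have h' := S.K.adj_symm h
  have h2 : S.K.Adj b c := ⟨_, S.K.rot hc⟩
  have h3 : S.K.Adj c a := ⟨_, S.K.rot (S.K.rot hc)⟩
  have e1 := S.edgeElt_mul w hc (a := a) (b := b) (c := c) (by simp) (by simp) (by simp) h'
    (S.K.adj_symm h2) h3
  have e2 := S.edgeElt_mul w hc (a := b) (b := a) (c := c) (by simp) (by simp) (by simp) h
    h3 (S.K.adj_symm h2)
  rw [← e2, ← mul_assoc] at e1
  rw [eq_inv_iff_mul_eq_one]
  have := mul_eq_right.1 e1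
  exact mul_eq_one_comm.1 this

theorem edgeElt_tri {a b c : Fin S.n} (hc : S.K.Tri a b c) :
    S.edgeElt w a b * S.edgeElt w b c = S.edgeElt w a c := by
  have h : S.K.Adj a b := ⟨_, hc⟩
  have h2 : S.K.Adj b c := ⟨_, S.K.rot hc⟩
  have h3 : S.K.Adj c a := ⟨_, S.K.rot (S.K.rot hc)⟩
  exact S.edgeElt_mul w hc (a := a) (b := b) (c := c) (by simp) (by simp) (by simp)
    (S.K.adj_symm h) (S.K.adj_symm h2) h3

/-- The class of a triangulated surface is evaluated by a product over its triangles. -/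
theorem eval_eq_weight {Q : Type*} [Group Q] (θ : GrpTwo.cocycles Q)
    (f : FundamentalGroup W w →* Q) (u : S.K.Dart → TwistedExt θ)
    (hu : ∀ d, u d.rev = (u d)⁻¹) (hpt : ∀ d, (u d).pt = f (S.edgeElt w d.1.1 d.1.2)) :
    ((GrpTwo.eval (GrpTwo.pullback f (GrpTwo.cls θ)) (S.fundamentalClass w) : ℂˣ) : ℂ) =
      weight u := by
  classical
  -- Standard lifts are used in the increasing direction, so that on an increasing triple the
  -- boundary is exactly the cocycle value appearing in the bar chain.
  let U : Fin S.n → Fin S.n → TwistedExt θ := fun a b =>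
    if a < b then std θ (f (S.edgeElt w a b)) else (std θ (f (S.edgeElt w b a)))⁻¹
  have hUpt : ∀ a b, S.K.Adj a b → (U a b).pt = f (S.edgeElt w a b) := by
    intro a b hab
    rcases lt_or_gt_of_ne (S.K.adj_ne hab) with h | h
    · simp [U, h, std]
    · simp [U, h.not_gt, std, inv_pt, S.edgeElt_swap w (S.K.adj_symm hab)]
  have e0 : weight u = weight (fun d : S.K.Dart => U d.1.1 d.1.2) := by
    refine weight_eq_of_pt_eq _ _ hu (fun d => ?_) fun d => ?_
    · rcases lt_or_gt_of_ne (S.K.adj_ne d.2) with h | h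
      · simp [U, Dart.rev, h, h.not_gt]
      · simp [U, Dart.rev, h, h.not_gt]
    · rw [hpt, hUpt _ _ d.2]
  have htri : ∀ a b c, a < b → b < c → S.edgeElt w a b * S.edgeElt w b c = S.edgeElt w a c →
      U a b * U b c = cen θ (θ.1 (f (S.edgeElt w a b)) (f (S.edgeElt w b c))) * U a c := by
    intro a b c hab hbc h
    simp only [U, if_pos hab, if_pos hbc, if_pos (hab.trans hbc)]
    rw [std_mul_std, ← map_mul, h]
  have hU : ∀ a b, a < b → U b a = (U a b)⁻¹ := by
    intro a b h
    simp [U, h, h.not_gt]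
  have key := prod_ordered (K := S.K)
    (fun a b c => (U a b * U b c * U c a).sc * θ.1 1 1)
    (fun a b c => θ.1 (f (S.edgeElt w a b)) (f (S.edgeElt w b c))) (by
      intro a b c h hab hbc
      have := htri a b c hab hbc (S.edgeElt_tri w h)
      rw [this, hU a c (hab.trans hbc), mul_inv_cancel_right]
      simp [cen]) (by
      intro a b c h hab hbc
      have h1 : S.edgeElt w a b * S.edgeElt w b c = S.edgeElt w a c := by
        rw [← S.edgeElt_tri w h, S.edgeElt_swap w (S.K.adj_symm ⟨_, S.K.rot h⟩),
          inv_mul_cancel_right]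
      have := htri a b c hab hbc h1
      rw [hU b c hbc, hU a b hab, mul_assoc, ← mul_inv_rev, this, mul_inv_rev, mul_inv_cancel_left,
        ← cen_inv]
      simp [cen])
  rw [e0]
  have e1 : ((GrpTwo.eval (GrpTwo.pullback f (GrpTwo.cls θ)) (S.fundamentalClass w) : ℂˣ)) =
      ∏ t : S.K.Face, ((U t.1.1 t.1.2.1 * U t.1.2.1 t.1.2.2 * U t.1.2.2 t.1.1).sc * θ.1 1 1) := by
    rw [← key]
    change (GrpTwo.evalChain (GrpTwo.cocyclesMap f θ).1 (S.fundamentalChain w)).toMul = _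
    rw [fundamentalChain]
    simp only [map_sum, toMul_sum]
    refine Finset.prod_congr rfl fun a _ => Finset.prod_congr rfl fun b _ =>
      Finset.prod_congr rfl fun c _ => ?_
    by_cases h : a < b ∧ b < c
    · rw [if_pos h, if_pos h, map_zsmul, GrpTwo.evalChain, Finsupp.liftAddHom_apply_single,
        zmultiplesHom_apply, one_smul, toMul_zsmul]
      rfl
    · rw [if_neg h, if_neg h, map_zero, toMul_zero]
  rw [e1, Units.coe_prod]
  refine Finset.prod_congr rfl fun t _ => ?_
  rw [tau, if_pos]
  · rfl
  · change (U t.1.1 t.1.2.1).pt * (U t.1.2.1 t.1.2.2).pt * (U t.1.2.2 t.1.1).pt = 1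
    have h1 := t.2.1
    have h3 : S.K.Adj t.1.2.2 t.1.1 := ⟨_, S.K.rot (S.K.rot h1)⟩
    rw [hUpt _ _ ⟨_, h1⟩, hUpt _ _ ⟨_, S.K.rot h1⟩, hUpt _ _ h3, ← map_mul, S.edgeElt_tri w h1,
      S.edgeElt_swap w (S.K.adj_symm h3), map_inv, mul_inv_cancel]

end ClosedOrientedSurface

/-! ### Lifts of g as flat labellings -/

open SurfaceComplex

namespace SurfaceComplex

variable {n : ℕ} {K : SurfaceComplex n}

open Classical in
/-- A labelling of oriented edges, extended by `1` to all pairs of vertices. -/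
def toPairs {A : Type*} [One A] (u : K.Dart → A) (a b : Fin n) : A :=
  if h : K.Adj a b then u ⟨(a, b), h⟩ else 1

theorem toPairs_dart {A : Type*} [One A] (u : K.Dart → A) (d : K.Dart) :
    toPairs u d.1.1 d.1.2 = u d := dif_pos d.2

/-- Supplies the hypothesis of `exists_hom`, which needs all triples of vertices of a triangle in
any order and with repetitions. They reduce to the boundary relation, inverses and the default value
1 on equal vertices. -/
theorem toPairs_flat {A : Type*} [Group A] (u : K.Dart → A) (hu : ∀ d, u d.rev = (u d)⁻¹)
    (hflat : ∀ t : K.Face, u (t.dart 0) * u (t.dart 1) * u (t.dart 2) = 1)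
    {x y z : Fin n} (h : K.Tri x y z) (i : Fin n) (hi : i ∈ ({x, y, z} : Set (Fin n)))
    (j : Fin n) (hj : j ∈ ({x, y, z} : Set (Fin n))) (k : Fin n)
    (hk : k ∈ ({x, y, z} : Set (Fin n))) :
    toPairs u i j * toPairs u j k = toPairs u i k := by
  have hself : ∀ i, toPairs u i i = 1 := fun i => dif_neg fun h => K.adj_ne h rfl
  have hinv : ∀ {i j}, K.Adj i j → toPairs u j i = (toPairs u i j)⁻¹ := by
    intro i j hij
    exact (toPairs_dart u (Dart.rev ⟨(i, j), hij⟩)).trans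
      ((hu _).trans (congrArg _ (toPairs_dart u ⟨(i, j), hij⟩).symm))
  have hnext : ∀ d : K.Dart, u d * u d.next * u d.next.next = 1 := by
    intro d
    obtain ⟨⟨t, k⟩, rfl⟩ := dart_bijective.2 d
    have := hflat t
    fin_cases k
    · change u (t.dart 0) * u (t.dart 0).next * u (t.dart 0).next.next = 1
      rw [t.next_dart_zero, t.next_dart_one, this]
    · change u (t.dart 1) * u (t.dart 1).next * u (t.dart 1).next.next = 1
      rw [t.next_dart_one, t.next_dart_two]
      rw [mul_assoc] at this
      exact mul_eq_one_comm.1 this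
    · change u (t.dart 2) * u (t.dart 2).next * u (t.dart 2).next.next = 1
      rw [t.next_dart_two, t.next_dart_zero, mul_assoc]
      exact mul_eq_one_comm.1 this
  have hxy : K.Adj x y := ⟨_, h⟩
  have hyz : K.Adj y z := ⟨_, K.rot h⟩
  have hzx : K.Adj z x := ⟨_, K.rot (K.rot h)⟩
  have key : toPairs u x y * toPairs u y z * toPairs u z x = 1 := by
    have := hnext ⟨(x, y), hxy⟩
    have e1 : Dart.next ⟨(x, y), hxy⟩ = (⟨(y, z), hyz⟩ : K.Dart) := Dart.next_eq _ h
    have e2 : Dart.next ⟨(y, z), hyz⟩ = (⟨(z, x), hzx⟩ : K.Dart) := Dart.next_eq _ (K.rot h)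
    rw [e1, e2, ← toPairs_dart u, ← toPairs_dart u, ← toPairs_dart u] at this
    exact this
  have h1 := hinv hxy
  have h2 := hinv hyz
  have h3 := hinv hzx
  have e : toPairs u z x = (toPairs u y z)⁻¹ * (toPairs u x y)⁻¹ := by
    rw [← mul_inv_rev, eq_inv_iff_mul_eq_one]
    exact mul_eq_one_comm.1 key
  rw [e] at h3
  rcases hi with rfl | rfl | rfl <;> rcases hj with rfl | rfl | rfl <;>
    rcases hk with rfl | rfl | rfl <;> simp only [hself, h1, h2, h3, e] <;> group

end SurfaceComplex

/-- A function is its value at v times a function normalised at v. The product form avoids an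
exponent with subtraction. -/
theorem card_pointed {V Γ : Type*} [Finite V] [Group Γ] (v : V) :
    Nat.card {φ : V → Γ // φ v = 1} * Nat.card Γ = Nat.card Γ ^ Nat.card V := by
  rw [← Nat.card_prod, ← Nat.card_fun]
  refine Nat.card_congr
    { toFun := fun p a => p.2 * p.1.1 a
      invFun := fun φ => (⟨fun a => (φ v)⁻¹ * φ a, by simp⟩, φ v)
      left_inv := ?_
      right_inv := ?_ }
  · rintro ⟨⟨φ, hφ⟩, γ⟩
    simp [hφ]
  · intro φ
    simp

namespace ClosedOrientedSurface

variable {W : Type*} [TopologicalSpace W] (S : ClosedOrientedSurface W) [PathConnectedSpace W]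
  (w : W) {G G' : Type*} [Group G] [Group G'] {q : G' →* G} {θ : GrpTwo.cocycles G'}
  {g : FundamentalGroup W w →* G}

/-- The labelling of the edges by the translates of given labels by elements of the kernel. -/
def shifted (s : S.K.Edge → TwistedExt θ) (k : S.K.Edge → q.ker) : S.K.Dart → TwistedExt θ :=
  extend fun e => s e * std θ (k e).1

/-- Homomorphisms over `g` up to gauge, as labellings of the edges. -/
def ofLift (s : S.K.Edge → TwistedExt θ)
    (hs : ∀ e, q (s e).pt = g (S.edgeElt w e.1.1 e.1.2)) (v : Fin S.n)
    (p : Lifts q g × {φ : Fin S.n → q.ker // φ v = 1}) (e : S.K.Edge) : q.ker :=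
  ⟨(s e).pt⁻¹ * ((p.2.1 e.1.1).1⁻¹ * p.1.1 (S.edgeElt w e.1.1 e.1.2) * (p.2.1 e.1.2).1), by
    have h1 : ∀ a, q (p.2.1 a).1 = 1 := fun a => (p.2.1 a).2
    have h2 : q (p.1.1 (S.edgeElt w e.1.1 e.1.2)) = g (S.edgeElt w e.1.1 e.1.2) :=
      DFunLike.congr_fun p.1.2 _
    rw [MonoidHom.mem_ker]
    simp [h1, h2, hs]⟩

variable {w} (s : S.K.Edge → TwistedExt θ)
  (hs : ∀ e, q (s e).pt = g (S.edgeElt w e.1.1 e.1.2)) (v : Fin S.n)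

theorem ofLift_pt (p : Lifts q g × {φ : Fin S.n → q.ker // φ v = 1}) (d : S.K.Dart) :
    (S.shifted s (S.ofLift w s hs v p) d).pt =
      (p.2.1 d.1.1).1⁻¹ * p.1.1 (S.edgeElt w d.1.1 d.1.2) * (p.2.1 d.1.2).1 := by
  have h1 := map_extend (fun e => s e * std θ (S.ofLift w s hs v p e).1) (proj (θ := θ)) d
  refine h1.trans (congrFun (eq_extend _ (fun d : S.K.Dart =>
    (p.2.1 d.1.1).1⁻¹ * p.1.1 (S.edgeElt w d.1.1 d.1.2) * (p.2.1 d.1.2).1) ?_ ?_) d).symm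
  · intro d
    change _ * p.1.1 (S.edgeElt w d.1.2 d.1.1) * _ = _
    rw [S.edgeElt_swap w d.2, map_inv, mul_inv_rev, mul_inv_rev, inv_inv]
    simp only [mul_assoc]
    rfl
  · intro e
    change _ = (s e).pt * ((s e).pt⁻¹ * _)
    rw [mul_inv_cancel_left]
    rfl

/-- The labels determine the product of the homomorphism at γ with the gauge value at b, by
induction along edges from v, where the gauge is 1. Setting γ = 1 recovers the gauge, then b = v the
homomorphism. -/
theorem ofLift_injective : Function.Injective (S.ofLift w s hs v) := by
  intro p p' h
  have key : ∀ b γ, p.1.1 γ * (p.2.1 b).1 = p'.1.1 γ * (p'.2.1 b).1 := by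
    refine S.edgeElt_induction w v _ ?_ ?_
    · rw [p.2.2, p'.2.2, map_one, map_one]
    · intro b b' γ hb hP
      have h1 := S.ofLift_pt s hs v p ⟨(b, b'), hb⟩
      have h2 := S.ofLift_pt s hs v p' ⟨(b, b'), hb⟩
      rw [h, h2] at h1
      have h3 := congrArg₂ (· * ·) hP h1.symm
      simp only [mul_assoc, mul_inv_cancel_left] at h3
      simp only [map_mul, mul_assoc]
      exact h3
  have h1 : ∀ b, p.2.1 b = p'.2.1 b := fun b => Subtype.ext (by
    have := key b 1
    rwa [map_one, map_one, one_mul, one_mul] at this)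
  refine Prod.ext (Subtype.ext (MonoidHom.ext fun γ => ?_)) (Subtype.ext (funext h1))
  have := key v γ
  rw [h1] at this
  exact mul_right_cancel this

theorem weight_ofLift (p : Lifts q g × {φ : Fin S.n → q.ker // φ v = 1}) :
    weight (S.shifted s (S.ofLift w s hs v p)) =
      ((GrpTwo.eval (GrpTwo.pullback p.1.1 (GrpTwo.cls θ)) (S.fundamentalClass w) : ℂˣ) : ℂ) := by
  let φ : Fin S.n → TwistedExt θ := fun a => std θ (p.2.1 a).1
  rw [← weight_gauge _ φ]
  refine (S.eval_eq_weight w θ p.1.1 _ (fun d => ?_) fun d => ?_).symm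
  · change φ d.1.2 * _ * (φ d.1.1)⁻¹ = _
    rw [shifted, extend_rev]
    simp only [mul_inv_rev, inv_inv, mul_assoc]
  · change (p.2.1 d.1.1).1 * (S.shifted s _ d).pt * (p.2.1 d.1.2).1⁻¹ = _
    rw [ofLift_pt]
    group

/-- Every factor `tau` is nonzero, so the labelling is flat in G' and `exists_hom` integrates it.
What remains is to normalise the homomorphism so that it covers g exactly. -/
theorem exists_ofLift (k : S.K.Edge → q.ker) (hk : weight (S.shifted s k) ≠ 0) :
    ∃ p, S.ofLift w s hs v p = k := by
  let u : S.K.Dart → G' := fun d => (S.shifted s k d).pt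
  have hu : ∀ d, u d.rev = (u d)⁻¹ := fun d => congrArg TwistedExt.pt (extend_rev _ d)
  have hflat : ∀ t : S.K.Face, u (t.dart 0) * u (t.dart 1) * u (t.dart 2) = 1 := by
    intro t
    have := Finset.prod_ne_zero_iff.1 hk t (Finset.mem_univ _)
    by_contra h
    exact this (if_neg h)
  obtain ⟨h, ψ, hψ⟩ := S.exists_hom w (toPairs u) (toPairs_flat u hu hflat)
  have hψ' : ∀ d : S.K.Dart, h (S.edgeElt w d.1.1 d.1.2) = (ψ d.1.1)⁻¹ * u d * ψ d.1.2 :=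
    fun d => by rw [hψ _ _ d.2, toPairs_dart]
  have hqu : ∀ d, q (u d) = g (S.edgeElt w d.1.1 d.1.2) := by
    intro d
    have h1 := map_extend (fun e => s e * std θ (k e).1) (q.comp (proj (θ := θ))) d
    refine h1.trans (congrFun (eq_extend _
      (fun d : S.K.Dart => g (S.edgeElt w d.1.1 d.1.2)) ?_ ?_) d).symm
    · intro d
      change g (S.edgeElt w d.1.2 d.1.1) = _
      rw [S.edgeElt_swap w d.2, map_inv]
    · intro e
      change _ = q ((s e).pt * (k e).1)
      have : q (k e).1 = 1 := (k e).2
      rw [map_mul, hs, this, mul_one]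
      rfl
  -- Modulo Γ the homomorphism is g up to a change of gauge. The case γ = 1 shows that this gauge is
  -- constant, and b = v shows that it is a conjugation.
  have key : ∀ b γ, q (h γ) = (q (ψ v))⁻¹ * g γ * q (ψ b) := by
    refine S.edgeElt_induction w v _ (by rw [map_one, map_one, map_one]; group) ?_
    intro b b' γ hb hP
    rw [map_mul, map_mul, hP, hψ' ⟨(b, b'), hb⟩]
    simp only [map_mul, map_inv, hqu, mul_assoc, mul_inv_cancel_left]
  have hqψ : ∀ b, q (ψ b) = q (ψ v) := by
    intro b
    have := key b 1
    rw [map_one, map_one, map_one, mul_one] at this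
    exact (inv_mul_eq_one.1 this.symm).symm
  -- Conjugating by ψ v undoes the discrepancy with g; the gauge function ψ v * (ψ a)⁻¹ then lies in
  -- Γ and is 1 at v.
  let g' : FundamentalGroup W w →* G' := (MulAut.conj (ψ v)).toMonoidHom.comp h
  have hg' : q.comp g' = g := by
    ext γ
    change q (ψ v * h γ * (ψ v)⁻¹) = _
    rw [map_mul, map_mul, key v, map_inv]
    group
  refine ⟨(⟨g', hg'⟩, ⟨fun a => ⟨ψ v * (ψ a)⁻¹, by simp [MonoidHom.mem_ker, hqψ]⟩, ?_⟩), ?_⟩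
  · apply Subtype.ext
    simp
  · funext e
    apply Subtype.ext
    change (s e).pt⁻¹ * ((ψ v * (ψ e.1.1)⁻¹)⁻¹ * (ψ v * h (S.edgeElt w e.1.1 e.1.2) * (ψ v)⁻¹) *
      (ψ v * (ψ e.1.2)⁻¹)) = (k e).1
    have h1 : u e.dart = (s e).pt * (k e).1 := congrArg TwistedExt.pt (extend_dart _ e)
    have h2 := hψ' e.dart
    rw [h1] at h2
    change h (S.edgeElt w e.1.1 e.1.2) = (ψ e.1.1)⁻¹ * ((s e).pt * (k e).1) * ψ e.1.2 at h2
    rw [h2]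
    group

/-- The sum over the homomorphisms that lift `g`, as a sum over labellings of the edges. -/
theorem sum_lifts [Fintype q.ker] (hs : ∀ e, q (s e).pt = g (S.edgeElt w e.1.1 e.1.2)) :
    Finite (Lifts q g) ∧
      (Nat.card q.ker : ℂ) * ∑ k : S.K.Edge → q.ker, weight (S.shifted s k) =
        (Nat.card q.ker : ℂ) ^ S.n * ∑ᶠ g' : Lifts q g,
          ((GrpTwo.eval (GrpTwo.pullback g'.1 (GrpTwo.cls θ)) (S.fundamentalClass w) : ℂˣ) : ℂ) := by
  obtain ⟨v, -⟩ := S.exists_mem_star w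
  have hinj := S.ofLift_injective s hs v
  -- With the trivial gauge, lifts inject into the finite set of edge labellings by Γ.
  have hfin : Finite (Lifts q g) := by
    refine Finite.of_injective (fun g' : Lifts q g => S.ofLift w s hs v (g', ⟨1, rfl⟩)) ?_
    intro x y hxy
    exact (Prod.mk.inj (hinj hxy)).1
  refine ⟨hfin, ?_⟩
  have := Fintype.ofFinite (Lifts q g)
  have := Fintype.ofFinite {φ : Fin S.n → q.ker // φ v = 1}
  -- Labellings outside the image of the pairs have weight zero.
  rw [finsum_eq_sum_of_fintype, ← Fintype.sum_of_injective _ hinj _ _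
    (fun k hk => by_contra fun h => hk (S.exists_ofLift s hs v k h)) (fun p => rfl)]
  simp only [weight_ofLift]
  rw [Fintype.sum_prod_type]
  simp only [Finset.sum_const, Finset.card_univ, nsmul_eq_mul]
  rw [← Finset.mul_sum, ← mul_assoc, ← Nat.card_eq_fintype_card]
  have := card_pointed (Γ := q.ker) v
  rw [Nat.card_eq_fintype_card (α := Fin S.n), Fintype.card_fin] at this
  rw [← Nat.cast_pow, ← this, Nat.cast_mul, mul_comm (Nat.card q.ker : ℂ)]

end ClosedOrientedSurface

/-! ### Schur's lemma and orthogonality for θ-representations -/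

/-- The preimage of the kernel of `q` in the central extension. -/
abbrev KerExt {G G' : Type*} [Group G] [Group G'] (θ : GrpTwo.cocycles G') (q : G' →* G) :
    Type _ := (q.comp (proj (θ := θ))).ker

namespace KerExt

open ThetaRep

variable {G G' : Type*} [Group G] [Group G'] {θ : GrpTwo.cocycles G'} {q : G' →* G}

/-- The central scalars. -/
def cen (θ : GrpTwo.cocycles G') (q : G' →* G) (c : ℂˣ) : KerExt θ q :=
  ⟨TwistedExt.cen θ c, map_one q⟩

/-- The projection to `Γ`. -/
def base (y : KerExt θ q) : q.ker := ⟨y.1.pt, y.2⟩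

theorem mul_el (y : KerExt θ q) (h : q.ker) :
    y * el h = cen θ q (y.1.sc * θ.1 y.1.pt h) * el (base y * h) := by
  apply Subtype.ext
  change y.1 * std θ h.1 = TwistedExt.cen θ _ * std θ (y.1.pt * h.1)
  rw [cen_mul_eq]
  ext1
  · rfl
  · simp [mul_sc, std]

theorem eq_cen_mul_el (y : KerExt θ q) : y = cen θ q y.1.sc * el (base y) := by
  apply Subtype.ext
  change y.1 = TwistedExt.cen θ _ * std θ y.1.pt
  rw [cen_mul_eq]
  ext1
  · rfl
  · simp [std]

/-- The preimage of Γ is infinite, so averages are taken over standard lifts. For a function blind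
to central scalars this sum is still invariant under translation. -/
theorem sum_mul_el [Fintype q.ker] {A : Type*} [AddCommMonoid A] (F : KerExt θ q → A)
    (hF : ∀ c y, F (cen θ q c * y) = F y) (y : KerExt θ q) :
    ∑ h, F (y * el h) = ∑ h, F (el h) := by
  refine (Finset.sum_congr rfl fun h _ => ?_).trans
    (Equiv.sum_comp (Equiv.mulLeft (base y)) fun h => F (el h))
  rw [mul_el, hF]
  rfl

theorem cj_cen (x : TwistedExt θ) (c : ℂˣ) : cj x (cen θ q c) = cen θ q c := by
  apply Subtype.ext
  change x⁻¹ * TwistedExt.cen θ c * x = TwistedExt.cen θ c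
  rw [TwistedExt.cen_comm, mul_assoc, inv_mul_cancel, mul_one]

theorem cj_one (y : KerExt θ q) : cj 1 y = y := by
  apply Subtype.ext
  simp [cj]

theorem cj_cj_inv (x : TwistedExt θ) (y : KerExt θ q) : cj x (cj x⁻¹ y) = y := by
  rw [← cj_mul, inv_mul_cancel, cj_one]

/-- Conjugation as an automorphism. -/
def cjHom (x : TwistedExt θ) : KerExt θ q →* KerExt θ q where
  toFun := cj x
  map_one' := by apply Subtype.ext; simp [cj]
  map_mul' y z := by
    apply Subtype.ext
    simp only [cj, Subgroup.coe_mul]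
    group

end KerExt

namespace ThetaRep

open KerExt

variable {G G' : Type*} [Group G] [Group G'] {θ : GrpTwo.cocycles G'} {q : G' →* G} {n m l : ℕ}

theorem hat_cen (ρ : ThetaRep θ q n) (c : ℂˣ) : ρ.hat (KerExt.cen θ q c) = scal c := by
  have h := ρ.mul_eq 1 1
  rw [mul_one] at h
  change scal (c * (θ.1 1 1)⁻¹) * ρ.toFun 1 = scal c
  rw [mul_right_cancel h, ← scal_mul]
  simp

theorem hat_eq (ρ : ThetaRep θ q n) (y : KerExt θ q) :
    (ρ.hat y).1 = (y.1.sc : ℂ) • (ρ.toFun (base y)).1 := by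
  change (scal y.1.sc).1 * (ρ.toFun (base y)).1 = _
  rw [scal_val, Matrix.smul_mul, Matrix.one_mul]

/-- The `θ`-representation given by a homomorphism of the central extension. -/
def ofHom (hn : 0 < n) (H : KerExt θ q →* GL (Fin n) ℂ)
    (hH : ∀ c, H (KerExt.cen θ q c) = scal c) : ThetaRep θ q n where
  pos := hn
  toFun h := H (el h)
  mul_eq g h := by
    rw [← map_mul, mul_el, map_mul, hH]
    change scal (1 * _) * _ = _
    rw [one_mul]
    rfl

theorem hat_ofHom (hn : 0 < n) (H : KerExt θ q →* GL (Fin n) ℂ)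
    (hH : ∀ c, H (KerExt.cen θ q c) = scal c) (y : KerExt θ q) : (ofHom hn H hH).hat y = H y := by
  rw [eq_cen_mul_el y, map_mul, map_mul, hat_cen, hH, hat_el]
  rfl

theorem irreducible_iff (ρ : ThetaRep θ q n) : ρ.Irreducible ↔
    ∀ V : Submodule ℂ (Fin n → ℂ), (∀ y, ∀ v ∈ V, Matrix.mulVec (ρ.hat y).1 v ∈ V) →
      V = ⊥ ∨ V = ⊤ := by
  refine forall_congr' fun V => imp_congr_left ⟨fun h y v hv => ?_, fun h x v hv => ?_⟩
  · rw [hat_eq, Matrix.smul_mulVec]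
    exact V.smul_mem _ (h _ v hv)
  · have := h (el x) v hv
    rwa [hat_el] at this

/-- The kernel and the range of an intertwiner are invariant, hence trivial or everything. -/
theorem schur_dichotomy {ρ : ThetaRep θ q n} {ρ' : ThetaRep θ q m} (hρ : ρ.Irreducible)
    (hρ' : ρ'.Irreducible) (T : Matrix (Fin n) (Fin m) ℂ)
    (hT : ∀ y, (ρ.hat y).1 * T = T * (ρ'.hat y).1) :
    T = 0 ∨ ∃ Q : Matrix (Fin m) (Fin n) ℂ, T * Q = 1 ∧ Q * T = 1 := by
  have h1 := (irreducible_iff ρ').1 hρ' (LinearMap.ker T.mulVecLin) (by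
    intro y v hv
    rw [LinearMap.mem_ker, Matrix.mulVecLin_apply] at hv ⊢
    rw [Matrix.mulVec_mulVec, ← hT, ← Matrix.mulVec_mulVec, hv, Matrix.mulVec_zero])
  have h2 := (irreducible_iff ρ).1 hρ (LinearMap.range T.mulVecLin) (by
    rintro y _ ⟨v, rfl⟩
    refine ⟨Matrix.mulVec (ρ'.hat y).1 v, ?_⟩
    rw [Matrix.mulVecLin_apply, Matrix.mulVecLin_apply, Matrix.mulVec_mulVec,
      Matrix.mulVec_mulVec, hT])
  have h0 : T.mulVecLin = 0 → T = 0 := fun h => by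
    apply Matrix.toLin'.injective
    rw [map_zero]
    exact h
  rcases h1 with h1 | h1
  · rcases h2 with h2 | h2
    · exact Or.inl (h0 (LinearMap.range_eq_bot.1 h2))
    · let e := LinearEquiv.ofBijective T.mulVecLin
        ⟨LinearMap.ker_eq_bot.1 h1, LinearMap.range_eq_top.1 h2⟩
      refine Or.inr ⟨LinearMap.toMatrix' e.symm.toLinearMap, ?_, ?_⟩
      · apply Matrix.toLin'.injective
        rw [Matrix.toLin'_mul, Matrix.toLin'_toMatrix', Matrix.toLin'_one]
        exact LinearMap.ext fun v => e.apply_symm_apply v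
      · apply Matrix.toLin'.injective
        rw [Matrix.toLin'_mul, Matrix.toLin'_toMatrix', Matrix.toLin'_one]
        exact LinearMap.ext fun v => e.symm_apply_apply v
  · exact Or.inl (h0 (LinearMap.ker_eq_top.1 h1))

/-- Subtracting an eigenvalue leaves an intertwiner that kills an eigenvector; not being invertible,
it is zero. -/
theorem schur_scalar {ρ : ThetaRep θ q n} (hρ : ρ.Irreducible) (T : Matrix (Fin n) (Fin n) ℂ)
    (hT : ∀ y, (ρ.hat y).1 * T = T * (ρ.hat y).1) : ∃ c : ℂ, T = c • 1 := by
  have : Nonempty (Fin n) := ⟨⟨0, ρ.pos⟩⟩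
  obtain ⟨μ, hμ⟩ := Module.End.exists_eigenvalue (Matrix.toLin' T)
  obtain ⟨v, hv⟩ := hμ.exists_hasEigenvector
  refine ⟨μ, ?_⟩
  rcases schur_dichotomy hρ hρ (T - μ • 1) (fun y => by
    rw [Matrix.mul_sub, Matrix.sub_mul, hT, Matrix.mul_smul, Matrix.smul_mul, Matrix.mul_one,
      Matrix.one_mul]) with h | ⟨Q, -, hQ⟩
  · exact sub_eq_zero.1 h
  · refine absurd ?_ hv.2
    have h1 : (T - μ • 1).mulVec v = 0 := by
      rw [Matrix.sub_mulVec, Matrix.smul_mulVec, Matrix.one_mulVec, sub_eq_zero]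
      exact hv.apply_eq_smul
    rw [← Matrix.one_mulVec v, ← hQ, ← Matrix.mulVec_mulVec, h1, Matrix.mulVec_zero]

/-- The average of a matrix over `Γ`. -/
def average [Fintype q.ker] (ρ : ThetaRep θ q n) (ρ' : ThetaRep θ q m)
    (C : Matrix (Fin n) (Fin m) ℂ) : Matrix (Fin n) (Fin m) ℂ :=
  ∑ h : q.ker, (ρ.hat (el h)).1 * C * (ρ'.hat (el h)⁻¹).1

/-- The scalars coming from z and from its inverse cancel in each summand, so `sum_mul_el` applies
and translation by y gives the commutation. -/
theorem average_comm [Fintype q.ker] (ρ : ThetaRep θ q n) (ρ' : ThetaRep θ q m)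
    (C : Matrix (Fin n) (Fin m) ℂ) (y : KerExt θ q) :
    (ρ.hat y).1 * average ρ ρ' C = average ρ ρ' C * (ρ'.hat y).1 := by
  have key := sum_mul_el (fun z => (ρ.hat z).1 * C * (ρ'.hat z⁻¹).1) (by
    intro c z
    rw [mul_inv_rev, map_mul, map_mul, hat_cen, map_inv ρ'.hat (KerExt.cen θ q c), hat_cen,
      ← scal_inv, Units.val_mul, Units.val_mul, scal_val, scal_val]
    simp [smul_smul]) y
  have h2 : average ρ ρ' C = (ρ.hat y).1 * average ρ ρ' C * (ρ'.hat y⁻¹).1 := by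
    rw [average, Matrix.mul_sum, Matrix.sum_mul, ← key]
    refine Finset.sum_congr rfl fun h _ => ?_
    rw [mul_inv_rev, map_mul, map_mul, Units.val_mul, Units.val_mul]
    simp only [Matrix.mul_assoc]
  have h3 : (ρ'.hat y⁻¹).1 * (ρ'.hat y).1 = 1 := by
    rw [← Units.val_mul, ← map_mul, inv_mul_cancel, map_one, Units.val_one]
  conv_rhs => rw [h2, Matrix.mul_assoc, h3, Matrix.mul_one]

theorem sum_hat_mul_hat_inv [Fintype q.ker] (ρ : ThetaRep θ q n) (ρ' : ThetaRep θ q m)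
    (i j : Fin n) (k l : Fin m) :
    ∑ h : q.ker, (ρ.hat (el h)).1 i j * (ρ'.hat (el h)⁻¹).1 k l =
      average ρ ρ' (Matrix.single j k 1) i l := by
  rw [average, Matrix.sum_apply]
  refine Finset.sum_congr rfl fun h _ => ?_
  rw [Matrix.mul_assoc, Matrix.mul_apply, Finset.sum_eq_single j]
  · rw [Matrix.single_mul_apply_same, one_mul]
  · intro b _ hb
    rw [Matrix.single_mul_apply_of_ne _ _ _ _ _ hb, mul_zero]
  · simp

/-- Schur orthogonality for one irreducible representation. -/
theorem orthogonality [Fintype q.ker] {ρ : ThetaRep θ q n} (hρ : ρ.Irreducible) (i j k l : Fin n) :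
    ∑ h : q.ker, (ρ.hat (el h)).1 i j * (ρ.hat (el h)⁻¹).1 k l =
      if i = l ∧ j = k then (Nat.card q.ker : ℂ) / n else 0 := by
  rw [sum_hat_mul_hat_inv]
  obtain ⟨c, hc⟩ := schur_scalar hρ _ (average_comm ρ ρ (Matrix.single j k 1))
  -- The average is a scalar matrix by Schur; its trace fixes the scalar and produces the factor
  -- |Γ|/n.
  have h1 : (average ρ ρ (Matrix.single j k 1)).trace =
      (Nat.card q.ker : ℂ) * if j = k then 1 else 0 := by
    rw [average, Matrix.trace_sum]
    have : ∀ h : q.ker, ((ρ.hat (el h)).1 * Matrix.single j k 1 * (ρ.hat (el h)⁻¹).1).trace =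
        if j = k then 1 else 0 := by
      intro h
      rw [Matrix.trace_mul_comm, ← Matrix.mul_assoc, ← Units.val_mul, ← map_mul, inv_mul_cancel,
        map_one, Units.val_one, Matrix.one_mul]
      split_ifs with hjk
      · rw [hjk, Matrix.trace_single_eq_same]
      · rw [Matrix.trace_single_eq_of_ne _ _ _ hjk]
    simp only [this, Finset.sum_const, Finset.card_univ, nsmul_eq_mul, Nat.card_eq_fintype_card]
  rw [hc, Matrix.trace_smul, Matrix.trace_one, Fintype.card_fin, smul_eq_mul] at h1
  have hn : (n : ℂ) ≠ 0 := Nat.cast_ne_zero.2 ρ.pos.ne'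
  rw [hc, Matrix.smul_apply, smul_eq_mul, Matrix.one_apply, eq_div_of_mul_eq hn h1]
  by_cases h2 : i = l <;> by_cases h3 : j = k <;> simp [h2, h3]

/-- Schur orthogonality for two different irreducible representations. -/
theorem orthogonality_ne [Fintype q.ker] {ρ : ThetaRep θ q n} {ρ' : ThetaRep θ q m}
    (hρ : ρ.Irreducible) (hρ' : ρ'.Irreducible)
    (hne : ¬ ∃ (P : Matrix (Fin n) (Fin m) ℂ) (Q : Matrix (Fin m) (Fin n) ℂ), P * Q = 1 ∧
      Q * P = 1 ∧ ∀ y, (ρ.hat y).1 * P = P * (ρ'.hat y).1)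
    (i j : Fin n) (k l : Fin m) :
    ∑ h : q.ker, (ρ.hat (el h)).1 i j * (ρ'.hat (el h)⁻¹).1 k l = 0 := by
  rw [sum_hat_mul_hat_inv]
  have h0 := average_comm ρ ρ' (Matrix.single j k 1)
  rcases schur_dichotomy hρ hρ' _ h0 with h | ⟨Q, h1, h2⟩
  · rw [h]; rfl
  · exact absurd ⟨_, Q, h1, h2, h0⟩ hne

end ThetaRep

/-! ### Complete reducibility, and the trace as a matrix coefficient -/

namespace ThetaRep

open KerExt

variable {G G' : Type*} [Group G] [Group G'] {θ : GrpTwo.cocycles G'} {q : G' →* G}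

/-- The span of the matrix coefficients of the irreducible `θ`-representations. -/
def coefficients (θ : GrpTwo.cocycles G') (q : G' →* G) : Submodule ℂ (q.ker → ℂ) :=
  Submodule.span ℂ {f | ∃ (n : ℕ) (ρ : ThetaRep θ q n), ρ.Irreducible ∧
    ∃ i j, f = fun h => (ρ.hat (el h)).1 i j}

section

variable {V : Type*} [AddCommGroup V] [Module ℂ V] (R : KerExt θ q →* Module.End ℂ V)

theorem end_inv_apply (y : KerExt θ q) (v : V) : R y (R y⁻¹ v) = v := by
  rw [← Module.End.mul_apply, ← map_mul, mul_inv_cancel, map_one, Module.End.one_apply]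

/-- Maschke's theorem for projective representations. -/
theorem exists_invariant_compl [Fintype q.ker]
    (hR : ∀ c : ℂˣ, R (KerExt.cen θ q c) = (c : ℂ) • 1) (U : Submodule ℂ V)
    (hU : ∀ y, ∀ u ∈ U, R y u ∈ U) :
    ∃ C : Submodule ℂ V, (∀ y, ∀ u ∈ C, R y u ∈ C) ∧ U ⊓ C = ⊥ ∧ U ⊔ C = ⊤ := by
  obtain ⟨p, hp⟩ := U.subtype.exists_leftInverse_of_injective U.ker_subtype
  have hp' : ∀ u (hu : u ∈ U), (p u : V) = u := fun u hu =>
    congrArg Subtype.val (LinearMap.congr_fun hp ⟨u, hu⟩)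
  -- Conjugates of a linear projection onto U do not see central scalars, so they can be averaged
  -- over Γ to an equivariant projection; its kernel is the complement.
  let F : KerExt θ q → Module.End ℂ V := fun y => R y * (U.subtype ∘ₗ p) * R y⁻¹
  have hF : ∀ c y, F (KerExt.cen θ q c * y) = F y := by
    intro c y
    have hinv : R (KerExt.cen θ q c)⁻¹ = ((c⁻¹ : ℂˣ) : ℂ) • 1 := by
      rw [← hR]
      congr 1
      rw [inv_eq_iff_mul_eq_one]
      apply Subtype.ext
      change TwistedExt.cen θ c * TwistedExt.cen θ c⁻¹ = 1
      rw [cen_inv, mul_inv_cancel]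
    simp only [F]
    rw [mul_inv_rev, map_mul, map_mul, hR, hinv]
    simp [smul_smul]
  let P : Module.End ℂ V := ((Nat.card q.ker : ℂ)⁻¹) • ∑ h : q.ker, F (el h)
  have hcard : (Nat.card q.ker : ℂ) ≠ 0 := Nat.cast_ne_zero.2 Nat.card_pos.ne'
  have hPmem : ∀ v, P v ∈ U := by
    intro v
    simp only [P, LinearMap.smul_apply, LinearMap.sum_apply]
    exact U.smul_mem _ (U.sum_mem fun h _ => hU _ _ (p _).2)
  have hPid : ∀ u ∈ U, P u = u := by
    intro u hu
    simp only [P, LinearMap.smul_apply, LinearMap.sum_apply]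
    have : ∀ h : q.ker, F (el h) u = u := by
      intro h
      change R _ (p (R _ u) : V) = u
      rw [hp' _ (hU _ _ hu), end_inv_apply]
    simp only [this, Finset.sum_const, Finset.card_univ, ← Nat.card_eq_fintype_card]
    rw [← Nat.cast_smul_eq_nsmul ℂ, smul_smul, inv_mul_cancel₀ hcard, one_smul]
  have hPcomm : ∀ y v, P (R y v) = R y (P v) := by
    intro y v
    have key := sum_mul_el F hF y
    have h1 : R y * (∑ h : q.ker, F (el h)) * R y⁻¹ = ∑ h : q.ker, F (el h) := by
      rw [Finset.mul_sum, Finset.sum_mul, ← key]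
      refine Finset.sum_congr rfl fun h _ => ?_
      simp only [F]
      rw [mul_inv_rev, map_mul, map_mul]
      simp only [mul_assoc]
    have h2 : R y * P = P * R y := by
      simp only [P, mul_smul_comm, smul_mul_assoc]
      congr 1
      conv_rhs => rw [← h1]
      rw [mul_assoc, ← map_mul, inv_mul_cancel, map_one, mul_one]
    exact (LinearMap.congr_fun h2 v).symm
  refine ⟨LinearMap.ker P, fun y u hu => ?_, ?_, ?_⟩
  · rw [LinearMap.mem_ker] at hu ⊢
    rw [hPcomm, hu, map_zero]
  · rw [eq_bot_iff]
    rintro u ⟨hu, hu'⟩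
    rw [SetLike.mem_coe, LinearMap.mem_ker, hPid u hu] at hu'
    exact hu'
  · rw [eq_top_iff]
    rintro u -
    rw [← add_sub_cancel (P u) u]
    refine Submodule.add_mem_sup (hPmem u) ?_
    rw [LinearMap.mem_ker, map_sub, hPid _ (hPmem u), sub_self]

/-- In a basis, the action on a minimal invariant subspace is an irreducible θ-representation, and
the coefficient is a linear combination of its matrix entries. -/
theorem coefficient_mem_of_minimal [FiniteDimensional ℂ V]
    (hR : ∀ c : ℂˣ, R (KerExt.cen θ q c) = (c : ℂ) • 1) (U : Submodule ℂ V)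
    (hU : ∀ y, ∀ u ∈ U, R y u ∈ U) (hne : U ≠ ⊥)
    (hmin : ∀ U' ≤ U, (∀ y, ∀ u ∈ U', R y u ∈ U') → U' = ⊥ ∨ U' = U) (u : V) (hu : u ∈ U)
    (ξ : V →ₗ[ℂ] ℂ) : (fun h : q.ker => ξ (R (el h) u)) ∈ coefficients θ q := by
  let b := Module.finBasis ℂ U
  have : Nontrivial U := Submodule.nontrivial_iff_ne_bot.2 hne
  let RU : KerExt θ q →* Module.End ℂ U :=
    { toFun := fun y => (R y).restrict (hU y)
      map_one' := by ext; simp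
      map_mul' := fun y z => by ext; simp }
  let H : KerExt θ q →* GL (Fin (Module.finrank ℂ U)) ℂ :=
    MonoidHom.toHomUnits ((LinearMap.toMatrixAlgEquiv b).toAlgHom.toRingHom.toMonoidHom.comp RU)
  have hH1 : ∀ y, (H y).1 = LinearMap.toMatrix b b (RU y) := fun y => rfl
  have hH : ∀ c, H (KerExt.cen θ q c) = scal c := by
    intro c
    apply Units.ext
    rw [scal_val, hH1]
    have : RU (KerExt.cen θ q c) = (c : ℂ) • LinearMap.id := by
      ext v
      change R (KerExt.cen θ q c) v = _
      rw [hR]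
      rfl
    rw [this, map_smul, LinearMap.toMatrix_id]
  let ρ := ofHom (Module.finrank_pos (R := ℂ) (M := U)) H hH
  have hρ : ρ.Irreducible := by
    rw [irreducible_iff]
    intro V' hV'
    let e : U ≃ₗ[ℂ] (Fin (Module.finrank ℂ U) → ℂ) := b.equivFun
    have hmul : ∀ y (x : U), e (RU y x) = Matrix.mulVec (ρ.hat y).1 (e x) := by
      intro y x
      rw [hat_ofHom, hH1]
      exact (LinearMap.toMatrix_mulVec_repr b b (RU y) x).symm
    have := hmin ((V'.comap e.toLinearMap).map U.subtype) (Submodule.map_subtype_le _ _) (by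
      rintro y _ ⟨x, hx, rfl⟩
      refine ⟨RU y x, ?_, rfl⟩
      change e (RU y x) ∈ V'
      rw [hmul]
      exact hV' y _ hx)
    rcases this with h | h
    · left
      rw [eq_bot_iff]
      intro v hv
      have h1 : U.subtype (e.symm v) ∈ (V'.comap e.toLinearMap).map U.subtype :=
        ⟨e.symm v, by
          change e (e.symm v) ∈ V'
          rwa [e.apply_symm_apply], rfl⟩
      rw [h, Submodule.mem_bot] at h1
      have h2 : e.symm v = 0 := Subtype.ext h1
      rw [Submodule.mem_bot, ← e.apply_symm_apply v, h2, map_zero]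
    · right
      rw [eq_top_iff]
      rintro v -
      have h1 : (e.symm v : V) ∈ (V'.comap e.toLinearMap).map U.subtype := h.ge (e.symm v).2
      obtain ⟨x, hx, hxv⟩ := h1
      rw [← e.apply_symm_apply v, ← Subtype.ext hxv]
      exact hx
  have hexp : (fun h : q.ker => ξ (R (el h) u)) = ∑ i, ∑ j,
      (b.repr ⟨u, hu⟩ j * ξ (b i)) • fun h : q.ker => (ρ.hat (el h)).1 i j := by
    funext h
    simp only [Finset.sum_apply, Pi.smul_apply, smul_eq_mul]
    have h1 : RU (el h) ⟨u, hu⟩ = ∑ i, (∑ j, (ρ.hat (el h)).1 i j * b.repr ⟨u, hu⟩ j) • b i := by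
      rw [← b.sum_repr (RU (el h) ⟨u, hu⟩)]
      refine Finset.sum_congr rfl fun i _ => ?_
      congr 1
      rw [hat_ofHom, hH1]
      exact (congrFun (LinearMap.toMatrix_mulVec_repr b b (RU (el h)) ⟨u, hu⟩) i).symm
    have h2 : R (el h) u = U.subtype (RU (el h) ⟨u, hu⟩) := rfl
    rw [h2, h1, map_sum, map_sum]
    refine Finset.sum_congr rfl fun i _ => ?_
    rw [map_smul, map_smul, smul_eq_mul, Finset.sum_mul]
    refine Finset.sum_congr rfl fun j _ => ?_
    change _ * ξ (b i) = _
    ring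
  rw [hexp]
  exact Submodule.sum_mem _ fun i _ => Submodule.sum_mem _ fun j _ =>
    Submodule.smul_mem _ _ (Submodule.subset_span ⟨_, ρ, hρ, i, j, rfl⟩)

/-- Induction on dimension: a proper nonzero invariant U' in U has an invariant complement C, and u
splits into parts in U' and in C ⊓ U, both of smaller dimension. -/
theorem coefficient_mem [Fintype q.ker] [FiniteDimensional ℂ V]
    (hR : ∀ c : ℂˣ, R (KerExt.cen θ q c) = (c : ℂ) • 1) (ξ : V →ₗ[ℂ] ℂ) (d : ℕ) :
    ∀ U : Submodule ℂ V, Module.finrank ℂ U = d → (∀ y, ∀ u ∈ U, R y u ∈ U) → ∀ u ∈ U,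
      (fun h : q.ker => ξ (R (el h) u)) ∈ coefficients θ q := by
  induction d using Nat.strong_induction_on with
  | _ d ih =>
    intro U hd hU u hu
    by_cases h0 : U = ⊥
    · rw [h0, Submodule.mem_bot] at hu
      simp only [hu, map_zero]
      exact Submodule.zero_mem _
    by_cases hmin : ∀ U' ≤ U, (∀ y, ∀ u ∈ U', R y u ∈ U') → U' = ⊥ ∨ U' = U
    · exact coefficient_mem_of_minimal R hR U hU h0 hmin u hu ξ
    push Not at hmin
    obtain ⟨U', hle, hU', hne, hne'⟩ := hmin
    obtain ⟨C, hC, hinf, hsup⟩ := exists_invariant_compl R hR U' hU'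
    have hu2 : u ∈ U' ⊔ C := hsup ▸ Submodule.mem_top
    obtain ⟨a, ha, c, hc, rfl⟩ := Submodule.mem_sup.1 hu2
    have hcU : c ∈ U := by
      have := U.sub_mem hu (hle ha)
      rwa [add_sub_cancel_left] at this
    have hlt : C ⊓ U < U := by
      refine lt_of_le_of_ne inf_le_right fun h => hne ?_
      rw [eq_bot_iff, ← hinf]
      exact le_inf le_rfl (hle.trans (h ▸ inf_le_left))
    have e1 := ih _ (hd ▸ Submodule.finrank_lt_finrank_of_lt (lt_of_le_of_ne hle hne')) U' rfl hU'
      a ha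
    have e2 := ih _ (hd ▸ Submodule.finrank_lt_finrank_of_lt hlt) (C ⊓ U) rfl
      (fun y u hu => ⟨hC y u hu.1, hU y u hu.2⟩) c ⟨hc, hcU⟩
    simp only [map_add]
    exact Submodule.add_mem _ e1 e2

end

/-- The regular representation, on functions on `Γ`. -/
def regular (θ : GrpTwo.cocycles G') (q : G' →* G) :
    KerExt θ q →* Module.End ℂ (q.ker → ℂ) where
  toFun y :=
    { toFun := fun f x => ((y.1.sc * θ.1 y.1.pt ((base y)⁻¹ * x : q.ker) : ℂˣ) : ℂ) *
        f ((base y)⁻¹ * x)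
      map_add' := fun f f' => by
        funext x
        exact mul_add _ _ _
      map_smul' := fun c f => by
        funext x
        exact mul_left_comm _ _ _ }
  map_one' := by
    ext1 f
    funext x
    change (((θ.1 1 1)⁻¹ * θ.1 1 (((1 : q.ker)⁻¹ * x : q.ker) : G') : ℂˣ) : ℂ) *
      f ((1 : q.ker)⁻¹ * x) = f x
    rw [cocycle_one_left θ (((1 : q.ker)⁻¹ * x : q.ker) : G'), inv_mul_cancel, inv_one, one_mul,
      Units.val_one, one_mul]
  map_mul' y z := by
    ext1 f
    funext x
    change ((y.1.sc * z.1.sc * θ.1 y.1.pt z.1.pt * θ.1 (y.1.pt * z.1.pt)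
        (((base y * base z)⁻¹ * x : q.ker)) : ℂˣ) : ℂ) * f ((base y * base z)⁻¹ * x) =
      ((y.1.sc * θ.1 y.1.pt ((base y)⁻¹ * x : q.ker) : ℂˣ) : ℂ) *
        (((z.1.sc * θ.1 z.1.pt ((base z)⁻¹ * ((base y)⁻¹ * x) : q.ker) : ℂˣ) : ℂ) *
          f ((base z)⁻¹ * ((base y)⁻¹ * x)))
    rw [← mul_assoc, ← Units.val_mul, mul_inv_rev, mul_assoc (base z)⁻¹]
    congr 2
    have h := θ.2 y.1.pt z.1.pt ((base z)⁻¹ * ((base y)⁻¹ * x) : q.ker)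
    have h2 : z.1.pt * (((base z)⁻¹ * ((base y)⁻¹ * x) : q.ker) : G') =
        (((base y)⁻¹ * x : q.ker) : G') := by
      change z.1.pt * (z.1.pt⁻¹ * (y.1.pt⁻¹ * x)) = y.1.pt⁻¹ * x
      rw [mul_inv_cancel_left]
    rw [h2] at h
    rw [mul_assoc (y.1.sc * z.1.sc), h]
    simp only [mul_assoc, mul_left_comm]

theorem regular_cen (c : ℂˣ) : regular θ q (KerExt.cen θ q c) = (c : ℂ) • 1 := by
  ext1 f
  funext x
  change ((c * (θ.1 1 1)⁻¹ * θ.1 1 (((1 : q.ker)⁻¹ * x : q.ker) : G') : ℂˣ) : ℂ) *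
    f ((1 : q.ker)⁻¹ * x) = (c : ℂ) * f x
  rw [cocycle_one_left θ (((1 : q.ker)⁻¹ * x : q.ker) : G'), inv_mul_cancel_right, inv_one, one_mul]

/-- The trace of the twisted group algebra is a combination of matrix coefficients. -/
theorem tau_mem_coefficients [Finite q.ker] :
    (fun h : q.ker => tau (std θ h.1)) ∈ coefficients θ q := by
  classical
  have := Fintype.ofFinite q.ker
  -- The trace is the coefficient of the regular representation between the delta function at 1 and
  -- evaluation at 1.
  have key := coefficient_mem (regular θ q) regular_cen (LinearMap.proj (1 : q.ker)) _ ⊤ rfl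
    (fun _ _ _ => Submodule.mem_top) (Pi.single 1 1) Submodule.mem_top
  convert key using 1
  funext h
  change tau (std θ h.1) = ((1 * θ.1 h.1 (h⁻¹ * 1 : q.ker) : ℂˣ) : ℂ) *
    (Pi.single 1 1 : q.ker → ℂ) (h⁻¹ * 1)
  rw [mul_one, one_mul]
  by_cases hh : h = 1
  · subst hh
    simp [tau, std]
  · rw [tau, if_neg (show ¬ (std θ h.1).pt = 1 from fun h' => hh (Subtype.ext h')),
      Pi.single_eq_of_ne (by simpa using hh), mul_zero]

end ThetaRep

/-! ### Intertwiners and the central extension given by ζ -/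

namespace KerExt

open ThetaRep

variable {G G' A : Type*} [Group G] [Group G'] [Group A] {θ : GrpTwo.cocycles G'} {q : G' →* G}
  (F : KerExt θ q →* A)

/-- The pairs `(x, V)` such that `F` and its conjugate by `x` differ by conjugation by `V`. -/
def intertwiners : Subgroup (TwistedExt θ × A) where
  carrier := {a | ∀ y, F (cj a.1 y) = a.2⁻¹ * F y * a.2}
  one_mem' := by
    intro y
    simp [cj_one]
  mul_mem' := by
    intro a b ha hb y
    rw [Prod.fst_mul, Prod.snd_mul, cj_mul, hb, ha]
    group
  inv_mem' := by
    intro a ha y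
    rw [Prod.fst_inv, Prod.snd_inv]
    have := ha (cj a.1⁻¹ y)
    rw [cj_cj_inv] at this
    rw [this]
    group

theorem apply_mem_intertwiners (y : KerExt θ q) : (y.1, F y) ∈ intertwiners F := by
  intro z
  rw [cj_coe, map_mul, map_mul, map_inv]

/-- The elements of the kernel as intertwiners. -/
def toIntertwiners : KerExt θ q →* intertwiners F where
  toFun y := ⟨(y.1, F y), apply_mem_intertwiners F y⟩
  map_one' := Subtype.ext (Prod.ext rfl (map_one F))
  map_mul' y z := Subtype.ext (Prod.ext rfl (map_mul F y z))

/-- The quotient by this image forgets the Γ-labels of the edges; it is used to show that scalars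
attached to triangles do not depend on them. -/
instance : (toIntertwiners F).range.Normal where
  conj_mem := by
    rintro _ ⟨y, rfl⟩ a
    refine ⟨cj a.1.1⁻¹ y, Subtype.ext (Prod.ext ?_ ?_)⟩
    · change a.1.1⁻¹⁻¹ * y.1 * a.1.1⁻¹ = a.1.1 * y.1 * a.1.1⁻¹
      rw [inv_inv]
    · change F (cj a.1.1⁻¹ y) = a.1.2 * F y * a.1.2⁻¹
      have := (intertwiners F).inv_mem a.2 y
      rw [Prod.fst_inv, Prod.snd_inv, inv_inv] at this
      exact this

end KerExt

namespace ThetaRep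

open KerExt

variable {G G' : Type*} [Group G] [Group G'] {θ : GrpTwo.cocycles G'} {q : G' →* G} {n : ℕ}
  (ρ : ThetaRep θ q n)

/-- The pairs `(x, V)` such that `ρ.hat` and its conjugate by `x` differ by conjugation by `V`. -/
abbrev implementers : Subgroup (TwistedExt θ × GL (Fin n) ℂ) := intertwiners ρ.hat

theorem mem_stab_iff {x : TwistedExt θ} :
    q x.pt ∈ ρ.stab ↔ ∃ V, (x, V) ∈ ρ.implementers := by
  refine ⟨fun h => ?_, fun ⟨V, hV⟩ => ⟨x.pt, rfl, V, (ρ.conj_iff x V).2 hV⟩⟩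
  obtain ⟨V, hV⟩ := ρ.exists_matrix h rfl
  exact ⟨V, (ρ.conj_iff x V).1 hV⟩

/-- The element of `G_ρ` under an implementer. -/
def implPt (a : ρ.implementers) : ρ.stab := ⟨q a.1.1.pt, ρ.mem_stab_iff.2 ⟨a.1.2, a.2⟩⟩

theorem implPt_mul (a b : ρ.implementers) : ρ.implPt (a * b) = ρ.implPt a * ρ.implPt b :=
  Subtype.ext (map_mul q _ _)

variable (hq : Function.Surjective q)

/-- The difference between an element of the extension and the chosen lift. -/
def implRem (a : ρ.implementers) : KerExt θ q :=
  ⟨(std θ (ρ.lift hq (ρ.implPt a)))⁻¹ * a.1.1, by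
    change q ((ρ.lift hq (ρ.implPt a))⁻¹ * a.1.1.pt) = 1
    rw [map_mul, map_inv, q_lift]
    exact inv_mul_cancel _⟩

theorem std_lift_mul_implRem (a : ρ.implementers) :
    std θ (ρ.lift hq (ρ.implPt a)) * (ρ.implRem hq a).1 = a.1.1 := mul_inv_cancel_left _ _

theorem mat_mem_implementers (α : ρ.stab) :
    (std θ (ρ.lift hq α), ρ.mat hq α) ∈ ρ.implementers :=
  (ρ.conj_iff (std θ (ρ.lift hq α)) _).1 (ρ.mat_spec hq α)

/-- The quotient of the two matrices implements the trivial conjugation, so it commutes with ρ and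
is scalar by Schur. -/
theorem exists_scal_of_implementers {ρ : ThetaRep θ q n} (hρ : ρ.Irreducible) {x : TwistedExt θ}
    {V V' : GL (Fin n) ℂ} (h : (x, V) ∈ ρ.implementers) (h' : (x, V') ∈ ρ.implementers) :
    ∃ c : ℂˣ, V = scal c * V' := by
  obtain ⟨c, hc⟩ := ρ.schur hρ (V * V'⁻¹) (by
    intro g
    have h3 := ρ.implementers.mul_mem h (ρ.implementers.inv_mem h') (el g)
    simp only [Prod.inv_mk, Prod.mk_mul_mk, mul_inv_cancel, cj_one, hat_el] at h3
    conv_lhs => rw [h3]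
    group)
  exact ⟨c, mul_inv_eq_iff_eq_mul.1 hc⟩

theorem exists_implSc (hρ : ρ.Irreducible) (a : ρ.implementers) :
    ∃ c : ℂˣ, a.1.2 = scal c * (ρ.mat hq (ρ.implPt a) * ρ.hat (ρ.implRem hq a)) := by
  have h := ρ.implementers.mul_mem (ρ.mat_mem_implementers hq (ρ.implPt a))
    (apply_mem_intertwiners ρ.hat (ρ.implRem hq a))
  rw [Prod.mk_mul_mk, std_lift_mul_implRem] at h
  exact exists_scal_of_implementers hρ a.2 h

/-- The scalar by which an implementer differs from the standard one. -/
def implSc (hρ : ρ.Irreducible) (a : ρ.implementers) : ℂˣ := (ρ.exists_implSc hq hρ a).choose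

theorem implSc_spec (hρ : ρ.Irreducible) (a : ρ.implementers) :
    a.1.2 = scal (ρ.implSc hq hρ a) * (ρ.mat hq (ρ.implPt a) * ρ.hat (ρ.implRem hq a)) :=
  (ρ.exists_implSc hq hρ a).choose_spec

theorem implSc_eq (hρ : ρ.Irreducible) {a : ρ.implementers} {c : ℂˣ}
    (h : a.1.2 = scal c * (ρ.mat hq (ρ.implPt a) * ρ.hat (ρ.implRem hq a))) :
    ρ.implSc hq hρ a = c :=
  scal_inj ρ.pos (mul_right_cancel ((ρ.implSc_spec hq hρ a).symm.trans h))

theorem mat_mul_mat (hρ : ρ.Irreducible) (α β : ρ.stab) :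
    ρ.mat hq α * ρ.mat hq β =
      scal (ρ.zeta hq hρ α β)⁻¹ * (ρ.mat hq (α * β) * ρ.hat (ρ.cc hq α β)) := by
  rw [scal_inv, eq_inv_mul_iff_mul_eq, zeta_spec, hat_cc, ← mul_assoc, ← mul_assoc, scal_comm]

/-- An implementer factors as a scalar times a chosen M_α times ρ of a remainder. In a product,
moving the first remainder past M_β conjugates it, and combining M_α with M_β costs ζ⁻¹. Hence the
inverse scalar multiplies as in the extension defined by ζ, which is why `implHom` inverts it. -/
theorem implSc_mul (hρ : ρ.Irreducible) (a b : ρ.implementers) :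
    ρ.implSc hq hρ (a * b) = ρ.implSc hq hρ a * ρ.implSc hq hρ b *
      (ρ.zeta hq hρ (ρ.implPt a) (ρ.implPt b))⁻¹ := by
  apply implSc_eq
  have hrem : ρ.implRem hq (a * b) = ρ.cc hq (ρ.implPt a) (ρ.implPt b) *
      (cj (std θ (ρ.lift hq (ρ.implPt b))) (ρ.implRem hq a) * ρ.implRem hq b) := by
    apply Subtype.ext
    simp only [implRem, cc, cj, Subgroup.coe_mul, implPt_mul, Prod.fst_mul]
    group
  have hcj := ρ.mat_mem_implementers hq (ρ.implPt b) (ρ.implRem hq a)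
  have hmm := ρ.mat_mul_mat hq hρ (ρ.implPt a) (ρ.implPt b)
  rw [hrem, implPt_mul, map_mul, map_mul, hcj, ← mul_assoc (ρ.mat hq _) (ρ.hat _), scal_mul,
    mul_assoc (scal _) (scal _⁻¹), ← mul_assoc (scal _⁻¹), ← hmm]
  change a.1.2 * b.1.2 = _
  conv_lhs => rw [ρ.implSc_spec hq hρ a, ρ.implSc_spec hq hρ b]
  rw [scal_mul]
  have := scal_comm (ρ.implSc hq hρ b) (ρ.mat hq (ρ.implPt a) * ρ.hat (ρ.implRem hq a))
  rw [mul_assoc, ← mul_assoc _ (scal (ρ.implSc hq hρ b)), this]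
  group

/-- The implementers map to the central extension of `G_ρ` determined by `ζ_ρ`. -/
def implHom (hρ : ρ.Irreducible) :
    ρ.implementers →* TwistedExt (⟨ρ.zeta hq hρ, ρ.zeta_mem hq hρ⟩ : GrpTwo.cocycles ρ.stab) :=
  MonoidHom.mk' (fun a => ⟨ρ.implPt a, (ρ.implSc hq hρ a)⁻¹⟩) (by
    intro a b
    ext1
    · exact ρ.implPt_mul a b
    · change (ρ.implSc hq hρ (a * b))⁻¹ = (ρ.implSc hq hρ a)⁻¹ * (ρ.implSc hq hρ b)⁻¹ *
        ρ.zeta hq hρ (ρ.implPt a) (ρ.implPt b)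
      rw [implSc_mul, mul_inv, mul_inv, inv_inv])

/-- Multiplying the identity by y only changes the remainder by y, and ρ of the new remainder
absorbs the new matrix. So the whole preimage of Γ dies and only G_ρ is seen. -/
theorem implHom_hat (hρ : ρ.Irreducible) (y : KerExt θ q) :
    ρ.implHom hq hρ ⟨(y.1, ρ.hat y), apply_mem_intertwiners ρ.hat y⟩ = 1 := by
  rw [← map_one (ρ.implHom hq hρ)]
  have hpt : ρ.implPt ⟨(y.1, ρ.hat y), apply_mem_intertwiners ρ.hat y⟩ = ρ.implPt 1 :=
    Subtype.ext (y.2.trans (map_one q).symm)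
  ext1
  · exact hpt
  · change (ρ.implSc hq hρ _)⁻¹ = (ρ.implSc hq hρ 1)⁻¹
    congr 1
    apply implSc_eq
    have hrem : ρ.implRem hq ⟨(y.1, ρ.hat y), apply_mem_intertwiners ρ.hat y⟩ =
        ρ.implRem hq 1 * y := by
      apply Subtype.ext
      change (std θ (ρ.lift hq _))⁻¹ * y.1 = (std θ (ρ.lift hq _))⁻¹ * 1 * y.1
      rw [hpt, mul_one]
    rw [hrem, hpt, map_mul, ← mul_assoc (ρ.mat hq _), ← mul_assoc, ← implSc_spec]
    exact (one_mul _).symm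

theorem implHom_scal (hρ : ρ.Irreducible) (a b : ρ.implementers) (c : ℂˣ) (h1 : a.1.1 = b.1.1)
    (h2 : a.1.2 = scal c * b.1.2) :
    ρ.implHom hq hρ a = TwistedExt.cen _ c⁻¹ * ρ.implHom hq hρ b := by
  rw [cen_mul_eq]
  have hpt : ρ.implPt a = ρ.implPt b := Subtype.ext (congrArg (fun x : TwistedExt θ => q x.pt) h1)
  ext1
  · exact hpt
  · change (ρ.implSc hq hρ a)⁻¹ = c⁻¹ * (ρ.implSc hq hρ b)⁻¹
    rw [← mul_inv]
    congr 1
    apply implSc_eq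
    have hrem : ρ.implRem hq a = ρ.implRem hq b := by
      apply Subtype.ext
      change (std θ (ρ.lift hq _))⁻¹ * _ = (std θ (ρ.lift hq _))⁻¹ * _
      rw [hpt, h1]
    rw [h2, hrem, hpt, scal_mul, mul_assoc, ← implSc_spec]

/-- Over y, an arbitrary implementer differs from ρ(y) by a scalar, and `implHom` records its
inverse. This lets ρ of a triangle boundary be replaced by a product of implementers along its
edges. -/
theorem hat_eq_tau_smul (hρ : ρ.Irreducible) (a : ρ.implementers) (y : KerExt θ q)
    (h : a.1.1 = y.1) : (ρ.hat y).1 = tau (ρ.implHom hq hρ a) • a.1.2.1 := by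
  obtain ⟨c, hc⟩ := exists_scal_of_implementers hρ (x := y.1) (V := a.1.2) (V' := ρ.hat y)
    (h ▸ a.2) (apply_mem_intertwiners ρ.hat y)
  rw [ρ.implHom_scal hq hρ a ⟨_, apply_mem_intertwiners ρ.hat y⟩ c h hc, implHom_hat, mul_one,
    tau_cen, hc, Units.val_mul, scal_val, Matrix.smul_mul, Matrix.one_mul, smul_smul, ← Units.val_mul,
    inv_mul_cancel, Units.val_one, one_smul]

end ThetaRep

/-! ### Equivalence classes of irreducibles and the action on them -/

namespace IrrClass

variable {G G' : Type*} [Group G] [Group G'] {θ : GrpTwo.cocycles G'} {q : G' →* G}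

/-- A representative of a class. -/
def rho (c : IrrClass θ q) : ThetaRep θ q c.dim := c.rep.1

theorem rho_irreducible (c : IrrClass θ q) : c.rho.Irreducible := c.rep.2

end IrrClass

namespace ThetaRep

open KerExt

variable {G G' : Type*} [Group G] [Group G'] {θ : GrpTwo.cocycles G'} {q : G' →* G} {n : ℕ}

/-- Equivalence of `θ`-representations, in terms of the homomorphisms `hat`. -/
def Intertwined {m : ℕ} (ρ : ThetaRep θ q n) (ρ' : ThetaRep θ q m) : Prop :=
  ∃ (P : Matrix (Fin n) (Fin m) ℂ) (Q : Matrix (Fin m) (Fin n) ℂ), P * Q = 1 ∧ Q * P = 1 ∧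
    ∀ y, (ρ.hat y).1 * P = P * (ρ'.hat y).1

theorem Intertwined.symm {m : ℕ} {ρ : ThetaRep θ q n} {ρ' : ThetaRep θ q m}
    (h : Intertwined ρ ρ') : Intertwined ρ' ρ := by
  obtain ⟨P, Q, hPQ, hQP, hP⟩ := h
  refine ⟨Q, P, hQP, hPQ, fun y => ?_⟩
  rw [← Matrix.one_mul (ρ'.hat y).1, ← hQP, Matrix.mul_assoc, Matrix.mul_assoc,
    ← Matrix.mul_assoc P, ← hP, Matrix.mul_assoc, hPQ, Matrix.mul_one]

theorem intertwined_iff {ρ ρ' : ThetaRep θ q n} :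
    Intertwined ρ ρ' ↔ ∃ M : GL (Fin n) ℂ, ∀ y, ρ'.hat y = M⁻¹ * ρ.hat y * M := by
  refine ⟨fun ⟨P, Q, hPQ, hQP, hP⟩ => ⟨⟨P, Q, hPQ, hQP⟩, fun y => ?_⟩,
    fun ⟨M, hM⟩ => ⟨M.1, M.2, M.3, M.4, fun y => ?_⟩⟩
  · rw [mul_assoc, eq_inv_mul_iff_mul_eq]
    exact Units.ext (hP y).symm
  · rw [← Units.val_mul, ← Units.val_mul, hM, mul_assoc, mul_inv_cancel_left]

theorem intertwined_iff_toFun {ρ ρ' : ThetaRep θ q n} :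
    Intertwined ρ ρ' ↔ ∃ M : GL (Fin n) ℂ, ∀ h, ρ'.toFun h = M⁻¹ * ρ.toFun h * M := by
  refine intertwined_iff.trans (exists_congr fun M => ⟨fun H h => ?_, fun H y => ?_⟩)
  · rw [← hat_el, ← hat_el, H]
  · change scal y.1.sc * ρ'.toFun _ = M⁻¹ * (scal y.1.sc * ρ.toFun _) * M
    rw [H, ← mul_assoc M⁻¹, scal_comm]
    simp only [mul_assoc]

/-- The class of an irreducible `θ`-representation. -/
def toClass (ρ : ThetaRep θ q n) (hρ : ρ.Irreducible) : IrrClass θ q :=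
  ⟨n, Quotient.mk (irrSetoid θ q n) ⟨ρ, hρ⟩⟩

theorem toClass_eq_iff {m : ℕ} {ρ : ThetaRep θ q n} {ρ' : ThetaRep θ q m} {hρ : ρ.Irreducible}
    {hρ' : ρ'.Irreducible} : ρ.toClass hρ = ρ'.toClass hρ' ↔ Intertwined ρ ρ' := by
  by_cases hnm : n = m
  · subst hnm
    rw [intertwined_iff_toFun]
    refine ⟨fun h => ?_, fun h => ?_⟩
    · exact Quotient.exact (s := irrSetoid θ q n) (eq_of_heq (Sigma.mk.inj h).2)
    · exact congrArg (Sigma.mk n) (Quotient.sound (s := irrSetoid θ q n) h)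
  · refine iff_of_false (fun h => hnm (congrArg IrrClass.dim h)) fun ⟨P, Q, hPQ, hQP, _⟩ => hnm ?_
    simpa using (Matrix.toLin'OfInv hQP hPQ).finrank_eq.symm

theorem toClass_rho (c : IrrClass θ q) : c.rho.toClass c.rho_irreducible = c :=
  Sigma.ext rfl (heq_of_eq (@Quotient.out_eq _ (irrSetoid θ q c.1) c.2))

theorem intertwined_rho (ρ : ThetaRep θ q n) (hρ : ρ.Irreducible) :
    Intertwined ρ (ρ.toClass hρ).rho :=
  toClass_eq_iff.1 (toClass_rho (ρ.toClass hρ)).symm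

theorem rho_not_intertwined {c d : IrrClass θ q} (h : c ≠ d) :
    ¬ Intertwined c.rho d.rho := fun h' =>
  h (by rw [← toClass_rho c, ← toClass_rho d]; exact toClass_eq_iff.2 h')

theorem rho_orthogonality [Fintype q.ker] (c : IrrClass θ q) (i j k l : Fin c.dim) :
    ∑ h : q.ker, (c.rho.hat (el h)).1 i j * (c.rho.hat (el h)⁻¹).1 k l =
      if i = l ∧ j = k then (Nat.card q.ker : ℂ) / c.dim else 0 :=
  orthogonality c.rho_irreducible i j k l

theorem rho_orthogonality_ne [Fintype q.ker] {c d : IrrClass θ q} (h : c ≠ d) (i j : Fin c.dim)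
    (k l : Fin d.dim) :
    ∑ h : q.ker, (c.rho.hat (el h)).1 i j * (d.rho.hat (el h)⁻¹).1 k l = 0 :=
  orthogonality_ne c.rho_irreducible d.rho_irreducible (rho_not_intertwined h) i j k l

/-- Characters of distinct classes are orthogonal against the characters at inverses, hence linearly
independent in the finite-dimensional space of functions on Γ. -/
theorem finite_irrClass [Finite q.ker] : Finite (IrrClass θ q) := by
  classical
  have := Fintype.ofFinite q.ker
  let f : IrrClass θ q → q.ker → ℂ := fun c h => (c.rho.hat (el h)).1.trace
  have key : ∀ c d : IrrClass θ q, ∑ h : q.ker, f c h * (d.rho.hat (el h)⁻¹).1.trace =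
      if c = d then (Nat.card q.ker : ℂ) else 0 := by
    intro c d
    simp only [f, Matrix.trace, Matrix.diag, Finset.sum_mul_sum]
    rw [Finset.sum_comm]
    simp only [Finset.sum_comm (s := (Finset.univ : Finset q.ker))]
    split_ifs with h
    · subst h
      have hn : (c.dim : ℂ) ≠ 0 := Nat.cast_ne_zero.2 c.rho.pos.ne'
      simp only [rho_orthogonality, and_self]
      simp
      field_simp
    · exact Finset.sum_eq_zero fun _ _ => Finset.sum_eq_zero fun _ _ => rho_orthogonality_ne h ..
  have hli : LinearIndependent ℂ f := by
    rw [linearIndependent_iff']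
    intro s a hs d hd
    have h1 : ∑ h : q.ker, (∑ c ∈ s, a c • f c) h * (d.rho.hat (el h)⁻¹).1.trace = 0 := by
      rw [hs]
      simp
    simp only [Finset.sum_apply, Pi.smul_apply, smul_eq_mul, Finset.sum_mul, mul_assoc] at h1
    rw [Finset.sum_comm] at h1
    simp only [← Finset.mul_sum, key] at h1
    rw [Finset.sum_eq_single d (fun c _ hc => by rw [if_neg hc, mul_zero])
      (fun h => absurd hd h), if_pos rfl] at h1
    exact (mul_eq_zero.1 h1).resolve_right (Nat.cast_ne_zero.2 Nat.card_pos.ne')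
  exact hli.finite

/-- The representation `y ↦ ρ(x⁻¹ y x)`. -/
def twist (x : TwistedExt θ) (ρ : ThetaRep θ q n) : ThetaRep θ q n :=
  ofHom ρ.pos (ρ.hat.comp (cjHom x)) (fun c => by
    change ρ.hat (cj x _) = _
    rw [cj_cen, hat_cen])

theorem twist_hat (x : TwistedExt θ) (ρ : ThetaRep θ q n) (y : KerExt θ q) :
    (ρ.twist x).hat y = ρ.hat (cj x y) := hat_ofHom ..

theorem Irreducible.twist {ρ : ThetaRep θ q n} (hρ : ρ.Irreducible) (x : TwistedExt θ) :
    (ρ.twist x).Irreducible := by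
  rw [irreducible_iff] at hρ ⊢
  intro V hV
  refine hρ V fun y v hv => ?_
  have := hV (cj x⁻¹ y) v hv
  rwa [twist_hat, cj_cj_inv] at this

theorem Intertwined.twist {m : ℕ} {ρ : ThetaRep θ q n} {ρ' : ThetaRep θ q m}
    (h : Intertwined ρ ρ') (x : TwistedExt θ) : Intertwined (ρ.twist x) (ρ'.twist x) := by
  obtain ⟨P, Q, hPQ, hQP, hP⟩ := h
  refine ⟨P, Q, hPQ, hQP, fun y => ?_⟩
  rw [twist_hat, twist_hat, hP]

theorem toClass_congr {ρ ρ' : ThetaRep θ q n} {hρ : ρ.Irreducible} {hρ' : ρ'.Irreducible}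
    (h : ∀ y, ρ.hat y = ρ'.hat y) : ρ.toClass hρ = ρ'.toClass hρ' :=
  toClass_eq_iff.2 (intertwined_iff.2 ⟨1, fun y => by rw [h]; group⟩)

/-- Twisting by conjugation is a left action. Its stabilizers are the preimages of the groups G_ρ,
and it factors through G by `smul_congr`. -/
instance : MulAction (TwistedExt θ) (IrrClass θ q) where
  smul x c := (c.rho.twist x).toClass (c.rho_irreducible.twist x)
  one_smul c := (toClass_congr fun y => by rw [twist_hat, cj_one]).trans (toClass_rho c)
  mul_smul x x' c := by
    refine (toClass_congr (hρ' := (c.rho_irreducible.twist x').twist x) fun y => ?_).trans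
      (toClass_eq_iff.2 ((intertwined_rho (c.rho.twist x') (c.rho_irreducible.twist x')).twist x))
    rw [twist_hat, twist_hat, twist_hat, cj_mul]

theorem smul_eq_toClass (x : TwistedExt θ) (c : IrrClass θ q) :
    x • c = (c.rho.twist x).toClass (c.rho_irreducible.twist x) := rfl

theorem smul_eq_self_iff {x : TwistedExt θ} {c : IrrClass θ q} :
    x • c = c ↔ q x.pt ∈ c.stab := by
  rw [IrrClass.stab, mem_stab_iff]
  have h1 : x • c = c ↔ Intertwined c.rho (c.rho.twist x) := by
    rw [← toClass_eq_iff (hρ := c.rho_irreducible) (hρ' := c.rho_irreducible.twist x), toClass_rho,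
      smul_eq_toClass, eq_comm]
  rw [h1, intertwined_iff]
  simp only [twist_hat]
  rfl

theorem smul_eq_self {x : TwistedExt θ} (hx : q x.pt = 1) (c : IrrClass θ q) : x • c = c :=
  smul_eq_self_iff.2 (hx ▸ c.stab.one_mem)

theorem smul_congr {x x' : TwistedExt θ} (h : q x.pt = q x'.pt) (c : IrrClass θ q) :
    x • c = x' • c := by
  rw [← inv_smul_eq_iff, ← mul_smul]
  apply smul_eq_self
  rw [mul_pt, inv_pt, map_mul, map_inv, h, inv_mul_cancel]

end ThetaRep

/-! ### The direct sum of all irreducibles -/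

namespace ThetaRep

open KerExt

variable {G G' : Type*} [Group G] [Group G'] {θ : GrpTwo.cocycles G'} {q : G' →* G}

/-- The index set of the direct sum of all irreducible `θ`-representations. -/
abbrev IrrIndex (θ : GrpTwo.cocycles G') (q : G' →* G) : Type _ := Σ c : IrrClass θ q, Fin c.dim

variable [Fintype (IrrClass θ q)] [DecidableEq (IrrClass θ q)]

/-- The direct sum of all irreducible `θ`-representations. -/
def sumRep (θ : GrpTwo.cocycles G') (q : G' →* G) [Fintype (IrrClass θ q)]
    [DecidableEq (IrrClass θ q)] : KerExt θ q →* GL (IrrIndex θ q) ℂ :=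
  MonoidHom.toHomUnits
    { toFun := fun y => Matrix.blockDiagonal' fun c => (c.rho.hat y).1
      map_one' := by
        simp only [map_one, Units.val_one]
        exact Matrix.blockDiagonal'_one
      map_mul' := fun y z => by
        simp only [map_mul, Units.val_mul]
        exact Matrix.blockDiagonal'_mul _ _ }

theorem sumRep_val (y : KerExt θ q) :
    (sumRep θ q y).1 = Matrix.blockDiagonal' fun c => (c.rho.hat y).1 := rfl

theorem sumRep_same (y : KerExt θ q) (c : IrrClass θ q) (i j : Fin c.dim) :
    (sumRep θ q y).1 ⟨c, i⟩ ⟨c, j⟩ = (c.rho.hat y).1 i j := by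
  rw [sumRep_val, Matrix.blockDiagonal'_apply_eq]

theorem sumRep_ne (y : KerExt θ q) {c d : IrrClass θ q} (h : c ≠ d) (i : Fin c.dim)
    (j : Fin d.dim) : (sumRep θ q y).1 ⟨c, i⟩ ⟨d, j⟩ = 0 := by
  rw [sumRep_val, Matrix.blockDiagonal'_apply_ne _ _ _ h]

theorem sumRep_cen (c : ℂˣ) : (sumRep θ q (KerExt.cen θ q c)).1 = (c : ℂ) • 1 := by
  ext ⟨d, i⟩ ⟨d', j⟩
  by_cases h : d = d'
  · subst h
    rw [sumRep_same, hat_cen, scal_val]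
    simp [Matrix.one_apply]
  · rw [sumRep_ne _ h]
    simp [h]

theorem sumRep_orthogonality [Fintype q.ker] (p p' r s : IrrIndex θ q) :
    ∑ h : q.ker, (sumRep θ q (el h)).1 p p' * (sumRep θ q (el h)⁻¹).1 r s =
      if p = s ∧ p' = r then (if p.1 = p'.1 then (Nat.card q.ker : ℂ) / p.1.dim else 0) else 0 := by
  obtain ⟨c, i⟩ := p
  obtain ⟨c', j⟩ := p'
  obtain ⟨d, k⟩ := r
  obtain ⟨d', l⟩ := s
  by_cases hc : c = c'
  · subst hc
    by_cases hd : d = d'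
    · subst hd
      simp only [sumRep_same]
      by_cases hcd : c = d
      · subst hcd
        rw [rho_orthogonality]
        simp
      · rw [rho_orthogonality_ne hcd]
        simp [hcd]
    · simp only [sumRep_ne _ hd, mul_zero, Finset.sum_const_zero]
      rw [if_neg]
      rintro ⟨h1, h2⟩
      exact hd ((congrArg Sigma.fst h2).symm.trans (congrArg Sigma.fst h1))
  · simp [sumRep_ne _ hc, hc]

theorem coefficients_le_span : coefficients θ q ≤ Submodule.span ℂ
    (Set.range fun p : IrrIndex θ q × IrrIndex θ q => fun h : q.ker =>
      (sumRep θ q (el h)).1 p.1 p.2) := by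
  rw [coefficients, Submodule.span_le]
  rintro _ ⟨n, ρ, hρ, i, j, rfl⟩
  obtain ⟨c, P, Q, hPQ, -, hP⟩ : ∃ c : IrrClass θ q, Intertwined ρ c.rho :=
    ⟨_, intertwined_rho ρ hρ⟩
  have : (fun h : q.ker => (ρ.hat (el h)).1 i j) = ∑ a, ∑ b, (P i a * Q b j) •
      fun h : q.ker => (sumRep θ q (el h)).1 ⟨c, a⟩ ⟨c, b⟩ := by
    funext h
    have h1 : (ρ.hat (el h)).1 = P * (c.rho.hat (el h)).1 * Q := by
      rw [← hP, Matrix.mul_assoc, hPQ, Matrix.mul_one]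
    rw [h1]
    simp only [Matrix.mul_apply, Finset.sum_apply, Pi.smul_apply, smul_eq_mul, sumRep_same,
      Finset.sum_mul]
    rw [Finset.sum_comm]
    refine Finset.sum_congr rfl fun a _ => Finset.sum_congr rfl fun b _ => ?_
    ring
  rw [this]
  exact Submodule.sum_mem _ fun a _ => Submodule.sum_mem _ fun b _ =>
    Submodule.smul_mem _ _ (Submodule.subset_span ⟨(⟨c, a⟩, ⟨c, b⟩), rfl⟩)

theorem sum_tau_mul [Fintype q.ker] (r s : IrrIndex θ q) :
    ∑ h : q.ker, tau (std θ h.1) * (sumRep θ q (el h)⁻¹).1 r s = if r = s then 1 else 0 := by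
  rw [Finset.sum_eq_single (1 : q.ker)]
  · have h1 : (el (θ := θ) (1 : q.ker)) = KerExt.cen θ q (θ.1 1 1) := by
      apply Subtype.ext
      change std θ 1 = TwistedExt.cen θ _
      ext1
      · rfl
      · simp [TwistedExt.cen, std]
    have h2 : (KerExt.cen θ q (θ.1 1 1))⁻¹ = KerExt.cen θ q (θ.1 1 1)⁻¹ := by
      apply Subtype.ext
      exact (TwistedExt.cen_inv _).symm
    rw [h1, h2, sumRep_cen]
    simp [tau, std, Matrix.one_apply]
  · intro h _ hh
    rw [tau, if_neg (show ¬ (std θ h.1).pt = 1 from fun h' => hh (Subtype.ext h')), zero_mul]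
  · simp

/-- The trace of the twisted group algebra in terms of the irreducible representations. -/
theorem card_mul_tau [Finite q.ker] (y : KerExt θ q) :
    (Nat.card q.ker : ℂ) * tau y.1 = ∑ p : IrrIndex θ q, (p.1.dim : ℂ) * (sumRep θ q y).1 p p := by
  have := Fintype.ofFinite q.ker
  -- Only the existence of an expansion of `tau` in matrix coefficients is known so far; pairing it
  -- with coefficients at inverses identifies the numbers a.
  obtain ⟨a, ha⟩ := (Submodule.mem_span_range_iff_exists_fun ℂ).1
    (coefficients_le_span (tau_mem_coefficients (θ := θ) (q := q)))
  have hval : ∀ h : q.ker, tau (std θ h.1) = ∑ p : IrrIndex θ q × IrrIndex θ q,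
      a p * (sumRep θ q (el h)).1 p.1 p.2 := by
    intro h
    rw [← congrFun ha h]
    simp
  -- As `tau` is supported at 1, the pairing is a Kronecker delta: within a block, a is dim/|Γ| on
  -- the diagonal and zero off it.
  have hcoef : ∀ r s : IrrIndex θ q, a (s, r) *
      (if s.1 = r.1 then (Nat.card q.ker : ℂ) / s.1.dim else 0) = if r = s then 1 else 0 := by
    intro r s
    rw [← sum_tau_mul r s]
    simp only [hval, Finset.sum_mul, mul_assoc]
    rw [Finset.sum_comm]
    simp only [← Finset.mul_sum, sumRep_orthogonality]
    rw [Finset.sum_eq_single (s, r)]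
    · simp
    · rintro ⟨p, p'⟩ - hp
      rw [if_neg, mul_zero]
      rintro ⟨rfl, rfl⟩
      exact hp rfl
    · simp
  have hcard : (Nat.card q.ker : ℂ) ≠ 0 := Nat.cast_ne_zero.2 Nat.card_pos.ne'
  have hdim : ∀ c : IrrClass θ q, (c.dim : ℂ) ≠ 0 := fun c => Nat.cast_ne_zero.2 c.rho.pos.ne'
  have hel : ∀ h : q.ker, (Nat.card q.ker : ℂ) * tau (std θ h.1) =
      ∑ p : IrrIndex θ q, (p.1.dim : ℂ) * (sumRep θ q (el h)).1 p p := by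
    intro h
    rw [hval, Fintype.sum_prod_type, Finset.mul_sum]
    refine Finset.sum_congr rfl fun s _ => ?_
    rw [Finset.sum_eq_single s]
    · have := hcoef s s
      rw [if_pos rfl, if_pos rfl, mul_div_assoc', div_eq_one_iff_eq (hdim _)] at this
      rw [← this]
      ring
    · intro r _ hr
      have := hcoef r s
      rw [if_neg hr] at this
      by_cases hrs : s.1 = r.1
      · rw [if_pos hrs] at this
        rw [(mul_eq_zero.1 this).resolve_right (div_ne_zero hcard (hdim _)), zero_mul]
      · rw [show (sumRep θ q (el h)).1 s r = 0 from sumRep_ne _ hrs _ _, mul_zero]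
    · simp
  have hy := eq_cen_mul_el y
  have h1 : tau y.1 = y.1.sc * tau (std θ (base y).1) := by
    conv_lhs => rw [hy]
    exact tau_cen_mul _ _
  have h2 : (sumRep θ q y).1 = (y.1.sc : ℂ) • (sumRep θ q (el (base y))).1 := by
    conv_lhs => rw [hy]
    rw [map_mul, Units.val_mul, sumRep_cen, Matrix.smul_mul, Matrix.one_mul]
  rw [h1, h2, mul_left_comm, hel, Finset.mul_sum]
  refine Finset.sum_congr rfl fun p _ => ?_
  rw [Matrix.smul_apply, smul_eq_mul]
  ring

/-- The intertwiners of the sum of all irreducible `θ`-representations. -/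
abbrev sumImpl (θ : GrpTwo.cocycles G') (q : G' →* G) [Fintype (IrrClass θ q)]
    [DecidableEq (IrrClass θ q)] : Subgroup (TwistedExt θ × GL (IrrIndex θ q) ℂ) :=
  intertwiners (sumRep θ q)

/-- Twisting by x permutes the irreducible classes, so the twisted sum is again equivalent to the
sum of all of them. The matrix is assembled from equivalences between the twist of c and the
representative of x • c. -/
theorem exists_mem_sumImpl (x : TwistedExt θ) : ∃ U, (x, U) ∈ sumImpl θ q := by
  have h : ∀ c : IrrClass θ q, Intertwined (x • c).rho (c.rho.twist x) := fun c =>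
    (intertwined_rho (c.rho.twist x) (c.rho_irreducible.twist x)).symm
  choose P Q hPQ hQP hP using h
  let e : (Σ c : IrrClass θ q, Fin (x • c).dim) ≃ IrrIndex θ q :=
    Equiv.sigmaCongrLeft (β := fun c : IrrClass θ q => Fin c.dim) (MulAction.toPerm x)
  let U : GL (IrrIndex θ q) ℂ :=
    { val := (Matrix.blockDiagonal' P).submatrix e.symm id
      inv := (Matrix.blockDiagonal' Q).submatrix id e.symm
      val_inv := by
        rw [← Matrix.submatrix_mul _ _ _ _ _ Function.bijective_id, ← Matrix.blockDiagonal'_mul]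
        simp only [hPQ]
        rw [show (fun c : IrrClass θ q => (1 : Matrix (Fin (x • c).dim) (Fin (x • c).dim) ℂ)) = 1
          from rfl, Matrix.blockDiagonal'_one, Matrix.submatrix_one_equiv]
      inv_val := by
        rw [← Matrix.submatrix_mul _ _ _ _ _ e.symm.bijective, ← Matrix.blockDiagonal'_mul]
        simp only [hQP]
        rw [show (fun c : IrrClass θ q => (1 : Matrix (Fin c.dim) (Fin c.dim) ℂ)) = 1
          from rfl, Matrix.blockDiagonal'_one, Matrix.submatrix_id_id] }
  refine ⟨U, fun y => ?_⟩
  rw [mul_assoc, eq_inv_mul_iff_mul_eq]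
  apply Units.ext
  have h1 : (sumRep θ q y).1 = (Matrix.blockDiagonal' fun c : IrrClass θ q =>
      ((x • c).rho.hat y).1).submatrix e.symm e.symm := by
    rw [← Matrix.submatrix_id_id (sumRep θ q y).1, ← e.self_comp_symm, ← Matrix.submatrix_submatrix]
    congr 1
    ext ⟨c, i⟩ ⟨d, j⟩
    change (sumRep θ q y).1 ⟨x • c, i⟩ ⟨x • d, j⟩ = _
    by_cases h : c = d
    · subst h
      rw [sumRep_same, Matrix.blockDiagonal'_apply_eq]
    · rw [sumRep_ne _ (fun h' => h (MulAction.injective x h')),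
        Matrix.blockDiagonal'_apply_ne _ _ _ h]
  rw [Units.val_mul, Units.val_mul, h1, sumRep_val]
  change (Matrix.blockDiagonal' P).submatrix e.symm id * _ =
    _ * (Matrix.blockDiagonal' P).submatrix e.symm id
  rw [← Matrix.submatrix_id_id (Matrix.blockDiagonal' fun c : IrrClass θ q => (c.rho.hat _).1),
    ← Matrix.submatrix_mul _ _ _ _ _ Function.bijective_id,
    ← Matrix.submatrix_mul _ _ _ _ _ e.symm.bijective, ← Matrix.blockDiagonal'_mul,
    ← Matrix.blockDiagonal'_mul]
  simp only [hP, twist_hat]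

/-- An intertwiner over `x` maps the block `d` to the block `x • d`. -/
theorem block_mul {a : TwistedExt θ × GL (IrrIndex θ q) ℂ} (ha : a ∈ sumImpl θ q)
    (y : KerExt θ q) (c d : IrrClass θ q) :
    (c.rho.hat y).1 * (Matrix.of fun i j => a.2.1 ⟨c, i⟩ ⟨d, j⟩) =
      (Matrix.of fun i j => a.2.1 ⟨c, i⟩ ⟨d, j⟩) * (d.rho.hat (cj a.1 y)).1 := by
  have h : (sumRep θ q y).1 * a.2.1 = a.2.1 * (sumRep θ q (cj a.1 y)).1 := by
    rw [← Units.val_mul, ← Units.val_mul, ha y]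
    group
  ext i j
  have h1 := congrFun (congrFun h ⟨c, i⟩) ⟨d, j⟩
  rw [Matrix.mul_apply, Matrix.mul_apply, Fintype.sum_sigma, Fintype.sum_sigma,
    Finset.sum_eq_single c, Finset.sum_eq_single d] at h1
  · simp only [sumRep_same] at h1
    exact h1
  · intro c' _ hc'
    simp [sumRep_ne _ hc']
  · simp
  · intro c' _ hc'
    simp [sumRep_ne _ hc'.symm]
  · simp

/-- A block of an intertwiner over x maps a twisted irreducible to an irreducible, so by Schur it is
zero or an equivalence. -/
theorem eq_smul_of_ne_zero {a : TwistedExt θ × GL (IrrIndex θ q) ℂ} (ha : a ∈ sumImpl θ q)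
    {p p' : IrrIndex θ q} (h : a.2.1 p p' ≠ 0) : p.1 = a.1 • p'.1 := by
  rcases schur_dichotomy p.1.rho_irreducible (p'.1.rho_irreducible.twist a.1)
    (Matrix.of fun i j => a.2.1 ⟨p.1, i⟩ ⟨p'.1, j⟩) (fun y => by
      rw [twist_hat, block_mul ha]) with h1 | ⟨Q, hQ, hQ'⟩
  · exact absurd (congrFun (congrFun h1 p.2) p'.2) h
  · rw [smul_eq_toClass, ← toClass_rho p.1]
    exact toClass_eq_iff.2 ⟨_, Q, hQ, hQ', fun y => by rw [twist_hat, block_mul ha]⟩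

/-- The relation used along an edge of the triangulation. The support of the blocks of the
intertwiner turns into the condition that the edge carries the class at its end to the class at its
start. -/
theorem sum_intertwiner_orthogonality [Fintype q.ker] {a : TwistedExt θ × GL (IrrIndex θ q) ℂ}
    (ha : a ∈ sumImpl θ q) (p p' r s : IrrIndex θ q) :
    ∑ h : q.ker, (a.2 * sumRep θ q (el h)).1 p p' * (a.2 * sumRep θ q (el h))⁻¹.1 r s =
      if p = s ∧ p' = r then (if p.1 = a.1 • p'.1 then (Nat.card q.ker : ℂ) / p'.1.dim else 0)
      else 0 := by
  simp only [mul_inv_rev, ← map_inv, Units.val_mul, Matrix.mul_apply, Finset.sum_mul_sum]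
  rw [Finset.sum_comm]
  -- Orthogonality of the sum representation forces b = c; where the entry of the intertwiner is
  -- nonzero, the class of b is determined by that of p'.
  have h1 : ∀ b : IrrIndex θ q, ∑ h : q.ker, ∑ c : IrrIndex θ q,
      a.2.1 p b * (sumRep θ q (el h)).1 b p' * ((sumRep θ q (el h)⁻¹).1 r c * a.2⁻¹.1 c s) =
      if p' = r then (if p.1 = a.1 • p'.1 then (Nat.card q.ker : ℂ) / p'.1.dim else 0) *
        (a.2.1 p b * a.2⁻¹.1 b s) else 0 := by
    intro b
    rw [Finset.sum_comm, Finset.sum_eq_single b]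
    · have := sumRep_orthogonality b p' r b
      simp only [true_and] at this
      by_cases hb : a.2.1 p b = 0
      · simp [hb]
      have hb' := eq_smul_of_ne_zero ha hb
      simp only [hb', smul_left_cancel_iff]
      calc _ = a.2.1 p b * a.2⁻¹.1 b s * ∑ h : q.ker, (sumRep θ q (el h)).1 b p' *
            (sumRep θ q (el h)⁻¹).1 r b := by
            rw [Finset.mul_sum]
            exact Finset.sum_congr rfl fun _ _ => by ring
        _ = _ := by
            rw [this]
            split_ifs with h2 h3
            · rw [h3]; ring
            · ring
            · ring
    · intro c _ hc
      have := sumRep_orthogonality b p' r c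
      rw [if_neg (fun h => hc h.1.symm)] at this
      calc _ = a.2.1 p b * a.2⁻¹.1 c s * ∑ h : q.ker, (sumRep θ q (el h)).1 b p' *
            (sumRep θ q (el h)⁻¹).1 r c := by
            rw [Finset.mul_sum]
            exact Finset.sum_congr rfl fun _ _ => by ring
        _ = _ := by rw [this, mul_zero]
    · simp
  simp only [h1]
  by_cases hr : p' = r
  · simp only [if_pos hr, ← Finset.mul_sum, and_iff_left hr]
    have h2 : ∑ b, a.2.1 p b * a.2⁻¹.1 b s = if p = s then 1 else 0 := by
      rw [← Matrix.mul_apply, ← Units.val_mul, mul_inv_cancel, Units.val_one, Matrix.one_apply]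
    rw [h2]
    simp
  · simp [hr]

end ThetaRep

/-! ### Diagonal blocks and the scalars they carry -/

namespace ThetaRep

open KerExt

variable {G G' : Type*} [Group G] [Group G'] {θ : GrpTwo.cocycles G'} {q : G' →* G}
  [Fintype (IrrClass θ q)] [DecidableEq (IrrClass θ q)]

/-- The intertwiners that preserve the block of the class `c`. -/
def stabImpl (c : IrrClass θ q) : Subgroup (TwistedExt θ × GL (IrrIndex θ q) ℂ) :=
  sumImpl θ q ⊓ (MulAction.stabilizer (TwistedExt θ) c).comap (MonoidHom.fst _ _)

theorem mem_stabImpl_of_ker (c : IrrClass θ q) {a : TwistedExt θ × GL (IrrIndex θ q) ℂ}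
    (ha : a ∈ sumImpl θ q) (h : q a.1.pt = 1) : a ∈ stabImpl c := ⟨ha, smul_eq_self h c⟩

/-- The diagonal block of the class `c`. -/
def blockHom (c : IrrClass θ q) : stabImpl c →* GL (Fin c.dim) ℂ :=
  MonoidHom.toHomUnits
    { toFun := fun a => Matrix.of fun i j => a.1.2.1 ⟨c, i⟩ ⟨c, j⟩
      map_one' := by
        ext i j
        change (1 : Matrix (IrrIndex θ q) (IrrIndex θ q) ℂ) ⟨c, i⟩ ⟨c, j⟩ = _
        simp [Matrix.one_apply]
      map_mul' := by
        intro a b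
        ext i j
        change (a.1.2.1 * b.1.2.1) ⟨c, i⟩ ⟨c, j⟩ = _
        rw [Matrix.mul_apply, Fintype.sum_sigma, Finset.sum_eq_single c]
        · rfl
        · intro d _ hd
          -- An intertwiner fixing c has no entries from column block c to another block, so
          -- diagonal blocks multiply.
          refine Finset.sum_eq_zero fun k _ => mul_eq_zero_of_right _ ?_
          by_contra hne
          exact hd ((eq_smul_of_ne_zero b.2.1 hne).trans b.2.2)
        · simp }

/-- The diagonal block of the class `c` as an intertwiner. -/
def blockImpl (c : IrrClass θ q) : stabImpl c →* c.rho.implementers where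
  toFun a := ⟨(a.1.1, blockHom c a), fun y => by
    rw [mul_assoc, eq_inv_mul_iff_mul_eq]
    exact Units.ext (block_mul a.2.1 y c c).symm⟩
  map_one' := Subtype.ext (Prod.ext rfl (map_one _))
  map_mul' a b := Subtype.ext (Prod.ext rfl (map_mul _ a b))

variable (hq : Function.Surjective q)

/-- The map from the intertwiners that preserve the block of `c` to the central extension of the
stabilizer of `c` given by the cocycle `ζ`. -/
def zetaHom (c : IrrClass θ q) : stabImpl c →*
    TwistedExt (⟨c.rho.zeta hq c.rho_irreducible, c.rho.zeta_mem hq c.rho_irreducible⟩ :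
      GrpTwo.cocycles c.rho.stab) :=
  (c.rho.implHom hq c.rho_irreducible).comp (blockImpl c)

theorem zetaHom_ker (c : IrrClass θ q) (y : KerExt θ q) (a : stabImpl c)
    (ha : a.1 = (y.1, sumRep θ q y)) : zetaHom hq c a = 1 := by
  rw [← c.rho.implHom_hat hq c.rho_irreducible y]
  refine congrArg (c.rho.implHom hq c.rho_irreducible) (Subtype.ext (Prod.ext ?_ ?_))
  · exact (congrArg Prod.fst ha : a.1.1 = y.1)
  · apply Units.ext
    ext i j
    change a.1.2.1 ⟨c, i⟩ ⟨c, j⟩ = _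
    rw [ha]
    exact sumRep_same ..

/-- Intertwiners that differ by an element of the kernel have the same image. -/
theorem zetaHom_congr (c : IrrClass θ q) (a b : sumImpl θ q) (ha : a.1 ∈ stabImpl c)
    (hb : b.1 ∈ stabImpl c)
    (h : (QuotientGroup.mk a : sumImpl θ q ⧸ (toIntertwiners (sumRep θ q)).range) =
      QuotientGroup.mk b) : zetaHom hq c ⟨a.1, ha⟩ = zetaHom hq c ⟨b.1, hb⟩ := by
  obtain ⟨y, hy⟩ := QuotientGroup.eq.1 h
  rw [← inv_mul_eq_one, ← map_inv, ← map_mul]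
  exact zetaHom_ker hq c y _ (congrArg Subtype.val hy).symm

theorem sumRep_eq_tau_mul (c : IrrClass θ q) (a : stabImpl c) (y : KerExt θ q) (h : a.1.1 = y.1)
    (i j : Fin c.dim) :
    (sumRep θ q y).1 ⟨c, i⟩ ⟨c, j⟩ = tau (zetaHom hq c a) * a.1.2.1 ⟨c, i⟩ ⟨c, j⟩ := by
  rw [sumRep_same, c.rho.hat_eq_tau_smul hq c.rho_irreducible (blockImpl c a) y h]
  rfl

/-- In the character formula for `tau`, each diagonal entry of the representation is exchanged for
that of the intertwiner; the block scalars go into the diagonal matrix. -/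
theorem tau_eq_trace [Finite q.ker] (a : sumImpl θ q) (h : q a.1.1.pt = 1) :
    tau a.1.1 = (Matrix.diagonal (fun p : IrrIndex θ q => (p.1.dim : ℂ) / Nat.card q.ker *
      tau (zetaHom hq p.1 ⟨a.1, mem_stabImpl_of_ker p.1 a.2 h⟩)) * a.1.2.1).trace := by
  have hcard : (Nat.card q.ker : ℂ) ≠ 0 := Nat.cast_ne_zero.2 Nat.card_pos.ne'
  have h1 : tau a.1.1 = _ :=
    (eq_div_iff hcard).2 ((mul_comm _ _).trans (card_mul_tau (⟨a.1.1, h⟩ : KerExt θ q)))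
  rw [h1, Matrix.trace, Finset.sum_div]
  refine Finset.sum_congr rfl fun p _ => ?_
  rw [Matrix.diag_apply, Matrix.diagonal_mul]
  have := sumRep_eq_tau_mul hq p.1 ⟨a.1, mem_stabImpl_of_ker p.1 a.2 h⟩ ⟨a.1.1, h⟩ rfl p.2 p.2
  change (sumRep θ q ⟨a.1.1, h⟩).1 p p = _ * a.1.2.1 p p at this
  rw [this]
  ring

end ThetaRep

/-! ### Evaluation of the state sum by irreducibles -/

namespace ClosedOrientedSurface

open ThetaRep KerExt SurfaceComplex

variable {G G' W : Type*} [Group G] [Group G'] [TopologicalSpace W]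
  {q : G' →* G} {θ : GrpTwo.cocycles G'} (S : ClosedOrientedSurface W)

/-- A colouring of the vertices that is compatible with the action of the edges is constant, and
its value is fixed by the whole fundamental group. -/
theorem exists_class_of_coloring [PathConnectedSpace W] {w : W}
    {g : FundamentalGroup W w →* G} (s : S.K.Edge → TwistedExt θ)
    (hs : ∀ e, q (s e).pt = g (S.edgeElt w e.1.1 e.1.2)) (hq : Function.Surjective q)
    (f : Fin S.n → IrrClass θ q) (hf : ∀ e : S.K.Edge, f e.1.1 = s e • f e.1.2) :
    ∃ c : {c : IrrClass θ q // ∀ x, g x ∈ c.stab}, ∀ b, f b = c.1 := by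
  have hd : ∀ a b, S.K.Adj a b → ∀ x : TwistedExt θ, q x.pt = g (S.edgeElt w a b) →
      f a = x • f b := by
    intro a b hab x hx
    rcases lt_or_gt_of_ne (S.K.adj_ne hab) with h | h
    · have := hf ⟨(a, b), hab, h⟩
      rw [this]
      exact smul_congr ((hs ⟨(a, b), hab, h⟩).trans hx.symm) _
    · have h1 : s ⟨(b, a), S.K.adj_symm hab, h⟩ • f a = f b := (hf ⟨(b, a), _⟩).symm
      rw [← eq_inv_smul_iff] at h1
      rw [h1]
      refine smul_congr ?_ _
      rw [inv_pt, map_inv, hs, hx, S.edgeElt_swap w hab, map_inv, inv_inv]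
  obtain ⟨v, -⟩ := S.exists_mem_star w
  -- Transport of the colour along edges depends only on the value of g: γ = 1 gives that the
  -- colouring is constant, b = v that its value is fixed by g(π).
  have key : ∀ b γ, ∀ x : TwistedExt θ, q x.pt = g γ → f v = x • f b := by
    intro b γ
    refine S.edgeElt_induction w v (fun b γ => ∀ x : TwistedExt θ, q x.pt = g γ → f v = x • f b)
      ?_ ?_ b γ
    · intro x hx
      exact (smul_eq_self (hx.trans (map_one g)) _).symm
    · intro b b' γ hadj ih x hx
      obtain ⟨p, hp⟩ := hq (g (S.edgeElt w b b'))
      rw [ih (x * (std θ p)⁻¹) (by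
        rw [mul_pt, inv_pt, map_mul, map_inv, hx, show q (std θ p).pt = _ from hp, map_mul,
          mul_inv_cancel_right]), hd b b' hadj (std θ p) hp, ← mul_smul, inv_mul_cancel_right]
  have hconst : ∀ b, f b = f v := fun b => by
    rw [key b 1 1 ((map_one q).trans (map_one g).symm), one_smul]
  refine ⟨⟨f v, fun x => ?_⟩, hconst⟩
  obtain ⟨p, hp⟩ := hq (g x)
  rw [← hp]
  exact smul_eq_self_iff.1 (key v x (std θ p) hp).symm

section

variable [Fintype (IrrClass θ q)] [DecidableEq (IrrClass θ q)] (r : S.K.Edge → sumImpl θ q)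

/-- The labelling of the oriented edges by intertwiners, for elements of `Γ` at the edges. -/
def implLabel (k : S.K.Edge → q.ker) : S.K.Dart → sumImpl θ q :=
  extend fun e => r e * toIntertwiners (sumRep θ q) (el (k e))

theorem implLabel_fst (k : S.K.Edge → q.ker) (d : S.K.Dart) :
    (S.implLabel r k d).1.1 = S.shifted (fun e => (r e).1.1) k d :=
  map_extend _ ((MonoidHom.fst _ _).comp (sumImpl θ q).subtype) d

/-- The boundary of a triangle. -/
def implFace (k : S.K.Edge → q.ker) (t : S.K.Face) : sumImpl θ q :=
  S.implLabel r k (t.dart 0) * S.implLabel r k (t.dart 1) * S.implLabel r k (t.dart 2)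

/-- Modulo the image of the kernel, the label of an edge is that of `r e` alone. Hence the block
scalars of a triangle do not change with k. -/
theorem mk_implFace (k k' : S.K.Edge → q.ker) (t : S.K.Face) :
    (QuotientGroup.mk (S.implFace r k t) : sumImpl θ q ⧸ (toIntertwiners (sumRep θ q)).range) =
      QuotientGroup.mk (S.implFace r k' t) := by
  let Q := QuotientGroup.mk' (toIntertwiners (sumRep θ q)).range
  have h : ∀ k d, Q (S.implLabel r k d) = extend (fun e => Q (r e)) d := by
    intro k d
    rw [implLabel, map_extend]
    congr 1
    funext e
    exact QuotientGroup.mk_mul_of_mem _ ⟨_, rfl⟩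
  change Q (_ * _ * _) = Q (_ * _ * _)
  simp only [map_mul, h]

variable [PathConnectedSpace W] {w : W} {g : FundamentalGroup W w →* G}

theorem q_implLabel (hr : ∀ e, q (r e).1.1.pt = g (S.edgeElt w e.1.1 e.1.2))
    (k : S.K.Edge → q.ker) (d : S.K.Dart) :
    q (S.implLabel r k d).1.1.pt = g (S.edgeElt w d.1.1 d.1.2) := by
  refine (map_extend _ ((q.comp proj).comp ((MonoidHom.fst _ _).comp (sumImpl θ q).subtype))
    d).trans ?_
  have h := eq_extend (fun e : S.K.Edge => g (S.edgeElt w e.1.1 e.1.2))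
    (fun d : S.K.Dart => g (S.edgeElt w d.1.1 d.1.2)) (fun d => by
      rw [← map_inv, ← S.edgeElt_swap w d.2]
      rfl) (fun e => rfl)
  refine Eq.trans ?_ (congrFun h d).symm
  congr 1
  funext e
  change q ((r e).1.1.pt * (k e).1) = _
  rw [map_mul, hr, (k e).2, mul_one]

theorem q_implFace (hr : ∀ e, q (r e).1.1.pt = g (S.edgeElt w e.1.1 e.1.2))
    (k : S.K.Edge → q.ker) (t : S.K.Face) : q (S.implFace r k t).1.1.pt = 1 := by
  change q (((S.implLabel r k (t.dart 0)).1.1.pt * (S.implLabel r k (t.dart 1)).1.1.pt) *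
    (S.implLabel r k (t.dart 2)).1.1.pt) = 1
  rw [map_mul, map_mul, S.q_implLabel r hr, S.q_implLabel r hr, S.q_implLabel r hr, ← map_mul,
    ← map_mul]
  change g (S.edgeElt w t.1.1 t.1.2.1 * S.edgeElt w t.1.2.1 t.1.2.2 *
    S.edgeElt w t.1.2.2 t.1.1) = 1
  have h1 := t.2.1
  have h3 : S.K.Adj t.1.2.2 t.1.1 := ⟨_, S.K.rot (S.K.rot h1)⟩
  rw [S.edgeElt_tri w h1, S.edgeElt_swap w (S.K.adj_symm h3), mul_inv_cancel, map_one]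

theorem implLabel_mem_stabImpl (hr : ∀ e, q (r e).1.1.pt = g (S.edgeElt w e.1.1 e.1.2))
    (k : S.K.Edge → q.ker) (c : IrrClass θ q) (hc : ∀ x, g x ∈ c.stab) (d : S.K.Dart) :
    (S.implLabel r k d).1 ∈ stabImpl c :=
  ⟨(S.implLabel r k d).2, smul_eq_self_iff.2 (S.q_implLabel r hr k d ▸ hc _)⟩

variable (hr : ∀ e, q (r e).1.1.pt = g (S.edgeElt w e.1.1 e.1.2)) (hq : Function.Surjective q)

/-- The weight of a vertex label at a triangle. -/
def faceWeight (k : S.K.Edge → q.ker) (t : S.K.Face) (p : IrrIndex θ q) : ℂ :=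
  (p.1.dim : ℂ) / Nat.card q.ker * tau (zetaHom hq p.1 ⟨(S.implFace r k t).1,
    mem_stabImpl_of_ker p.1 (S.implFace r k t).2 (S.q_implFace r hr k t)⟩)

/-- Within one class the scalars are the triangle traces of a labelling in the extension given by ζ,
so `eval_eq_weight` applies to ζ as it did to θ. -/
theorem prod_faceWeight (k : S.K.Edge → q.ker) (c : IrrClass θ q) (hc : ∀ x, g x ∈ c.stab)
    (f : S.K.Face → Fin c.dim) :
    ∏ t, S.faceWeight r hr hq k t ⟨c, f t⟩ =
      ((c.dim : ℂ) / Nat.card q.ker) ^ Fintype.card S.K.Face *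
        ((GrpTwo.eval (GrpTwo.pullback (g.codRestrict c.stab hc) (c.zetaClass hq))
          (S.fundamentalClass w) : ℂˣ) : ℂ) := by
  let u : S.K.Dart → stabImpl c := fun d =>
    ⟨(S.implLabel r k d).1, S.implLabel_mem_stabImpl r hr k c hc d⟩
  have h := S.eval_eq_weight w
    (⟨c.rho.zeta hq c.rho_irreducible, c.rho.zeta_mem hq c.rho_irreducible⟩ :
      GrpTwo.cocycles c.rho.stab) (g.codRestrict c.stab hc) (fun d => zetaHom hq c (u d))
    (fun d => by
      rw [← map_inv]
      congr 1
      exact Subtype.ext (congrArg (fun a : sumImpl θ q => a.1) (extend_rev _ d)))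
    (fun d => Subtype.ext (S.q_implLabel r hr k d))
  simp only [faceWeight]
  rw [Finset.prod_mul_distrib, Finset.prod_const, Finset.card_univ]
  refine congrArg _ (Eq.trans ?_ h.symm)
  refine Finset.prod_congr rfl fun t _ => ?_
  rw [← map_mul, ← map_mul]
  rfl

/-- The scalars may be computed at any fixed k'. After that, k enters only through the edge
matrices, as `sum_prod_trace` requires. -/
theorem weight_eq_prod_trace [Finite q.ker] (k k' : S.K.Edge → q.ker) :
    weight (S.shifted (fun e => (r e).1.1) k) = ∏ t : S.K.Face,
      (Matrix.diagonal (S.faceWeight r hr hq k' t) * (S.implLabel r k (t.dart 0)).1.2.1 *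
        (S.implLabel r k (t.dart 1)).1.2.1 * (S.implLabel r k (t.dart 2)).1.2.1).trace := by
  refine Finset.prod_congr rfl fun t _ => ?_
  simp only [← implLabel_fst]
  refine (tau_eq_trace hq (S.implFace r k t) (S.q_implFace r hr k t)).trans ?_
  rw [Matrix.mul_assoc, Matrix.mul_assoc, ← Matrix.mul_assoc _ _ (S.implLabel r k (t.dart 2)).1.2.1]
  congr 3
  funext p
  refine congrArg _ (congrArg tau (zetaHom_congr hq p.1 _ _ _ _ (S.mk_implFace r k k' t)))

theorem sum_weight (hr : ∀ e, q (r e).1.1.pt = g (S.edgeElt w e.1.1 e.1.2))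
    (hq : Function.Surjective q) [Fintype q.ker]
    [Fintype {c : IrrClass θ q // ∀ x, g x ∈ c.stab}] :
    ∑ k : S.K.Edge → q.ker, weight (S.shifted (fun e => (r e).1.1) k) =
      ∑ c : {c : IrrClass θ q // ∀ x, g x ∈ c.stab}, (c.1.dim : ℂ) ^ S.n *
        (((c.1.dim : ℂ) / Nat.card q.ker) ^ Fintype.card S.K.Face *
          ((GrpTwo.eval (GrpTwo.pullback (g.codRestrict c.1.stab c.2) (c.1.zetaClass hq))
            (S.fundamentalClass w) : ℂˣ) : ℂ)) *
        ((Nat.card q.ker : ℂ) / c.1.dim) ^ Fintype.card S.K.Edge := by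
  -- The scalars are frozen at the trivial labelling.
  simp only [S.weight_eq_prod_trace r hr hq _ 1]
  rw [sum_prod_trace (fun k d => (S.implLabel r k d).1.2.1)
    (fun e h => ((r e).1.2 * sumRep θ q (el h)).1) (fun e h => ((r e).1.2 * sumRep θ q (el h))⁻¹.1)
    (fun k e => by rw [implLabel, extend_dart]; rfl)
    (fun k e => by rw [implLabel, extend_dart_rev]; rfl) _
    (fun e p p' => if p.1 = (r e).1.1 • p'.1 then (Nat.card q.ker : ℂ) / p'.1.dim else 0)
    (fun e => sum_intertwiner_orthogonality (r e).2)]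
  -- The power of dim to the number of vertices counts the choices of an index inside the block at
  -- every vertex.
  have hsum : ∀ c : {c : IrrClass θ q // ∀ x, g x ∈ c.stab}, (c.1.dim : ℂ) ^ S.n *
        (((c.1.dim : ℂ) / Nat.card q.ker) ^ Fintype.card S.K.Face *
          ((GrpTwo.eval (GrpTwo.pullback (g.codRestrict c.1.stab c.2) (c.1.zetaClass hq))
            (S.fundamentalClass w) : ℂˣ) : ℂ)) *
        ((Nat.card q.ker : ℂ) / c.1.dim) ^ Fintype.card S.K.Edge =
      ∑ f : Fin S.n → Fin c.1.dim, (∏ t : S.K.Face, S.faceWeight r hr hq 1 t ⟨c.1, f t.1.1⟩) *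
        ∏ e : S.K.Edge, if c.1 = (r e).1.1 • c.1 then (Nat.card q.ker : ℂ) / c.1.dim else 0 := by
    intro c
    have h1 : ∀ e, c.1 = (r e).1.1 • c.1 := fun e =>
      (smul_eq_self_iff.2 (hr e ▸ c.2 _)).symm
    simp only [S.prod_faceWeight r hr hq 1 c.1 c.2, if_pos (h1 _), Finset.prod_const,
      Finset.sum_const, Finset.card_univ, Fintype.card_pi, Fintype.card_fin, nsmul_eq_mul]
    push_cast
    ring
  simp only [hsum]
  rw [← Fintype.sum_sigma']
  symm
  -- Index functions whose classes vary, or are not fixed by g(π), contribute zero because some edge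
  -- factor vanishes.
  refine Fintype.sum_of_injective (fun x (a : Fin S.n) => (⟨x.1.1, x.2 a⟩ : IrrIndex θ q))
    ?_ _ _ ?_ ?_
  · obtain ⟨v, -⟩ := S.exists_mem_star w
    rintro ⟨⟨c, hc⟩, f⟩ ⟨⟨c', hc'⟩, f'⟩ h
    obtain rfl : c = c' := congrArg Sigma.fst (congrFun h v)
    obtain rfl : f = f' := funext fun a => eq_of_heq (Sigma.mk.inj (congrFun h a)).2
    rfl
  · intro f hf
    by_contra hne
    have h1 := Finset.prod_ne_zero_iff.1 (right_ne_zero_of_mul hne)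
    obtain ⟨c, hc⟩ := S.exists_class_of_coloring (fun e => (r e).1.1) hr hq (fun a => (f a).1)
      (fun e => by
        by_contra he
        exact h1 e (Finset.mem_univ e) (if_neg he))
    refine hf ⟨⟨c, fun a => Fin.cast (congrArg IrrClass.dim (hc a)) (f a).2⟩, ?_⟩
    funext a
    refine Sigma.ext (hc a).symm ?_
    exact (Fin.heq_ext_iff (congrArg IrrClass.dim (hc a)).symm).2 rfl
  · intro x
    rfl

end

end ClosedOrientedSurface

end

theorem theoremt2 {G G' W : Type*} [Group G] [Group G'] (q : G' →* G)
    (hq : Function.Surjective q) [Finite q.ker]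
    [TopologicalSpace W] [PathConnectedSpace W] (S : ClosedOrientedSurface W)
    (hgenus : S.eulerChar ≤ 0) (w : W)
    (θ : GrpTwo.cocycles G') (g : FundamentalGroup W w →* G) :
    Finite (Lifts q g) ∧ Finite (IrrClass θ q) ∧
      ∑ᶠ g' : Lifts q g,
          ((GrpTwo.eval (GrpTwo.pullback g'.1 (GrpTwo.cls θ)) (S.fundamentalClass w) : ℂˣ) : ℂ) =
        (Nat.card q.ker : ℂ) *
          ∑ᶠ c : {c : IrrClass θ q // ∀ x, g x ∈ c.stab},
            ((Nat.card q.ker : ℂ) / (c.1.dim : ℂ)) ^ (-S.eulerChar) *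
              ((GrpTwo.eval
                (GrpTwo.pullback (g.codRestrict c.1.stab c.2) (c.1.zetaClass hq))
                (S.fundamentalClass w) : ℂˣ) : ℂ) := by
  classical
  have hirr : Finite (IrrClass θ q) := ThetaRep.finite_irrClass
  have := Fintype.ofFinite (IrrClass θ q)
  have := Fintype.ofFinite q.ker
  have := Fintype.ofFinite {c : IrrClass θ q // ∀ x, g x ∈ c.stab}
  -- Any lifts of the values of g on the edges serve; the sum over Γ-labels covers all others.
  let s : S.K.Edge → TwistedExt θ := fun e =>
    TwistedExt.std θ (Function.surjInv hq (g (S.edgeElt w e.1.1 e.1.2)))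
  have hs : ∀ e, q (s e).pt = g (S.edgeElt w e.1.1 e.1.2) := fun e => Function.surjInv_eq hq _
  choose U hU using fun e => ThetaRep.exists_mem_sumImpl (q := q) (s e)
  obtain ⟨hfin, hsum⟩ := S.sum_lifts s hs
  refine ⟨hfin, hirr, ?_⟩
  have hcard : (Nat.card q.ker : ℂ) ≠ 0 := Nat.cast_ne_zero.2 Nat.card_pos.ne'
  have hw := S.sum_weight (fun e => ⟨(s e, U e), hU e⟩) hs hq
  simp only at hw
  rw [hw] at hsum
  -- Multiplying by |Γ|^n brings in the gauge count of the first evaluation; a comparison of powers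
  -- of |Γ| and dim ρ, class by class, remains.
  apply mul_left_cancel₀ (pow_ne_zero S.n hcard)
  rw [← hsum, mul_left_comm, finsum_eq_sum_of_fintype]
  congr 1
  rw [Finset.mul_sum]
  refine Finset.sum_congr rfl fun c _ => ?_
  have hdim : (c.1.dim : ℂ) ≠ 0 := Nat.cast_ne_zero.2 c.1.rho.pos.ne'
  have hχ : -S.eulerChar =
      -(S.n : ℤ) + Fintype.card S.K.Edge + -(Fintype.card S.K.Face : ℤ) := by
    rw [ClosedOrientedSurface.eulerChar, SurfaceComplex.eulerChar_eq]
    ring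
  have hne := div_ne_zero hcard hdim
  rw [hχ, zpow_add₀ hne, zpow_add₀ hne, zpow_neg, zpow_neg, zpow_natCast, zpow_natCast,
    zpow_natCast, ← inv_pow, ← inv_pow, inv_div, div_pow (c.1.dim : ℂ) _ S.n]
  field_simp
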